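/- Let $X$ be a connected, Hausdorff, paracompact, finite-dimensional smooth manifold and let $\pi:Y\to X$ be a smooth affine bundle, i.e. a smooth fibre bundle whose typical fibre is a finite-dimensional real affine space, with an atlas of smooth local trivializations whose transition maps are affine on fibres. Let $J^\infty Y=\varprojlim J^rY$ be its infinite-order jet space, with the projective limit topology and projections $\pi^\infty_r:J^\infty Y\to J^rY$, $\pi^\infty:J^\infty Y\to X$, and with coordinates $(x^\lambda,y^i_\Lambda)$, $0\le|\Lambda|$, induced by affine bundle charts. Let $\mathcal O^*_\infty$ be the algebra of pull-back forms on $J^\infty Y$ (pull-backs $\pi^{\infty *}_r\omega$ of exterior forms $\omega$ on some $J^rY$), and let $\mathcal Q^*_\infty$ be the algebra of locally pull-back forms (forms which near each point of $J^\infty Y$ are the pull-back of an exterior form on an open subset of some $J^rY$). For $\mathcal A=\mathcal Q$ or $\mathcal O$, let $\mathcal A^{k,m}_\infty$ be the space of forms in $\mathcal A^{k+m}_\infty$ that are locally combinations of products of $k$ contact forms $\theta^i_\Lambda=dy^i_\Lambda-y^i_{\lambda+\Lambda}dx^\lambda$ and $m$ basic forms $dx^\lambda$, and write $d=d_H+d_V$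 with $d_H:\mathcal A^{k,m}_\infty\to\mathcal A^{k,m+1}_\infty$ and $d_V:\mathcal A^{k,m}_\infty\to\mathcal A^{k+1,m}_\infty$. Let $\mathcal O^m(X)$ be the space of exterior $m$-forms on $X$. 1. For every $m\ge 0$ the complex $$0\to\mathcal O^m(X)\xrightarrow{\ \pi^{\infty *}\ }\mathcal Q^{0,m}_\infty\xrightarrow{\ d_V\ }\mathcal Q^{1,m}_\infty\xrightarrow{\ d_V\ }\cdots\xrightarrow{\ d_V\ }\mathcal Q^{k,m}_\infty\xrightarrow{\ d_V\ }\cdots$$ is exact: $\pi^{\infty *}$ is injective, a form in $\mathcal Q^{0,m}_\infty$ is $d_V$-closed if and only if it is the pull-back of a form on $X$, and for $k\ge1$ every $d_V$-closed form in $\mathcal Q^{k,m}_\infty$ is $d_V\sigma$ for some $\sigma\in\mathcal Q^{k-1,m}_\infty$. 2. The same holds with $\mathcal O^{*,*}_\infty$ in place of $\mathcal Q^{*,*}_\infty$. 3. The bundle $Y\to X$ has a global smooth section $s$. Given any such $s$, regard $Y$ as a vector bundle with zero section $s$, and let $y^i$ denote fibre coordinates relative to $s$ (in an affine bundle chart,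 the differences of the fibre coordinates and those of $s$; so $y^i\circ s=0$), with induced jet coordinates $y^i_\Lambda$. Then for all $k\ge1$, $m\ge0$ there is a globally defined operator $h:\mathcal Q^{k,m}_\infty\to\mathcal Q^{k-1,m}_\infty$, mapping $\mathcal O^{k,m}_\infty$ into $\mathcal O^{k-1,m}_\infty$, which in all such charts is given by $$h\varphi=\int_0^1 t^{k-1}\,\bigl[\overline y\rfloor\varphi(x^\lambda,t\,y^i_\Lambda)\bigr]\,dt,\qquad \overline y=y^i_\Lambda\partial_i^\Lambda,$$ where $\varphi(x^\lambda,ty^i_\Lambda)$ means that the coefficients of $\varphi$ in the basis $(dx^\lambda,\theta^i_\Lambda)$ are evaluated at $(x^\lambda,ty^i_\Lambda)$; and $h$ is a homotopy operator: $d_Vh\varphi+h\,d_V\varphi=\varphi$ for all $\varphi\in\mathcal Q^{k,m}_\infty$, $k\ge1$. -/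

import Mathlib

open Set Filter Topology MeasureTheory
open scoped Manifold ContDiff

noncomputable section

/-! ### Exterior forms on a space with prescribed local smooth functions

`S p` is the algebra of those real functions on `M` that are smooth near the point `p`. -/

namespace FormCalculus

variable {M N : Type*}

/-- Tangent vectors at `p`: the derivations at `p` of the algebra of functions smooth near `p`. -/
def Tangent (S : M → Subalgebra ℝ (M → ℝ)) (p : M) : Submodule ℝ (S p →ₗ[ℝ] ℝ) where
  carrier := {ξ | ∀ f g : S p, ξ (f * g) = f.1 p * ξ g + g.1 p * ξ f}
  zero_mem' := by intro f g; simp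
  add_mem' := by
    intro ξ η hξ hη f g
    have h1 := hξ f g
    have h2 := hη f g
    simp only [LinearMap.add_apply, h1, h2]
    ring
  smul_mem' := by
    intro a ξ hξ f g
    have h1 := hξ f g
    simp only [LinearMap.smul_apply, h1, smul_eq_mul]
    ring

open Classical in
/-- The differential `df` at `p`, for `f` smooth near `p` (and `0` for other `f`). -/
def dAt (S : M → Subalgebra ℝ (M → ℝ)) (p : M) (f : M → ℝ) : Tangent S p →ₗ[ℝ] ℝ :=
  if h : f ∈ S p then (LinearMap.applyₗ (⟨f, h⟩ : S p)) ∘ₗ (Tangent S p).subtype else 0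

/-- Fields of alternating `n`-forms on the tangent spaces, with no smoothness required. -/
abbrev Form (S : M → Subalgebra ℝ (M → ℝ)) (n : ℕ) : Type _ :=
  ∀ p : M, (Tangent S p) [⋀^Fin n]→ₗ[ℝ] ℝ

/-- `α = ∑ⱼ fⱼ dgⱼ₁ ∧ … ∧ dgⱼₙ` on `U`, where all `fⱼ` and `gⱼᵢ` are smooth on `U`. -/
def IsExpr (S : M → Subalgebra ℝ (M → ℝ)) (U : Set M) {n J : ℕ} (α : Form S n)
    (f : Fin J → M → ℝ) (g : Fin J → Fin n → M → ℝ) : Prop :=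
  (∀ p ∈ U, ∀ j, f j ∈ S p ∧ ∀ i, g j i ∈ S p) ∧
  ∀ p ∈ U, ∀ ξ : Fin n → Tangent S p,
    α p ξ = ∑ j, f j p * Matrix.det (Matrix.of fun a b => dAt S p (g j b) (ξ a))

/-- `α` is a smooth exterior form on the open set `W`. -/
def IsSmoothFormOn [TopologicalSpace M] (S : M → Subalgebra ℝ (M → ℝ)) (W : Set M) {n : ℕ}
    (α : Form S n) : Prop :=
  ∀ p ∈ W, ∃ U : Set M, IsOpen U ∧ p ∈ U ∧
    ∃ (J : ℕ) (f : Fin J → M → ℝ) (g : Fin J → Fin n → M → ℝ), IsExpr S U α f g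

/-- `ψ = dα`: near every point, `α = ∑ⱼ fⱼ dgⱼ₁ ∧ … ∧ dgⱼₙ` and
`ψ = ∑ⱼ dfⱼ ∧ dgⱼ₁ ∧ … ∧ dgⱼₙ` for suitable smooth functions. -/
def IsExtDeriv [TopologicalSpace M] (S : M → Subalgebra ℝ (M → ℝ)) {n : ℕ}
    (α : Form S n) (ψ : Form S (n + 1)) : Prop :=
  ∀ p : M, ∃ U : Set M, IsOpen U ∧ p ∈ U ∧
    ∃ (J : ℕ) (f : Fin J → M → ℝ) (g : Fin J → Fin n → M → ℝ), IsExpr S U α f g ∧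
      IsExpr S U ψ (fun _ _ => 1) (fun j => Fin.cons (f j) (g j))

/-- Smooth maps: pull-backs of locally smooth functions are locally smooth. -/
def IsSmoothMap (S : M → Subalgebra ℝ (M → ℝ)) (S' : N → Subalgebra ℝ (N → ℝ)) (F : M → N) :
    Prop :=
  ∀ p : M, ∀ f ∈ S' (F p), f ∘ F ∈ S p

variable {S : M → Subalgebra ℝ (M → ℝ)} {S' : N → Subalgebra ℝ (N → ℝ)} {F : M → N}

/-- The tangent map of a smooth map: `(F_* ξ) f = ξ (f ∘ F)`. -/
def pushforward (hF : IsSmoothMap S S' F) (p : M) : Tangent S p →ₗ[ℝ] Tangent S' (F p) where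
  toFun ξ :=
    ⟨{ toFun := fun f => ξ.1 ⟨f.1 ∘ F, hF p f.1 f.2⟩
       map_add' := fun f g =>
        ξ.1.map_add ⟨f.1 ∘ F, hF p f.1 f.2⟩ ⟨g.1 ∘ F, hF p g.1 g.2⟩
       map_smul' := fun a f => ξ.1.map_smul a ⟨f.1 ∘ F, hF p f.1 f.2⟩ },
     fun f g => ξ.2 ⟨f.1 ∘ F, hF p f.1 f.2⟩ ⟨g.1 ∘ F, hF p g.1 g.2⟩⟩
  map_add' _ _ := rfl
  map_smul' _ _ := rfl

/-- The pull-back of exterior forms by a smooth map. -/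
def pullback (hF : IsSmoothMap S S' F) {n : ℕ} (α : Form S' n) : Form S n :=
  fun p => (α (F p)).compLinearMap (pushforward hF p)

end FormCalculus

open FormCalculus

/-- A smooth affine bundle `Y → X` with typical fibre the affine space `F`: a smooth fibre bundle
with an atlas of smooth local trivializations whose transition maps are affine on the fibres. -/
structure AffineBundle (E E' F X Y : Type*)
    [NormedAddCommGroup E] [NormedSpace ℝ E] [NormedAddCommGroup E'] [NormedSpace ℝ E']
    [NormedAddCommGroup F] [NormedSpace ℝ F]
    [TopologicalSpace X] [ChartedSpace E X] [TopologicalSpace Y] [ChartedSpace E' Y] where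
  proj : Y → X
  atlas : Set (Bundle.Trivialization F proj)
  exists_mem : ∀ x : X, ∃ e ∈ atlas, x ∈ e.baseSet
  smooth : ∀ e ∈ atlas, ContMDiffOn 𝓘(ℝ, E') (𝓘(ℝ, E).prod 𝓘(ℝ, F)) ∞ e e.source
  smooth_symm : ∀ e ∈ atlas, ContMDiffOn (𝓘(ℝ, E).prod 𝓘(ℝ, F)) 𝓘(ℝ, E') ∞
    e.toOpenPartialHomeomorph.symm e.target
  affine : ∀ e ∈ atlas, ∀ e' ∈ atlas, ∀ x ∈ e.baseSet ∩ e'.baseSet, ∃ a : F →ᵃ[ℝ] F, ∀ v : F,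
    (e' (e.toOpenPartialHomeomorph.symm (x, v))).2 = a v

namespace AffineBundle

variable {E E' F X Y : Type*}
  [NormedAddCommGroup E] [NormedSpace ℝ E] [NormedAddCommGroup E'] [NormedSpace ℝ E']
  [NormedAddCommGroup F] [NormedSpace ℝ F]
  [TopologicalSpace X] [ChartedSpace E X] [TopologicalSpace Y] [ChartedSpace E' Y]

/-- Smooth local sections of `Y → X` (values outside `dom` are irrelevant). -/
structure LocalSection (B : AffineBundle E E' F X Y) where
  dom : Set X
  isOpen_dom : IsOpen dom
  toFun : X → Y
  smooth : ContMDiffOn 𝓘(ℝ, E) 𝓘(ℝ, E') ∞ toFun dom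
  proj_eq : ∀ x ∈ dom, B.proj (toFun x) = x

/-- Affine bundle charts: an affine local trivialization together with a smooth chart of `X`. -/
structure BundleChart (B : AffineBundle E E' F X Y) where
  triv : Bundle.Trivialization F B.proj
  triv_mem : triv ∈ B.atlas
  base : OpenPartialHomeomorph X E
  base_mem : base ∈ IsManifold.maximalAtlas 𝓘(ℝ, E) ∞ X

variable {B : AffineBundle E E' F X Y}

/-- The domain `U_X` in `X` over which a bundle chart is defined. -/
def BundleChart.dom (c : B.BundleChart) : Set X := c.base.source ∩ c.triv.baseSet

/-- The coordinate expression `y(x)` of a local section. -/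
def BundleChart.rep (c : B.BundleChart) (s : B.LocalSection) : E → F :=
  fun z => (c.triv (s.toFun (c.base.symm z))).2

/-! ### Jet spaces -/

/-- Coordinates `(x, y_Λ)`, `|Λ| ≤ r`; for `|Λ| = j` the `y_Λ` are the components of a `j`-linear
map (symmetric for every jet). -/
abbrev Coord (E F : Type*) [NormedAddCommGroup E] [NormedSpace ℝ E]
    [NormedAddCommGroup F] [NormedSpace ℝ F] (r : ℕ) : Type _ :=
  E × (∀ j : Fin (r + 1), ContinuousMultilinearMap ℝ (fun _ : Fin (j : ℕ) => E) F)

variable (B) in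
/-- A point of `X` with a smooth local section around it. -/
abbrev PreJet : Type _ := {p : X × B.LocalSection // p.1 ∈ p.2.dom}

variable (B) in
/-- Local sections have the same `r`-jet at `x` if their partial derivatives at `x` up to order
`r` agree in bundle charts. -/
def jetSetoid (r : ℕ) : Setoid B.PreJet where
  r p p' := p.1.1 = p'.1.1 ∧ ∀ c : B.BundleChart, p.1.1 ∈ c.dom → ∀ j ≤ r,
    iteratedFDeriv ℝ j (c.rep p.1.2) (c.base p.1.1) =
      iteratedFDeriv ℝ j (c.rep p'.1.2) (c.base p'.1.1)
  iseqv :=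
    { refl := fun _ => ⟨rfl, fun _ _ _ _ => rfl⟩
      symm := fun h => ⟨h.1.symm, fun c hc j hj => (h.2 c (h.1 ▸ hc) j hj).symm⟩
      trans := fun h h' => ⟨h.1.trans h'.1, fun c hc j hj =>
        (h.2 c hc j hj).trans (h'.2 c (h.1 ▸ hc) j hj)⟩ }

variable (B) in
/-- The jet manifold `J^r Y`. -/
def Jet (r : ℕ) : Type _ := Quotient (jetSetoid B r)

/-- The `r`-jet of a local section at a point of its domain. -/
def jet (r : ℕ) (s : B.LocalSection) (x : X) (hx : x ∈ s.dom) : B.Jet r :=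
  Quotient.mk (jetSetoid B r) ⟨(x, s), hx⟩

/-- The projection `J^r Y → X`. -/
def Jet.pt {r : ℕ} (q : B.Jet r) : X :=
  Quotient.lift (s := jetSetoid B r) (fun p : B.PreJet => p.1.1) (fun _ _ (h : _ ∧ _) => h.1) q

/-- The projection `J^{r'} Y → J^r Y`, `r ≤ r'`. -/
def Jet.trunc {r r' : ℕ} (h : r ≤ r') (q : B.Jet r') : B.Jet r :=
  Quotient.map (sa := jetSetoid B r') (sb := jetSetoid B r) id
    (fun _ _ hp => ⟨hp.1, fun c hc j hj => hp.2 c hc j (hj.trans h)⟩) q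

open Classical in
/-- The coordinates of an `r`-jet in a bundle chart (`0` outside the domain of the chart). -/
def BundleChart.coord (c : B.BundleChart) (r : ℕ) (q : B.Jet r) : Coord E F r :=
  Quotient.lift (s := jetSetoid B r)
    (fun p : B.PreJet => if p.1.1 ∈ c.dom then
      ((c.base p.1.1, fun j => iteratedFDeriv ℝ j (c.rep p.1.2) (c.base p.1.1)) : Coord E F r)
      else 0)
    (fun p p' h => by
      by_cases hc : p.1.1 ∈ c.dom
      · have hc' : p'.1.1 ∈ c.dom := h.1 ▸ hc
        simp only [hc, hc', if_true]
        refine Prod.ext ?_ ?_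
        · exact congrArg c.base h.1
        · funext j
          exact h.2 c hc j (Nat.lt_succ_iff.mp j.2)
      · have hc' : p'.1.1 ∉ c.dom := fun h' => hc (h.1.symm ▸ h')
        simp only [hc, hc', if_false]) q

/-- The manifold topology of `J^r Y`, generated by the bundle charts. -/
instance (r : ℕ) : TopologicalSpace (B.Jet r) :=
  TopologicalSpace.generateFrom
    {W | ∃ (c : B.BundleChart) (O : Set (Coord E F r)), IsOpen O ∧
      W = {q | q.pt ∈ c.dom ∧ c.coord r q ∈ O}}

variable (B) in
/-- The infinite-order jet space `J^∞ Y`: the projective limit of the `J^r Y`, with the projective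
limit topology. -/
abbrev JetInf : Type _ :=
  {q : ∀ r, B.Jet r // ∀ (r r' : ℕ) (h : r ≤ r'), (q r').trunc h = q r}

/-- `π^∞_r : J^∞ Y → J^r Y`. -/
def toJet (r : ℕ) (q : B.JetInf) : B.Jet r := q.1 r

/-- `π^∞ : J^∞ Y → X`. -/
def toBase (q : B.JetInf) : X := (toJet 0 q).pt

lemma Jet.pt_trunc {r r' : ℕ} (h : r ≤ r') (q : B.Jet r') : (q.trunc h).pt = q.pt := by
  induction q using Quotient.inductionOn with
  | h p => rfl

lemma pt_toJet (r : ℕ) (q : B.JetInf) : (toJet r q).pt = toBase q := by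
  have h := q.2 0 r (Nat.zero_le r)
  unfold toBase
  rw [show toJet 0 q = (toJet r q).trunc (Nat.zero_le r) from h.symm, Jet.pt_trunc]

/-- Forgetting the coordinates of order greater than `r`. -/
def coordTrunc (E F : Type*) [NormedAddCommGroup E] [NormedSpace ℝ E]
    [NormedAddCommGroup F] [NormedSpace ℝ F] {r r' : ℕ} (h : r ≤ r') (z : Coord E F r') :
    Coord E F r :=
  (z.1, fun j => z.2 ⟨j, lt_of_lt_of_le j.2 (Nat.succ_le_succ h)⟩)

lemma contDiff_coordTrunc {r r' : ℕ} (h : r ≤ r') : ContDiff ℝ ∞ (coordTrunc E F h) := by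
  unfold coordTrunc
  refine contDiff_fst.prodMk ?_
  rw [contDiff_pi]
  intro j
  exact (ContinuousLinearMap.proj (R := ℝ)
    (φ := fun i : Fin (r' + 1) => ContinuousMultilinearMap ℝ (fun _ : Fin (i : ℕ) => E) F)
    ⟨j, lt_of_lt_of_le j.2 (Nat.succ_le_succ h)⟩).contDiff.comp contDiff_snd

open Classical in
lemma coord_trunc (c : B.BundleChart) {r r' : ℕ} (h : r ≤ r') (q : B.Jet r') :
    c.coord r (q.trunc h) = coordTrunc E F h (c.coord r' q) := by
  induction q using Quotient.inductionOn with
  | h p =>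
    change (if p.1.1 ∈ c.dom then _ else _) = coordTrunc E F h (if p.1.1 ∈ c.dom then _ else _)
    by_cases hc : p.1.1 ∈ c.dom
    · simp only [hc, if_true]; rfl
    · simp only [hc, if_false]; rfl

open Classical in
lemma coord_fst (c : B.BundleChart) {r : ℕ} (q : B.Jet r) (hq : q.pt ∈ c.dom) :
    (c.coord r q).1 = c.base q.pt := by
  induction q using Quotient.inductionOn with
  | h p =>
    change (if p.1.1 ∈ c.dom then _ else _ : Coord E F r).1 = _
    have hc : p.1.1 ∈ c.dom := hq
    simp only [hc, if_true]; rfl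

/-! ### Smooth functions on `X`, `J^r Y` and `J^∞ Y` -/

variable (E X) in
/-- Functions on `X` that are smooth near `x`. -/
def smoothX (x : X) : Subalgebra ℝ (X → ℝ) where
  carrier := {f | ∀ᶠ z in 𝓝 x, ContMDiffAt 𝓘(ℝ, E) 𝓘(ℝ, ℝ) ∞ f z}
  mul_mem' := by
    intro f g hf hg
    filter_upwards [hf, hg] with z h1 h2 using h1.mul h2
  add_mem' := by
    intro f g hf hg
    filter_upwards [hf, hg] with z h1 h2 using h1.add h2
  algebraMap_mem' := fun a => Filter.Eventually.of_forall fun _ => contMDiffAt_const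

variable (B) in
/-- Functions on `J^r Y` that are smooth near `q`, that is, in every bundle chart around `q` they
are smooth functions of the coordinates near `q`. -/
def smoothJet (r : ℕ) (q : B.Jet r) : Subalgebra ℝ (B.Jet r → ℝ) where
  carrier := {f | ∀ c : B.BundleChart, q.pt ∈ c.dom →
    ∃ (O : Set (Coord E F r)) (g : Coord E F r → ℝ), IsOpen O ∧ c.coord r q ∈ O ∧
      ContDiffOn ℝ ∞ g O ∧ ∀ q' : B.Jet r, q'.pt ∈ c.dom → c.coord r q' ∈ O →
        f q' = g (c.coord r q')}
  mul_mem' := by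
    intro f f' hf hf' c hc
    obtain ⟨O, g, h1, h2, h3, h4⟩ := hf c hc
    obtain ⟨O', g', h1', h2', h3', h4'⟩ := hf' c hc
    refine ⟨O ∩ O', fun z => g z * g' z, h1.inter h1', ⟨h2, h2'⟩,
      (h3.mono inter_subset_left).mul (h3'.mono inter_subset_right), fun q' hq' hO => ?_⟩
    simp only [Pi.mul_apply, h4 q' hq' hO.1, h4' q' hq' hO.2]
  add_mem' := by
    intro f f' hf hf' c hc
    obtain ⟨O, g, h1, h2, h3, h4⟩ := hf c hc
    obtain ⟨O', g', h1', h2', h3', h4'⟩ := hf' c hc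
    refine ⟨O ∩ O', fun z => g z + g' z, h1.inter h1', ⟨h2, h2'⟩,
      (h3.mono inter_subset_left).add (h3'.mono inter_subset_right), fun q' hq' hO => ?_⟩
    simp only [Pi.add_apply, h4 q' hq' hO.1, h4' q' hq' hO.2]
  algebraMap_mem' := fun a c _ =>
    ⟨univ, fun _ => a, isOpen_univ, mem_univ _, contDiffOn_const, fun _ _ _ => rfl⟩

lemma smoothJet_trunc {r r' : ℕ} (h : r ≤ r') (q : B.Jet r') {f : B.Jet r → ℝ}
    (hf : f ∈ smoothJet B r (q.trunc h)) : f ∘ Jet.trunc h ∈ smoothJet B r' q := by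
  intro c hc
  obtain ⟨O, g, h1, h2, h3, h4⟩ := hf c (by rwa [Jet.pt_trunc])
  refine ⟨coordTrunc E F h ⁻¹' O, g ∘ coordTrunc E F h,
    h1.preimage (contDiff_coordTrunc h).continuous, ?_,
    h3.comp (contDiff_coordTrunc h).contDiffOn (fun _ hz => hz), fun q' hq' hO => ?_⟩
  · rwa [coord_trunc] at h2
  · have := h4 (q'.trunc h) (by rwa [Jet.pt_trunc]) (by rw [coord_trunc]; exact hO)
    simpa only [Function.comp_apply, coord_trunc] using this

lemma toJet_trunc {r r' : ℕ} (h : r ≤ r') (q : B.JetInf) :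
    (toJet r' q).trunc h = toJet r q := q.2 r r' h

lemma smoothJet_lift {r r' : ℕ} (h : r ≤ r') (q : B.JetInf) {f : B.Jet r → ℝ}
    (hf : f ∈ smoothJet B r (toJet r q)) :
    ∃ f' ∈ smoothJet B r' (toJet r' q), f ∘ toJet r = f' ∘ toJet (B := B) r' := by
  refine ⟨f ∘ Jet.trunc h, smoothJet_trunc h _ (by rwa [toJet_trunc]), ?_⟩
  funext q'
  simp only [Function.comp_apply, toJet_trunc]

variable (B) in
/-- Functions on `J^∞ Y` that are, near `q`, the pull-back of a smooth function on an open subset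
of some finite-order jet manifold. -/
def smoothInf (q : B.JetInf) : Subalgebra ℝ (B.JetInf → ℝ) where
  carrier := {f | ∃ r, ∃ g ∈ smoothJet B r (toJet r q), f =ᶠ[𝓝 q] g ∘ toJet r}
  mul_mem' := by
    rintro f f' ⟨r, g, hg, hf⟩ ⟨r', g', hg', hf'⟩
    obtain ⟨k, hk, hk1⟩ := smoothJet_lift (le_max_left r r') q hg
    obtain ⟨k', hk', hk1'⟩ := smoothJet_lift (le_max_right r r') q hg'
    rw [hk1] at hf
    rw [hk1'] at hf'
    exact ⟨max r r', k * k', mul_mem hk hk', hf.mul hf'⟩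
  add_mem' := by
    rintro f f' ⟨r, g, hg, hf⟩ ⟨r', g', hg', hf'⟩
    obtain ⟨k, hk, hk1⟩ := smoothJet_lift (le_max_left r r') q hg
    obtain ⟨k', hk', hk1'⟩ := smoothJet_lift (le_max_right r r') q hg'
    rw [hk1] at hf
    rw [hk1'] at hf'
    exact ⟨max r r', k + k', add_mem hk hk', hf.add hf'⟩
  algebraMap_mem' := fun a =>
    ⟨0, algebraMap ℝ _ a, Subalgebra.algebraMap_mem _ a, Filter.EventuallyEq.rfl⟩

lemma isSmoothMap_toJet (r : ℕ) :
    IsSmoothMap (smoothInf B) (smoothJet B r) (toJet r) :=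
  fun _ f hf => ⟨r, f, hf, Filter.EventuallyEq.rfl⟩

lemma smoothJet_pt (r : ℕ) (q : B.Jet r) {f : X → ℝ} (hf : f ∈ smoothX E X q.pt) :
    f ∘ Jet.pt ∈ smoothJet B r q := by
  intro c hc
  obtain ⟨U, hU, hUo, hqU⟩ := eventually_nhds_iff.mp hf
  have hO : IsOpen (c.base.target ∩ c.base.symm ⁻¹' U) :=
    c.base.isOpen_inter_preimage_symm hUo
  refine ⟨Prod.fst ⁻¹' (c.base.target ∩ c.base.symm ⁻¹' U), fun z => f (c.base.symm z.1),
    hO.preimage continuous_fst, ?_, ?_, ?_⟩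
  · rw [mem_preimage, coord_fst c q hc]
    exact ⟨c.base.map_source hc.1, by simpa [c.base.left_inv hc.1] using hqU⟩
  · have h1 : ContMDiffOn 𝓘(ℝ, E) 𝓘(ℝ, ℝ) ∞ f U := fun z hz => (hU z hz).contMDiffWithinAt
    have h2 : ContMDiffOn 𝓘(ℝ, E) 𝓘(ℝ, E) ∞ c.base.symm c.base.target :=
      contMDiffOn_symm_of_mem_maximalAtlas c.base_mem
    have h3 : ContMDiffOn 𝓘(ℝ, E) 𝓘(ℝ, ℝ) ∞ (f ∘ c.base.symm)
        (c.base.target ∩ c.base.symm ⁻¹' U) :=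
      h1.comp (h2.mono inter_subset_left) (fun z hz => hz.2)
    exact (contMDiffOn_iff_contDiffOn.mp h3).comp contDiff_fst.contDiffOn (fun _ hz => hz)
  · intro q' hq' _
    simp only [Function.comp_apply, coord_fst c q' hq', c.base.left_inv hq'.1]

lemma isSmoothMap_toBase : IsSmoothMap (smoothInf B) (smoothX E X) toBase :=
  fun _ _ hf => ⟨0, _, smoothJet_pt 0 _ hf, Filter.EventuallyEq.rfl⟩

/-! ### Forms on `J^∞ Y` and the vertical differential -/

variable (B) in
/-- `n`-forms on `J^∞ Y`, with no smoothness required. -/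
abbrev InfForm (n : ℕ) : Type _ := Form (smoothInf B) n

/-- `φ` is a pull-back form, `φ ∈ O^n_∞`: the pull-back of an exterior form on some `J^r Y`. -/
def IsPullbackForm {n : ℕ} (φ : B.InfForm n) : Prop :=
  ∃ (r : ℕ) (α : Form (smoothJet B r) n), IsSmoothFormOn (smoothJet B r) univ α ∧
    φ = pullback (isSmoothMap_toJet r) α

/-- `φ` is a locally pull-back form, `φ ∈ Q^n_∞`: near every point it is the pull-back of an
exterior form on an open subset of some `J^r Y`. -/
def IsLocallyPullbackForm {n : ℕ} (φ : B.InfForm n) : Prop :=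
  ∀ q : B.JetInf, ∃ (r : ℕ) (W : Set (B.Jet r)) (α : Form (smoothJet B r) n),
    IsOpen W ∧ toJet r q ∈ W ∧ IsSmoothFormOn (smoothJet B r) W α ∧
      ∀ q' : B.JetInf, toJet r q' ∈ W → φ q' = pullback (isSmoothMap_toJet r) α q'

/-- Tangent vectors vertical for `J^∞ Y → X`: those spanned by the `∂_i^Λ`. -/
def IsVertical {q : B.JetInf} (ξ : Tangent (smoothInf B) q) : Prop :=
  pushforward isSmoothMap_toBase q ξ = 0

open Classical in
/-- The pull-back `g ∘ j^r s ∘ π^∞`, a function on `J^∞ Y` near the fibre of a point of `s.dom`. -/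
def alongSection {r : ℕ} (g : B.Jet r → ℝ) (s : B.LocalSection) (q : B.JetInf) : ℝ :=
  if h : toBase q ∈ s.dom then g (jet r s (toBase q) h) else 0

/-- Tangent vectors annihilated by all contact 1-forms `dg - d(g ∘ j^r s ∘ π^∞)` at `q`, where
`j^{r+1} s` passes through `π^∞_{r+1}(q)`: those spanned by the total derivatives `d_λ`. -/
def IsCartan {q : B.JetInf} (ξ : Tangent (smoothInf B) q) : Prop :=
  ∀ (r : ℕ), ∀ g ∈ smoothJet B r (toJet r q), ∀ (s : B.LocalSection) (h : toBase q ∈ s.dom),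
    jet (r + 1) s (toBase q) h = toJet (r + 1) q →
      dAt (smoothInf B) q (g ∘ toJet r) ξ = dAt (smoothInf B) q (alongSection g s) ξ

/-- `φ` is a `k`-contact form of horizontal degree `m`, that is, a combination of products of `k`
contact forms `θ^i_Λ` and `m` basic forms `dx^λ`. As `(dx^λ, θ^i_Λ)` is dual to `(d_λ, ∂_i^Λ)`,
this says that `φ` vanishes on more than `k` vertical and on more than `m` Cartan arguments. -/
def IsBidegree (k m : ℕ) {n : ℕ} (φ : B.InfForm n) : Prop :=
  n = k + m ∧ ∀ (q : B.JetInf) (ξ : Fin n → Tangent (smoothInf B) q) (A : Finset (Fin n)),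
    ((k < A.card ∧ ∀ a ∈ A, IsVertical (ξ a)) ∨ (m < A.card ∧ ∀ a ∈ A, IsCartan (ξ a))) →
      φ q ξ = 0

/-- `φ ∈ Q^{k,m}_∞`. -/
def MemQ (k m : ℕ) {n : ℕ} (φ : B.InfForm n) : Prop :=
  IsLocallyPullbackForm φ ∧ IsBidegree k m φ

/-- `φ ∈ O^{k,m}_∞`. -/
def MemO (k m : ℕ) {n : ℕ} (φ : B.InfForm n) : Prop :=
  IsPullbackForm φ ∧ IsBidegree k m φ

/-- `ψ = d_V φ` for `φ ∈ Q^{k,m}_∞`: one has `dφ = ψ + η` with `ψ ∈ Q^{k+1,m}_∞` and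
`η = d_H φ ∈ Q^{k,m+1}_∞`. -/
def IsVerticalDiff (k m : ℕ) {n : ℕ} (φ : B.InfForm n) (ψ : B.InfForm (n + 1)) : Prop :=
  MemQ k m φ ∧ MemQ (k + 1) m ψ ∧
    ∃ η : B.InfForm (n + 1), MemQ k (m + 1) η ∧ IsExtDeriv (smoothInf B) φ (ψ + η)

variable (B) in
/-- Pull-back `π^{∞*}` onto `J^∞ Y` of forms on `X`. -/
def pullbackBase {n : ℕ} (α : Form (smoothX E X) n) : B.InfForm n := pullback isSmoothMap_toBase α

variable (B) in
/-- Exactness of `0 → O^m(X) → A^{0,m} → A^{1,m} → A^{2,m} → ⋯`, with the maps `π^{∞*}` and `d_V`,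
for a family `A^{k,m}` of spaces of forms on `J^∞ Y`. -/
def VerticalComplexExact (A : ℕ → ℕ → ∀ {n : ℕ}, B.InfForm n → Prop) (m : ℕ) : Prop :=
  (∀ α α' : Form (smoothX E X) m, IsSmoothFormOn (smoothX E X) univ α →
    IsSmoothFormOn (smoothX E X) univ α' → B.pullbackBase α = B.pullbackBase α' → α = α') ∧
  (∀ α : Form (smoothX E X) m, IsSmoothFormOn (smoothX E X) univ α →
    A 0 m (B.pullbackBase α) ∧ IsVerticalDiff 0 m (B.pullbackBase α) 0) ∧
  (∀ φ : B.InfForm m, A 0 m φ → IsVerticalDiff 0 m φ 0 →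
    ∃ α : Form (smoothX E X) m, IsSmoothFormOn (smoothX E X) univ α ∧ φ = B.pullbackBase α) ∧
  (∀ (k n : ℕ) (φ : B.InfForm (n + 1)), A (k + 1) m φ → IsVerticalDiff (k + 1) m φ 0 →
    ∃ σ : B.InfForm n, A k m σ ∧ IsVerticalDiff k m σ φ)

/-! ### The homotopy operator -/

/-- The two vectors have the same components in the frame `(d_λ, ∂_i^Λ)` of the chart `c`, and are
both vertical or both Cartan. -/
def SameComponents (c : B.BundleChart) {q q' : B.JetInf} (ξ : Tangent (smoothInf B) q)
    (ξ' : Tangent (smoothInf B) q') : Prop :=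
  (IsVertical ξ ∧ IsVertical ξ' ∧ ∀ (r : ℕ) (l : Coord E F r →L[ℝ] ℝ),
    dAt (smoothInf B) q (fun p => l (c.coord r (toJet r p))) ξ =
      dAt (smoothInf B) q' (fun p => l (c.coord r (toJet r p))) ξ') ∨
  (IsCartan ξ ∧ IsCartan ξ' ∧ ∀ l : E →L[ℝ] ℝ,
    dAt (smoothInf B) q (fun p => l (c.base (toBase p))) ξ =
      dAt (smoothInf B) q' (fun p => l (c.base (toBase p))) ξ')

/-- `σ = ∫₀¹ t^k [ȳ ⌋ φ(x^λ, t y^i_Λ)] dt` for a form `φ` of contact degree `k + 1`. Here `Y` is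
made a vector bundle with zero section `s`: in an arbitrary affine bundle chart `y^i_Λ` is replaced
by the fibre coordinates `y^i_Λ - ∂_Λ s^i` relative to `s`. The formula means that the components
in the basis `(dx^λ, θ^i_Λ)` are taken at the point `qt t` with coordinates `t y^i_Λ`, contracted
with `ȳ = y^i_Λ ∂_i^Λ` (the `y^i_Λ` being those of `q`), and integrated. -/
def IsHomotopyIntegral (s : B.LocalSection) (hs : s.dom = univ) (k : ℕ) {n : ℕ}
    (φ : B.InfForm (n + 1)) (σ : B.InfForm n) : Prop :=
  ∀ (c : B.BundleChart) (q : B.JetInf) (ξ : Fin n → Tangent (smoothInf B) q)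
    (qt : ℝ → B.JetInf) (ybar : ∀ t, Tangent (smoothInf B) (qt t))
    (ξt : ∀ t, Fin n → Tangent (smoothInf B) (qt t)),
    toBase q ∈ c.dom →
    let s₀ : ∀ r, Coord E F r := fun r =>
      c.coord r (jet r s (toBase q) (hs ▸ mem_univ (toBase q)))
    let y : ∀ r, Coord E F r := fun r => c.coord r (toJet r q) - s₀ r
    (∀ t ∈ Icc (0 : ℝ) 1, toBase (qt t) = toBase q ∧
      ∀ r, c.coord r (toJet r (qt t)) = s₀ r + t • y r) →
    (∀ t ∈ Icc (0 : ℝ) 1, IsVertical (ybar t) ∧ ∀ (r : ℕ) (l : Coord E F r →L[ℝ] ℝ),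
      dAt (smoothInf B) (qt t) (fun p => l (c.coord r (toJet r p))) (ybar t) = l (y r)) →
    (∀ t ∈ Icc (0 : ℝ) 1, ∀ a, SameComponents c (ξ a) (ξt t a)) →
    IntervalIntegrable (fun t => t ^ k * φ (qt t) (Fin.cons (ybar t) (ξt t))) volume 0 1 ∧
      σ q ξ = ∫ t in (0 : ℝ)..1, t ^ k * φ (qt t) (Fin.cons (ybar t) (ξt t))

end AffineBundle

end

/-! Fix a global section s. The contraction (t, x, y) ↦ (x, s(x) + t(y − s(x))) of Y onto s does not
depend on charts, because transition maps are affine on fibres (`BundleChart.exists_lineSection`).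
Prolonged to jets it gives maps `htpy s hs t` of J^∞Y. At t = 1 this is the identity, and at t = 0
it is the composite of π^∞ with x ↦ j^∞s(x).

Let K = `htpyOp s hs 0 1` integrate over t ∈ [0,1] the pull-back by `htpy s hs t` of the contraction
of φ with the velocity ȳ. Cartan's homotopy formula reads dKφ + Kdφ = φ − (htpy 0)^*φ
(`IsExtDeriv.htpyOp`). The velocity is vertical, and `htpy s hs t` maps vertical vectors to vertical
ones and Cartan vectors to Cartan ones. So K lowers the contact degree by one and keeps the
horizontal degree, and the formula splits by bidegree (`IsVerticalDiff.htpyOp`). Every vector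
becomes Cartan under `htpy s hs 0`, so (htpy 0)^*φ = 0 in positive contact degree. This leaves d_V K
+ K d_V = id, hence exactness there.

For φ of contact degree 0 with d_V φ = 0, both φ and dφ are killed by K. The formula then says φ =
(htpy 0)^*φ, the pull-back to J^∞Y of the form (j^∞s)^*φ on X (`eq_pullback_htpy_zero`). The power
t^(k-1) of the explicit formula comes from `htpy s hs t` multiplying the components of vertical
vectors by t (`contractHtpy_eq`).

The analysis takes place in finitely many jet coordinates. Tangent vectors are abstract derivations,
and Hadamard's lemma reduces them to their components (`IsCoordAt.dAt_eq`). Near a point a locally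
pull-back form is given by a form A on the vector space `Coord E F r`, but r and A may change along
the path t ↦ `htpy s hs t q`. Smoothness and the homotopy formula are therefore first proved on
short time intervals and then glued by connectedness of the time axis (`induction_Icc`). The
homotopy respects every jet order, so the same gluing with r fixed shows that K preserves pull-back
forms. Jets fill only the subspace `jetSub` of the coordinate space, so A is not unique; uniqueness
of d on J^∞Y is obtained by testing along curves (`IsExtDeriv.eq_zero`).

The section s is an affine combination of local sections, weighted by a partition of unity
(`exists_globalSection`). -/

noncomputable section

universe u

set_option linter.unusedSectionVars false

/-! ### Smooth functions near a point and parametric integrals -/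

/-- `g` is infinitely differentiable on a neighbourhood of `z`. -/
def SmoothNear {V W : Type*} [NormedAddCommGroup V] [NormedSpace ℝ V] [NormedAddCommGroup W]
    [NormedSpace ℝ W] (g : V → W) (z : V) : Prop :=
  ∀ᶠ z' in 𝓝 z, ContDiffAt ℝ ∞ g z'

namespace SmoothNear

variable {V W W' : Type*} [NormedAddCommGroup V] [NormedSpace ℝ V] [NormedAddCommGroup W]
    [NormedSpace ℝ W] [NormedAddCommGroup W'] [NormedSpace ℝ W']

lemma contDiffAt {g : V → W} {z : V} (h : SmoothNear g z) : ContDiffAt ℝ ∞ g z := h.self_of_nhds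

lemma differentiableAt {g : V → W} {z : V} (h : SmoothNear g z) : DifferentiableAt ℝ g z :=
  h.contDiffAt.differentiableAt (by simp)

lemma continuousAt {g : V → W} {z : V} (h : SmoothNear g z) : ContinuousAt g z :=
  h.contDiffAt.continuousAt

lemma eventually {g : V → W} {z : V} (h : SmoothNear g z) : ∀ᶠ z' in 𝓝 z, SmoothNear g z' :=
  eventually_eventually_nhds.mpr h

lemma _root_.ContDiff.smoothNear {g : V → W} (h : ContDiff ℝ ∞ g) (z : V) : SmoothNear g z :=
  Eventually.of_forall fun _ => h.contDiffAt

lemma _root_.ContDiffOn.smoothNear {g : V → W} {O : Set V} (h : ContDiffOn ℝ ∞ g O)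
    (hO : IsOpen O) {z : V} (hz : z ∈ O) : SmoothNear g z := by
  filter_upwards [hO.mem_nhds hz] with z' hz' using h.contDiffAt (hO.mem_nhds hz')

/-- This is the gain over `ContDiffAt ℝ ∞` at the single point z, which provides for each finite
order a neighbourhood that may depend on the order. -/
lemma exists_contDiffOn {g : V → W} {z : V} (h : SmoothNear g z) :
    ∃ O : Set V, IsOpen O ∧ z ∈ O ∧ ContDiffOn ℝ ∞ g O := by
  obtain ⟨O, hO, hOo, hz⟩ := eventually_nhds_iff.mp h
  exact ⟨O, hOo, hz, fun x hx => (hO x hx).contDiffWithinAt⟩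

lemma comp {g : W → W'} {f : V → W} {z : V} (hg : SmoothNear g (f z)) (hf : SmoothNear f z) :
    SmoothNear (g ∘ f) z := by
  filter_upwards [hf, hf.continuousAt.eventually hg] with z' h1 h2 using h2.comp z' h1

lemma congr {f g : V → W} {z : V} (hf : SmoothNear f z) (h : g =ᶠ[𝓝 z] f) : SmoothNear g z := by
  filter_upwards [hf, h.eventuallyEq_nhds] with z' h1 h2 using h1.congr_of_eventuallyEq h2

lemma const (w : W) (z : V) : SmoothNear (fun _ : V => w) z := contDiff_const.smoothNear z

lemma add {f g : V → W} {z : V} (hf : SmoothNear f z) (hg : SmoothNear g z) :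
    SmoothNear (fun x => f x + g x) z := by
  filter_upwards [hf, hg] with z' h1 h2 using h1.add h2

lemma sum {ι : Type*} {s : Finset ι} {f : ι → V → W} {z : V}
    (hf : ∀ i ∈ s, SmoothNear (f i) z) : SmoothNear (fun x => ∑ i ∈ s, f i x) z := by
  filter_upwards [(Filter.eventually_all_finset s).mpr hf] with z' h1 using ContDiffAt.sum h1

lemma smul {f : V → ℝ} {g : V → W} {z : V} (hf : SmoothNear f z) (hg : SmoothNear g z) :
    SmoothNear (fun x => f x • g x) z := by
  filter_upwards [hf, hg] with z' h1 h2 using h1.smul h2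

lemma fderiv_right {g : V → W} {z : V} (h : SmoothNear g z) : SmoothNear (fderiv ℝ g) z := by
  filter_upwards [h] with z' h1 using h1.fderiv_right (m := ∞) (by simp)

lemma clm_comp (L : W →L[ℝ] W') {g : V → W} {z : V} (h : SmoothNear g z) :
    SmoothNear (fun x => L (g x)) z :=
  (L.contDiff.smoothNear _).comp h

end SmoothNear

section ParametricIntegral

variable {V W : Type u} [NormedAddCommGroup V] [NormedSpace ℝ V] [FiniteDimensional ℝ V]
  [NormedAddCommGroup W] [NormedSpace ℝ W]

lemma continuousOn_slice {g : ℝ × V → W} {U : Set V} {a b : ℝ} {Ω : Set (ℝ × V)}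
    (hsub : uIcc a b ×ˢ U ⊆ Ω) (hg : ContinuousOn g Ω) {z : V} (hz : z ∈ U) :
    ContinuousOn (fun t => g (t, z)) (uIcc a b) :=
  hg.comp (by fun_prop) fun _ ht => hsub ⟨ht, hz⟩

/-- As V is finite-dimensional, `uIcc a b` times a closed ball is compact. The partial derivative is
bounded there, and a constant dominates it. -/
lemma hasFDerivAt_intervalIntegral_of_contDiffOn {g : ℝ × V → W} {U : Set V} (hU : IsOpen U)
    {a b : ℝ} {Ω : Set (ℝ × V)} (hΩ : IsOpen Ω) (hsub : uIcc a b ×ˢ U ⊆ Ω)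
    (hg : ContDiffOn ℝ ∞ g Ω) {z : V} (hz : z ∈ U) :
    HasFDerivAt (fun z => ∫ t in a..b, g (t, z))
      (∫ t in a..b, (fderiv ℝ g (t, z)).comp (ContinuousLinearMap.inr ℝ ℝ V)) z := by
  obtain ⟨ε, hε, hεU⟩ := Metric.nhds_basis_closedBall.mem_iff.mp (hU.mem_nhds hz)
  have hg' : ContinuousOn (fun p => (fderiv ℝ g p).comp (ContinuousLinearMap.inr ℝ ℝ V)) Ω :=
    ((hg.continuousOn_fderiv_of_isOpen hΩ (by simp)).clm_comp continuousOn_const)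
  obtain ⟨C, hC⟩ := (isCompact_uIcc.prod (isCompact_closedBall z ε)).exists_bound_of_continuousOn
    (hg'.mono ((prod_mono_right hεU).trans hsub))
  refine intervalIntegral.hasFDerivAt_integral_of_dominated_of_fderiv_le (𝕜 := ℝ)
    (F := fun z t => g (t, z)) (bound := fun _ => C)
    (F' := fun z t => (fderiv ℝ g (t, z)).comp (ContinuousLinearMap.inr ℝ ℝ V))
    (Metric.closedBall_mem_nhds z hε) ?_ ?_ ?_ ?_ ?_ ?_
  · filter_upwards [hU.mem_nhds hz] with x hx
    exact ((continuousOn_slice hsub hg.continuousOn hx).mono uIoc_subset_uIcc).aestronglyMeasurable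
      measurableSet_uIoc
  · exact (continuousOn_slice hsub hg.continuousOn hz).intervalIntegrable
  · exact ((continuousOn_slice hsub hg' hz).mono uIoc_subset_uIcc).aestronglyMeasurable
      measurableSet_uIoc
  · exact Eventually.of_forall fun t ht x hx => hC (t, x) ⟨uIoc_subset_uIcc ht, hx⟩
  · exact intervalIntegrable_const
  · refine Eventually.of_forall fun t ht x hx => ?_
    have h1 : (t, x) ∈ Ω := hsub ⟨uIoc_subset_uIcc ht, hεU hx⟩
    have h2 : HasFDerivAt g (fderiv ℝ g (t, x)) (t, x) :=
      ((hg.contDiffAt (hΩ.mem_nhds h1)).differentiableAt (by simp)).hasFDerivAt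
    exact h2.comp x (hasFDerivAt_prodMk_right t x)

/-- The derivative is again a parametric integral, with values in `V →L[ℝ] W`, so induction on the
order works once W is generalized. V and W share a universe in order that W can be replaced by `V
→L[ℝ] W`. -/
lemma contDiffOn_intervalIntegral {g : ℝ × V → W} {U : Set V} (hU : IsOpen U)
    {a b : ℝ} {Ω : Set (ℝ × V)} (hΩ : IsOpen Ω) (hsub : uIcc a b ×ˢ U ⊆ Ω)
    (hg : ContDiffOn ℝ ∞ g Ω) : ContDiffOn ℝ ∞ (fun z => ∫ t in a..b, g (t, z)) U := by
  rw [contDiffOn_infty]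
  intro n
  induction n generalizing W with
  | zero =>
    refine contDiffOn_zero.mpr fun z hz => ?_
    have h := hasFDerivAt_intervalIntegral_of_contDiffOn hU hΩ hsub hg hz
    exact h.continuousAt.continuousWithinAt
  | succ n ih =>
    have hd := fun z hz => hasFDerivAt_intervalIntegral_of_contDiffOn (z := z) hU hΩ hsub hg hz
    rw [show ((n + 1 : ℕ) : WithTop ℕ∞) = (n : WithTop ℕ∞) + 1 by push_cast; rfl,
      contDiffOn_succ_iff_fderiv_of_isOpen hU]
    refine ⟨fun z hz => (hd z hz).differentiableAt.differentiableWithinAt, by simp, ?_⟩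
    have h1 : ContDiffOn ℝ ∞ (fun p => (fderiv ℝ g p).comp (ContinuousLinearMap.inr ℝ ℝ V)) Ω :=
      (hg.fderiv_of_isOpen hΩ (by simp)).clm_comp contDiffOn_const
    exact (ih h1).congr fun z hz => (hd z hz).fderiv

/-- Tube lemma: the time interval is compact, so smoothness near each of its points over z holds
over one neighbourhood of z. -/
lemma exists_tube_contDiffOn {g : ℝ × V → W} {z : V} {a b : ℝ}
    (hg : ∀ t ∈ uIcc a b, SmoothNear g (t, z)) :
    ∃ (Ω : Set (ℝ × V)) (U : Set V), IsOpen Ω ∧ IsOpen U ∧ z ∈ U ∧ uIcc a b ×ˢ U ⊆ Ω ∧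
      ContDiffOn ℝ ∞ g Ω := by
  have hsub : uIcc a b ×ˢ {z} ⊆ interior {p | ContDiffAt ℝ ∞ g p} := by
    rintro ⟨t, x⟩ ⟨ht, rfl⟩
    exact mem_interior_iff_mem_nhds.mpr (hg t ht)
  obtain ⟨I, U, -, hU, hI, hzU, hIU⟩ :=
    generalized_tube_lemma isCompact_uIcc isCompact_singleton isOpen_interior hsub
  exact ⟨_, U, isOpen_interior, hU, hzU rfl, (prod_mono_left hI).trans hIU,
    fun p hp => ContDiffAt.contDiffWithinAt (x := p) (by exact (interior_subset hp :))⟩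

lemma SmoothNear.intervalIntegral {g : ℝ × V → W} {z : V} {a b : ℝ}
    (hg : ∀ t ∈ uIcc a b, SmoothNear g (t, z)) :
    SmoothNear (fun z => ∫ t in a..b, g (t, z)) z := by
  obtain ⟨Ω, U, hΩ, hU, hz, hsub, h⟩ := exists_tube_contDiffOn hg
  exact (contDiffOn_intervalIntegral hU hΩ hsub h).smoothNear hU hz

lemma hasFDerivAt_intervalIntegral {g : ℝ × V → W} {z : V} {a b : ℝ}
    (hg : ∀ t ∈ uIcc a b, SmoothNear g (t, z)) :
    HasFDerivAt (fun z => ∫ t in a..b, g (t, z))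
      (∫ t in a..b, (fderiv ℝ g (t, z)).comp (ContinuousLinearMap.inr ℝ ℝ V)) z := by
  obtain ⟨Ω, U, hΩ, hU, hz, hsub, h⟩ := exists_tube_contDiffOn hg
  exact hasFDerivAt_intervalIntegral_of_contDiffOn hU hΩ hsub h hz

lemma fderiv_intervalIntegral_apply [CompleteSpace W] {g : ℝ × V → W} {z : V} {a b : ℝ}
    (hg : ∀ t ∈ uIcc a b, SmoothNear g (t, z)) (L : W →L[ℝ] ℝ) (x : V) :
    L (fderiv ℝ (fun z => ∫ t in a..b, g (t, z)) z x) =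
      ∫ t in a..b, L (fderiv ℝ g (t, z) (0, x)) := by
  rw [(hasFDerivAt_intervalIntegral hg).fderiv]
  refine ((L.comp (ContinuousLinearMap.apply ℝ W x)).intervalIntegral_comp_comm ?_).symm
  refine ContinuousOn.intervalIntegrable fun t ht => ?_
  exact (((hg t ht).fderiv_right.continuousAt.comp (f := fun t => (t, z))
    (by fun_prop)).clm_comp continuousAt_const).continuousWithinAt

/-- Hadamard's lemma. -/
lemma SmoothNear.exists_hadamard {g : V → ℝ} {z₀ : V} (hg : SmoothNear g z₀) :
    ∃ h : V → V →L[ℝ] ℝ, SmoothNear h z₀ ∧ h z₀ = fderiv ℝ g z₀ ∧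
      ∀ᶠ z in 𝓝 z₀, g z = g z₀ + h z (z - z₀) := by
  -- The increment of g is the integral of its derivative along the segment from z₀ to z; h is the
  -- mean of the derivative over that segment.
  let G : ℝ × V → V →L[ℝ] ℝ := fun p => fderiv ℝ g (z₀ + p.1 • (p.2 - z₀))
  refine ⟨fun z => ∫ t in (0:ℝ)..1, G (t, z), SmoothNear.intervalIntegral fun t _ => ?_, ?_, ?_⟩
  · refine SmoothNear.comp (g := fderiv ℝ g) (by simpa using hg.fderiv_right)
      (ContDiff.smoothNear ?_ _)
    fun_prop
  · simp [G]
  · obtain ⟨ε, hε, hball⟩ := Metric.eventually_nhds_iff_ball.mp hg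
    filter_upwards [Metric.ball_mem_nhds z₀ hε] with z hz
    have hseg : ∀ t ∈ uIcc (0:ℝ) 1, z₀ + t • (z - z₀) ∈ Metric.ball z₀ ε := by
      intro t ht
      rw [uIcc_of_le zero_le_one] at ht
      exact (convex_ball z₀ ε).add_smul_sub_mem (Metric.mem_ball_self hε) hz ht
    have hder : ∀ t ∈ uIcc (0:ℝ) 1, HasDerivAt (fun t : ℝ => g (z₀ + t • (z - z₀)))
        (G (t, z) (z - z₀)) t := by
      intro t ht
      have h1 := ((hball _ (hseg t ht)).differentiableAt (by simp)).hasFDerivAt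
      have h2 : HasDerivAt (fun t : ℝ => z₀ + t • (z - z₀)) (z - z₀) t := by
        simpa using ((hasDerivAt_id t).smul_const (z - z₀)).const_add z₀
      exact h1.comp_hasDerivAt t h2
    have hcont : ContinuousOn (fun t => G (t, z)) (uIcc 0 1) := by
      have h1 : ContinuousOn (fderiv ℝ g) (Metric.ball z₀ ε) := fun x hx =>
        ((hball x hx).fderiv_right (m := ∞) (by simp)).continuousAt.continuousWithinAt
      exact h1.comp (by fun_prop) hseg
    have h3 := intervalIntegral.integral_eq_sub_of_hasDerivAt hder
      (hcont.clm_apply continuousOn_const).intervalIntegrable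
    have h4 := ContinuousLinearMap.intervalIntegral_apply
      (hcont.intervalIntegrable (μ := volume)) (z - z₀)
    rw [h4, h3]
    simp

end ParametricIntegral

/-! ### Differential forms `∑ f dg₁ ∧ … ∧ dgₙ` on a vector space -/

section DetForm

variable {V : Type u} [NormedAddCommGroup V] [NormedSpace ℝ V]

lemma minSmoothness_two_le_infty : minSmoothness ℝ 2 ≤ ∞ := by
  rw [minSmoothness_of_isRCLikeNormedField]
  exact WithTop.coe_le_coe.mpr (OrderTop.le_top (2 : ℕ∞))

/-- The form `dg₁ ∧ … ∧ dgₙ`. -/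
def detForm : ∀ {n : ℕ}, (Fin n → V → ℝ) → V → V [⋀^Fin n]→L[ℝ] ℝ
  | 0, _, _ => ContinuousAlternatingMap.constOfIsEmpty ℝ V (Fin 0) 1
  | _ + 1, g, z => ContinuousAlternatingMap.alternatizeUncurryFin
      ((fderiv ℝ (g 0) z).smulRight (detForm (Fin.tail g) z))

/-- The alternatization in the recursive definition is Laplace expansion along the first column.
This links `detForm` with the determinants in `IsExpr`. -/
lemma detForm_apply {n : ℕ} (g : Fin n → V → ℝ) (z : V) (v : Fin n → V) :
    detForm g z v = Matrix.det (Matrix.of fun a b => fderiv ℝ (g b) z (v a)) := by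
  induction n with
  | zero => simp [detForm]
  | succ n ih =>
    rw [Matrix.det_succ_column_zero]
    simp only [detForm, ContinuousAlternatingMap.alternatizeUncurryFin_apply,
      ContinuousLinearMap.smulRight_apply, ContinuousAlternatingMap.smul_apply, ih]
    refine Finset.sum_congr rfl fun i _ => ?_
    simp only [smul_eq_mul, Int.reduceNeg, zsmul_eq_mul, Int.cast_pow, Int.cast_neg, Int.cast_one,
      mul_assoc]
    rfl

lemma smoothNear_detForm {n : ℕ} {g : Fin n → V → ℝ} {z : V} (hg : ∀ b, SmoothNear (g b) z) :
    SmoothNear (detForm g) z := by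
  induction n with
  | zero => exact SmoothNear.const _ _
  | succ n ih =>
    have h1 : SmoothNear (fun z => (fderiv ℝ (g 0) z).smulRight (detForm (Fin.tail g) z)) z := by
      filter_upwards [(hg 0).fderiv_right, ih (g := Fin.tail g) fun b => hg b.succ] with z' h1 h2
        using h1.smulRight h2
    exact h1.clm_comp (ContinuousAlternatingMap.alternatizeUncurryFinCLM ℝ V ℝ)

lemma extDeriv_smul_of_extDeriv_eq_zero {n : ℕ} {f : V → ℝ} {β : V → V [⋀^Fin n]→L[ℝ] ℝ} {z : V}
    (hf : DifferentiableAt ℝ f z) (hβ : DifferentiableAt ℝ β z) (h : extDeriv β z = 0) :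
    extDeriv (fun z => f z • β z) z =
      ContinuousAlternatingMap.alternatizeUncurryFin ((fderiv ℝ f z).smulRight (β z)) := by
  rw [extDeriv, fderiv_fun_smul hf hβ, ContinuousAlternatingMap.alternatizeUncurryFin_add,
    ContinuousAlternatingMap.alternatizeUncurryFin_smul]
  rw [extDeriv] at h
  rw [h, smul_zero, zero_add]

/-- By induction, dg₁ ∧ … ∧ dgₙ = d(g₁ dg₂ ∧ … ∧ dgₙ) near z, so d ∘ d = 0 applies. -/
lemma extDeriv_detForm {n : ℕ} {g : Fin n → V → ℝ} {z : V} (hg : ∀ b, SmoothNear (g b) z) :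
    extDeriv (detForm g) z = 0 := by
  induction n generalizing z with
  | zero =>
    have : detForm g = fun _ : V => ContinuousAlternatingMap.constOfIsEmpty ℝ V (Fin 0) (1 : ℝ) :=
      rfl
    rw [this, extDeriv, fderiv_fun_const]
    exact map_zero (ContinuousAlternatingMap.alternatizeUncurryFinCLM ℝ V ℝ)
  | succ n ih =>
    have h1 : detForm g =ᶠ[𝓝 z] extDeriv (fun z => g 0 z • detForm (Fin.tail g) z) := by
      filter_upwards [(hg 0).eventually,
        eventually_all.mpr fun b : Fin n => (hg b.succ).eventually] with z' h1 h2
      exact (extDeriv_smul_of_extDeriv_eq_zero h1.differentiableAt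
        (smoothNear_detForm h2).differentiableAt (ih h2)).symm
    rw [h1.extDeriv_eq]
    exact extDeriv_extDeriv_apply (r := ∞)
      ((hg 0).smul (smoothNear_detForm fun b => hg b.succ)).contDiffAt minSmoothness_two_le_infty

lemma extDeriv_smul_detForm {n : ℕ} {f : V → ℝ} {g : Fin n → V → ℝ} {z : V}
    (hf : SmoothNear f z) (hg : ∀ b, SmoothNear (g b) z) :
    extDeriv (fun z => f z • detForm g z) z =
      detForm (Fin.cons f g : Fin (n + 1) → V → ℝ) z :=
  extDeriv_smul_of_extDeriv_eq_zero hf.differentiableAt (smoothNear_detForm hg).differentiableAt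
    (extDeriv_detForm hg)

/-- The form `∑ⱼ fⱼ dgⱼ₁ ∧ … ∧ dgⱼₙ`. -/
def sumForm {J : Type*} [Fintype J] {n : ℕ} (f : J → V → ℝ) (g : J → Fin n → V → ℝ) (z : V) :
    V [⋀^Fin n]→L[ℝ] ℝ :=
  ∑ j, f j z • detForm (g j) z

lemma smoothNear_sumForm {J : Type*} [Fintype J] {n : ℕ} {f : J → V → ℝ} {g : J → Fin n → V → ℝ}
    {z : V} (hf : ∀ j, SmoothNear (f j) z) (hg : ∀ j b, SmoothNear (g j b) z) :
    SmoothNear (sumForm f g) z :=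
  SmoothNear.sum fun j _ => (hf j).smul (smoothNear_detForm (hg j))

lemma extDeriv_sumForm {J : Type*} [Fintype J] {n : ℕ} {f : J → V → ℝ} {g : J → Fin n → V → ℝ}
    {z : V} (hf : ∀ j, SmoothNear (f j) z) (hg : ∀ j b, SmoothNear (g j b) z) :
    extDeriv (sumForm f g) z =
      sumForm (fun _ _ => 1) (fun j => (Fin.cons (f j) (g j) : Fin (n + 1) → V → ℝ)) z := by
  have h : ∀ j, DifferentiableAt ℝ (fun z => f j z • detForm (g j) z) z := fun j =>
    ((hf j).smul (smoothNear_detForm (hg j))).differentiableAt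
  have h1 : extDeriv (sumForm f g) z = ∑ j, extDeriv (fun z => f j z • detForm (g j) z) z := by
    unfold extDeriv sumForm
    rw [fderiv_fun_sum fun j _ => h j]
    exact map_sum (ContinuousAlternatingMap.alternatizeUncurryFinCLM ℝ V ℝ) _ _
  rw [h1, sumForm]
  exact Finset.sum_congr rfl fun j _ => by rw [extDeriv_smul_detForm (hf j) (hg j), one_smul]

lemma sumForm_apply {J : Type*} [Fintype J] {n : ℕ} (f : J → V → ℝ) (g : J → Fin n → V → ℝ) (z : V)
    (v : Fin n → V) : sumForm f g z v =
      ∑ j, f j z * Matrix.det (Matrix.of fun a b => fderiv ℝ (g j b) z (v a)) := by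
  simp [sumForm, detForm_apply]

/-- Every form is a combination of exterior products of coordinate differentials. -/
lemma exists_eq_sumForm [FiniteDimensional ℝ V] {n : ℕ} (A : V → V [⋀^Fin n]→L[ℝ] ℝ) :
    ∃ (J : ℕ) (L : Fin J → V [⋀^Fin n]→L[ℝ] ℝ →L[ℝ] ℝ) (l : Fin J → Fin n → V →L[ℝ] ℝ),
      A = sumForm (fun j z => L j (A z)) (fun j b z => l j b z) := by
  let b := Module.finBasis ℝ V
  let d := Module.finrank ℝ V
  let l : Fin d → V →L[ℝ] ℝ := fun i => LinearMap.toContinuousLinearMap (b.coord i)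
  -- Expand B in the basis and sum over all permutations of the arguments. The multi-indices I are
  -- not required to be increasing, which accounts for the factor n!.
  have key : ∀ (B : V [⋀^Fin n]→L[ℝ] ℝ) (v : Fin n → V),
      (n.factorial : ℝ) * B v = ∑ I : Fin n → Fin d, B (fun a => b (I a)) *
        Matrix.det (Matrix.of fun a c => l (I c) (v a)) := by
    intro B v
    have h1 : ∀ w : Fin n → V, B w = ∑ I : Fin n → Fin d,
        (∏ a, l (I a) (w a)) * B (fun a => b (I a)) := by
      intro w
      conv_lhs => rw [show w = fun a => ∑ i, l i (w a) • b i from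
        funext fun a => (b.sum_repr (w a)).symm]
      have := B.toMultilinearMap.map_sum (fun a i => l i (w a) • b i)
      refine this.trans (Finset.sum_congr rfl fun I _ => ?_)
      exact B.toMultilinearMap.map_smul_univ (fun a => l (I a) (w a)) (fun a => b (I a))
    have h2 : ∀ σ : Equiv.Perm (Fin n), ((Equiv.Perm.sign σ : ℤ) : ℝ) * B (v ∘ σ) = B v := by
      intro σ
      have := B.toAlternatingMap.map_perm v σ
      have h3 : B (v ∘ σ) = Equiv.Perm.sign σ • B v := this
      rw [h3, Units.smul_def, zsmul_eq_mul, ← mul_assoc, ← Int.cast_mul]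
      simp [← Units.val_mul]
    calc (n.factorial : ℝ) * B v
        = ∑ σ : Equiv.Perm (Fin n), ((Equiv.Perm.sign σ : ℤ) : ℝ) * B (v ∘ σ) := by
          simp only [h2, Finset.sum_const, Finset.card_univ, Fintype.card_perm, Fintype.card_fin,
            nsmul_eq_mul]
      _ = ∑ σ : Equiv.Perm (Fin n), ∑ I : Fin n → Fin d, ((Equiv.Perm.sign σ : ℤ) : ℝ) *
            ((∏ a, l (I a) (v (σ a))) * B (fun a => b (I a))) := by
          refine Finset.sum_congr rfl fun σ _ => ?_
          rw [h1 (v ∘ σ), Finset.mul_sum]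
          rfl
      _ = _ := by
          rw [Finset.sum_comm]
          refine Finset.sum_congr rfl fun I _ => ?_
          rw [Matrix.det_apply', Finset.mul_sum]
          refine Finset.sum_congr rfl fun σ _ => ?_
          simp only [Matrix.of_apply]
          ring
  let e := (Fintype.equivFin (Fin n → Fin d)).symm
  -- The coefficients are fixed continuous linear functionals of A z, and so inherit the smoothness
  -- of A.
  refine ⟨Fintype.card (Fin n → Fin d), fun j => (n.factorial : ℝ)⁻¹ •
    ContinuousAlternatingMap.apply ℝ V ℝ (fun a => b (e j a)), fun j c => l (e j c), ?_⟩
  funext z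
  ext v
  have hn : (n.factorial : ℝ) ≠ 0 := by positivity
  rw [sumForm_apply, ← mul_right_inj' hn, key, Finset.mul_sum, ← e.sum_comp]
  refine Finset.sum_congr rfl fun j _ => ?_
  have h5 : ∀ (i : Fin d) , fderiv ℝ (fun z => l i z) z = l i := fun i => (l i).fderiv
  simp only [h5]
  simp [← mul_assoc, hn]

end DetForm

/-! ### The homotopy formula -/

section Homotopy

variable {V : Type u} [NormedAddCommGroup V] [NormedSpace ℝ V] [FiniteDimensional ℝ V] {n : ℕ}

/-- The pull-back of a form by a map between vector spaces. -/
def pullForm {V' : Type u} [NormedAddCommGroup V'] [NormedSpace ℝ V'] (H : V' → V)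
    (A : V → V [⋀^Fin n]→L[ℝ] ℝ) (p : V') : V' [⋀^Fin n]→L[ℝ] ℝ :=
  (A (H p)).compContinuousLinearMap (fderiv ℝ H p)

/-- Write A as ∑ f dg₁ ∧ … ∧ dgₙ. Its pull-back is ∑ (f ∘ H) d(g₁ ∘ H) ∧ … ∧ d(gₙ ∘ H), which is
smooth by `smoothNear_sumForm`. -/
lemma smoothNear_pullForm {V' : Type u} [NormedAddCommGroup V'] [NormedSpace ℝ V'] {H : V' → V}
    {A : V → V [⋀^Fin n]→L[ℝ] ℝ} {p : V'} (hH : SmoothNear H p) (hA : SmoothNear A (H p)) :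
    SmoothNear (pullForm H A) p := by
  obtain ⟨J, L, l, h⟩ := exists_eq_sumForm A
  refine SmoothNear.congr (f := sumForm (fun j p => L j (A (H p))) fun j b p => l j b (H p))
    (smoothNear_sumForm (fun j => (hA.comp hH).clm_comp (L j)) fun j b => hH.clm_comp (l j b)) ?_
  filter_upwards [hH.eventually] with p hp
  ext v
  have hl : ∀ j b, fderiv ℝ (fun p => l j b (H p)) p = (l j b).comp (fderiv ℝ H p) := fun j b =>
    ((l j b).hasFDerivAt.comp p hp.differentiableAt.hasFDerivAt).fderiv
  rw [pullForm, ContinuousAlternatingMap.compContinuousLinearMap_apply]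
  conv_lhs => rw [h]
  simp only [sumForm_apply, hl, Function.comp_def, ContinuousLinearMap.comp_apply,
    ContinuousLinearMap.fderiv]

lemma extDeriv_pullForm {V' : Type u} [NormedAddCommGroup V'] [NormedSpace ℝ V'] {H : V' → V}
    {A : V → V [⋀^Fin n]→L[ℝ] ℝ} {p : V'} (hH : SmoothNear H p) (hA : SmoothNear A (H p)) :
    extDeriv (pullForm H A) p = pullForm H (extDeriv A) p :=
  extDeriv_pullback (r := ∞) hA.differentiableAt hH.contDiffAt minSmoothness_two_le_infty

/-- Contraction of a form on `ℝ × V` with `∂/∂t`, restricted to `V`. -/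
def contractTime : ((ℝ × V) [⋀^Fin (n + 1)]→L[ℝ] ℝ) →L[ℝ] (V [⋀^Fin n]→L[ℝ] ℝ) :=
  (ContinuousAlternatingMap.compContinuousLinearMapCLM (ContinuousLinearMap.inr ℝ ℝ V)).comp
    ((ContinuousLinearMap.apply ℝ _ ((1, 0) : ℝ × V)).comp
      (ContinuousAlternatingMap.curryLeftLI (𝕜 := ℝ) (E := ℝ × V) (F := ℝ)
        (n := n)).toContinuousLinearMap)

lemma contractTime_apply (β : (ℝ × V) [⋀^Fin (n + 1)]→L[ℝ] ℝ) (v : Fin n → V) :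
    contractTime β v = β (Fin.cons (1, 0) fun a => (0, v a)) := rfl

lemma cons_removeNth_succ {M : Type*} (x : M) (v : Fin (n + 1) → M) (i : Fin (n + 1)) :
    Fin.removeNth i.succ (Fin.cons x v : Fin (n + 2) → M) = Fin.cons x (i.removeNth v) := by
  funext j
  refine Fin.cases ?_ (fun j => ?_) j
  · simp [Fin.removeNth]
  · simp [Fin.removeNth]

/-- Cartan's formula on the cylinder. In dβ(∂_t, v₀, …, vₙ) the term differentiated along ∂_t
integrates to the boundary values by the fundamental theorem of calculus. The terms differentiated
along the vᵢ carry the opposite sign to those of the exterior derivative of the integrated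
contraction, because ∂_t shifts every index by one. -/
lemma extDeriv_integral_contractTime {β : ℝ × V → (ℝ × V) [⋀^Fin (n + 1)]→L[ℝ] ℝ} {z : V} {a b : ℝ}
    (hβ : ∀ t ∈ uIcc a b, SmoothNear β (t, z)) (v : Fin (n + 1) → V) :
    extDeriv (fun z => ∫ t in a..b, contractTime (β (t, z))) z v =
      β (b, z) (fun i => (0, v i)) - β (a, z) (fun i => (0, v i)) -
        ∫ t in a..b, extDeriv β (t, z) (Fin.cons (1, 0) fun i => (0, v i)) := by
  have hc : ∀ t ∈ uIcc a b, SmoothNear (fun p => contractTime (β p)) (t, z) := fun t ht =>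
    (hβ t ht).clm_comp contractTime
  have hD : ContinuousOn (fun t => fderiv ℝ β (t, z)) (uIcc a b) := fun t ht =>
    ((hβ t ht).fderiv_right.continuousAt.comp (f := fun t => (t, z))
      (by fun_prop)).continuousWithinAt
  have hint : ∀ (w : ℝ × V) (u : Fin (n + 1) → ℝ × V),
      IntervalIntegrable (fun t => fderiv ℝ β (t, z) w u) volume a b := fun w u =>
    (((ContinuousAlternatingMap.apply ℝ (ℝ × V) ℝ u).comp
      (ContinuousLinearMap.apply ℝ _ w)).continuous.comp_continuousOn hD).intervalIntegrable
  have h1 : ∀ (x : V) (w : Fin n → V),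
      fderiv ℝ (fun z => ∫ t in a..b, contractTime (β (t, z))) z x w =
        ∫ t in a..b, fderiv ℝ β (t, z) (0, x) (Fin.cons (1, 0) fun i => (0, w i)) := by
    intro x w
    refine (fderiv_intervalIntegral_apply (g := fun p => contractTime (β p)) hc
      (ContinuousAlternatingMap.apply ℝ V ℝ w) x).trans ?_
    refine intervalIntegral.integral_congr fun t ht => ?_
    have h3 : fderiv ℝ (fun p => contractTime (β p)) (t, z) =
        contractTime.comp (fderiv ℝ β (t, z)) :=
      ((contractTime (V := V) (n := n)).hasFDerivAt.comp (t, z)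
        (hβ t ht).differentiableAt.hasFDerivAt).fderiv
    simp only [h3]
    rfl
  have hFTC : ∫ t in a..b, fderiv ℝ β (t, z) (1, 0) (fun i => (0, v i)) =
      β (b, z) (fun i => (0, v i)) - β (a, z) (fun i => (0, v i)) := by
    refine intervalIntegral.integral_eq_sub_of_hasDerivAt
      (f := fun t => β (t, z) (fun i => (0, v i))) (fun t ht => ?_) (hint _ _)
    have h5 : HasDerivAt (fun t : ℝ => (t, z)) (1, 0) t :=
      (hasDerivAt_id t).prodMk (hasDerivAt_const t z)
    have h6 := (hβ t ht).differentiableAt.hasFDerivAt.comp_hasDerivAt t h5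
    exact (ContinuousAlternatingMap.apply ℝ (ℝ × V) ℝ
      fun i => ((0 : ℝ), v i)).hasFDerivAt.comp_hasDerivAt t h6
  have h7 : ∀ t, extDeriv β (t, z) (Fin.cons (1, 0) fun i => (0, v i)) =
      fderiv ℝ β (t, z) (1, 0) (fun i => (0, v i)) -
        ∑ i : Fin (n + 1), (-1) ^ (i : ℕ) * fderiv ℝ β (t, z) (0, v i)
          (Fin.cons (1, 0) fun j => (0, i.removeNth v j)) := by
    intro t
    rw [extDeriv, ContinuousAlternatingMap.alternatizeUncurryFin_apply, Fin.sum_univ_succ,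
      sub_eq_add_neg, ← Finset.sum_neg_distrib]
    congr 1
    · simp [Fin.removeNth_zero]
    · refine Finset.sum_congr rfl fun i _ => ?_
      rw [cons_removeNth_succ, Fin.cons_succ, Fin.val_succ, pow_succ]
      simp
      rfl
  have h8 : ∫ t in a..b, extDeriv β (t, z) (Fin.cons (1, 0) fun i => (0, v i)) =
      (β (b, z) (fun i => (0, v i)) - β (a, z) (fun i => (0, v i))) -
        ∑ i : Fin (n + 1), (-1) ^ (i : ℕ) * ∫ t in a..b, fderiv ℝ β (t, z) (0, v i)
          (Fin.cons (1, 0) fun j => (0, i.removeNth v j)) := by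
    rw [← hFTC]
    simp only [h7]
    rw [intervalIntegral.integral_sub (hint _ _) ?_,
      intervalIntegral.integral_finsetSum fun i _ => (hint _ _).const_mul _]
    swap
    · have := IntervalIntegrable.sum Finset.univ fun (i : Fin (n + 1)) _ => (hint (0, v i)
        (Fin.cons (1, 0) fun j => (0, i.removeNth v j))).const_mul ((-1) ^ (i : ℕ))
      simpa only [Finset.sum_fn] using this
    simp only [intervalIntegral.integral_const_mul]
  rw [h8, extDeriv, ContinuousAlternatingMap.alternatizeUncurryFin_apply]
  simp only [h1]
  simp

end Homotopy

/-! ### Coordinates, tangent vectors and forms -/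

namespace FormCalculus

variable {M N : Type*} {S : M → Subalgebra ℝ (M → ℝ)} {S' : N → Subalgebra ℝ (N → ℝ)}
  {V : Type u} [NormedAddCommGroup V] [NormedSpace ℝ V] [FiniteDimensional ℝ V]

lemma dAt_apply {p : M} {f : M → ℝ} (hf : f ∈ S p) (ξ : Tangent S p) :
    dAt S p f ξ = ξ.1 ⟨f, hf⟩ := by
  simp [dAt, hf]

lemma Tangent.ext_dAt {p : M} {ξ η : Tangent S p} (h : ∀ f ∈ S p, dAt S p f ξ = dAt S p f η) :
    ξ = η := by
  refine Subtype.ext (LinearMap.ext fun f => ?_)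
  have := h f.1 f.2
  rwa [dAt_apply f.2, dAt_apply f.2] at this

lemma Tangent.apply_algebraMap {p : M} (ξ : Tangent S p) (a : ℝ) :
    ξ.1 (algebraMap ℝ (S p) a) = 0 := by
  have h := ξ.2 1 1
  have h1 : ξ.1 (1 : S p) = 0 := by
    have e : ((1 : S p) : M → ℝ) p = 1 := rfl
    rw [mul_one, e] at h
    linarith
  rw [Algebra.algebraMap_eq_smul_one, map_smul, h1, smul_zero]

lemma dAt_pushforward {F : M → N} (hF : IsSmoothMap S S' F) {p : M} {f : N → ℝ} (hf : f ∈ S' (F p))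
    (ξ : Tangent S p) : dAt S' (F p) f (pushforward hF p ξ) = dAt S p (f ∘ F) ξ := by
  rw [dAt_apply hf, dAt_apply (hF p f hf)]
  rfl

/-- The velocity vector of a curve at the time `t₀`. -/
def curveTangent {p : M} (γ : ℝ → M) (t₀ : ℝ) (hp : γ t₀ = p)
    (h : ∀ f ∈ S p, DifferentiableAt ℝ (f ∘ γ) t₀) : Tangent S p :=
  ⟨{ toFun := fun f => deriv (f.1 ∘ γ) t₀
     map_add' := fun f g => deriv_add (h f.1 f.2) (h g.1 g.2)
     map_smul' := fun a f => deriv_const_smul a (h f.1 f.2) },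
   fun f g => by
     have := deriv_mul (h f.1 f.2) (h g.1 g.2)
     refine (this.trans ?_ : deriv ((f.1 ∘ γ) * (g.1 ∘ γ)) t₀ = _)
     simp only [Function.comp_apply, hp, LinearMap.coe_mk, AddHom.coe_mk]
     ring⟩

lemma dAt_curveTangent {p : M} {γ : ℝ → M} {t₀ : ℝ} (hp : γ t₀ = p)
    (h : ∀ f ∈ S p, DifferentiableAt ℝ (f ∘ γ) t₀) {f : M → ℝ} (hf : f ∈ S p) :
    dAt S p f (curveTangent γ t₀ hp h) = deriv (f ∘ γ) t₀ := by
  rw [dAt_apply hf]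
  rfl

variable (S) in
/-- The components of a tangent vector in the coordinates `κ`. -/
def coordT (κ : M → V) (p : M) : Tangent S p →ₗ[ℝ] V :=
  ∑ i, (dAt S p fun x => (Module.finBasis ℝ V).coord i (κ x)).smulRight (Module.finBasis ℝ V i)

lemma coordT_apply (κ : M → V) {p : M} (ξ : Tangent S p) : coordT S κ p ξ =
    ∑ i, dAt S p (fun x => (Module.finBasis ℝ V).coord i (κ x)) ξ • Module.finBasis ℝ V i := by
  simp [coordT]

/-- `α = ∑ⱼ fⱼ dgⱼ₁ ∧ … ∧ dgⱼₙ` at `p`. -/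
def IsExprAt (S : M → Subalgebra ℝ (M → ℝ)) (p : M) {J : Type*} [Fintype J] {n : ℕ} (α : Form S n)
    (f : J → M → ℝ) (g : J → Fin n → M → ℝ) : Prop :=
  (∀ j, f j ∈ S p ∧ ∀ i, g j i ∈ S p) ∧ ∀ ξ : Fin n → Tangent S p,
    α p ξ = ∑ j, f j p * Matrix.det (Matrix.of fun a b => dAt S p (g j b) (ξ a))

lemma isExpr_iff {U : Set M} {n J : ℕ} {α : Form S n} {f : Fin J → M → ℝ}
    {g : Fin J → Fin n → M → ℝ} : IsExpr S U α f g ↔ ∀ p ∈ U, IsExprAt S p α f g :=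
  ⟨fun h p hp => ⟨h.1 p hp, h.2 p hp⟩, fun h => ⟨fun p hp => (h p hp).1, fun p hp => (h p hp).2⟩⟩

lemma cons_comp {n : ℕ} (f : N → ℝ) (g : Fin n → N → ℝ) (F : M → N) (b : Fin (n + 1)) :
    (Fin.cons f g : Fin (n + 1) → N → ℝ) b ∘ F =
      (Fin.cons (f ∘ F) (fun b => g b ∘ F) : Fin (n + 1) → M → ℝ) b := by
  refine Fin.cases rfl (fun b => rfl) b

lemma IsExprAt.pullback {F : M → N} (hF : IsSmoothMap S S' F) {p : M} {J : Type*} [Fintype J]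
    {n : ℕ} {α : Form S' n} {f : J → N → ℝ} {g : J → Fin n → N → ℝ}
    (h : IsExprAt S' (F p) α f g) :
    IsExprAt S p (pullback hF α) (fun j => f j ∘ F) (fun j b => g j b ∘ F) := by
  refine ⟨fun j => ⟨hF p _ (h.1 j).1, fun b => hF p _ ((h.1 j).2 b)⟩, fun ξ => ?_⟩
  refine (h.2 fun a => pushforward hF p (ξ a)).trans ?_
  simp only [dAt_pushforward hF ((h.1 _).2 _), Function.comp_apply]

lemma IsExprAt.reindex {p : M} {J J' : Type*} [Fintype J] [Fintype J'] (e : J' ≃ J)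
    {n : ℕ} {α : Form S n} {f : J → M → ℝ} {g : J → Fin n → M → ℝ} (h : IsExprAt S p α f g) :
    IsExprAt S p α (fun j => f (e j)) (fun j => g (e j)) :=
  ⟨fun j => h.1 (e j), fun ξ => by
    rw [h.2, ← e.sum_comp]⟩

lemma IsExprAt.add {p : M} {J J' : Type*} [Fintype J] [Fintype J']
    {n : ℕ} {α α' : Form S n} {f : J → M → ℝ} {g : J → Fin n → M → ℝ} {f' : J' → M → ℝ}
    {g' : J' → Fin n → M → ℝ} (h : IsExprAt S p α f g) (h' : IsExprAt S p α' f' g') :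
    IsExprAt S p (α + α') (Sum.elim f f') (Sum.elim g g') := by
  refine ⟨fun j => ?_, fun ξ => ?_⟩
  · cases j with
    | inl j => exact h.1 j
    | inr j => exact h'.1 j
  · simp [h.2, h'.2]

section Topology

variable [TopologicalSpace M] [TopologicalSpace N]

variable (S) in
/-- `κ` is smooth at `p`. -/
structure IsCoordAt (κ : M → V) (p : M) : Prop where
  congr : ∀ {f f' : M → ℝ}, f ∈ S p → f' =ᶠ[𝓝 p] f → f' ∈ S p
  comp_mem : ∀ {g : V → ℝ}, SmoothNear g (κ p) → g ∘ κ ∈ S p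
  continuousAt : ContinuousAt κ p

/-- Derivations are local. Membership in `S p` depends on germs only, so the indicator function of
the set where f' = f serves as a cut-off and no bump function is needed. -/
lemma dAt_congr {p : M} (hS : ∀ {f f' : M → ℝ}, f ∈ S p → f' =ᶠ[𝓝 p] f → f' ∈ S p)
    {f f' : M → ℝ} (h : f' =ᶠ[𝓝 p] f) (ξ : Tangent S p) : dAt S p f' ξ = dAt S p f ξ := by
  classical
  by_cases hf : f ∈ S p
  · have hf' : f' ∈ S p := hS hf h
    rw [dAt_apply hf, dAt_apply hf', ← sub_eq_zero, ← map_sub]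
    let χ : M → ℝ := fun x => if f' x = f x then 1 else 0
    have hχ : χ ∈ S p := by
      refine hS (Subalgebra.one_mem (S p)) ?_
      filter_upwards [h] with x hx
      simp [χ, hx]
    have h0 := ξ.2 ⟨χ, hχ⟩ (⟨f', hf'⟩ - ⟨f, hf⟩)
    have h1 : (⟨χ, hχ⟩ : S p) * (⟨f', hf'⟩ - ⟨f, hf⟩) = 0 := by
      refine Subtype.ext (funext fun x => ?_)
      change χ x * (f' x - f x) = 0
      by_cases hx : f' x = f x
      · simp [hx]
      · simp [χ, hx]
    have h2 : ((⟨f', hf'⟩ - ⟨f, hf⟩ : S p) : M → ℝ) p = 0 := by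
      change f' p - f p = 0
      rw [h.self_of_nhds, sub_self]
    have h3 : χ p = 1 := by simp [χ, h.self_of_nhds]
    rw [h1, map_zero, h2] at h0
    change 0 = χ p * _ + _ at h0
    rw [h3] at h0
    linarith
  · have hf' : f' ∉ S p := fun hf' => hf (hS hf' h.symm)
    simp [dAt, hf, hf']

/-- By Hadamard's lemma f = g(κ p) + ∑ᵢ hᵢ(κ)(κᵢ − κᵢ(p)) near p. The Leibniz rule leaves only ∑ᵢ
hᵢ(κ p) ξ(κᵢ), because κᵢ − κᵢ(p) vanishes at p. Derivations thus act on functions of κ through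
their components. -/
lemma IsCoordAt.dAt_eq {κ : M → V} {p : M} (hκ : IsCoordAt S κ p) {f : M → ℝ} {g : V → ℝ}
    (hg : SmoothNear g (κ p)) (hf : f =ᶠ[𝓝 p] g ∘ κ) (ξ : Tangent S p) :
    dAt S p f ξ = fderiv ℝ g (κ p) (coordT S κ p ξ) := by
  obtain ⟨h, hh, h0, hgh⟩ := hg.exists_hadamard
  let b := Module.finBasis ℝ V
  let l : Fin (Module.finrank ℝ V) → V →L[ℝ] ℝ := fun i =>
    LinearMap.toContinuousLinearMap (b.coord i)
  have hl : ∀ i, (fun x => b.coord i (κ x)) ∈ S p := fun i =>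
    hκ.comp_mem (g := fun z => l i z) ((l i).contDiff.smoothNear _)
  have hH : ∀ i, (fun x => h (κ x) (b i)) ∈ S p := fun i =>
    hκ.comp_mem (g := fun z => h z (b i))
      (hh.clm_comp (ContinuousLinearMap.apply ℝ ℝ (b i)))
  let K : Fin (Module.finrank ℝ V) → S p := fun i =>
    ⟨_, hl i⟩ - algebraMap ℝ (S p) (b.coord i (κ p))
  let H : Fin (Module.finrank ℝ V) → S p := fun i => ⟨_, hH i⟩
  let Φ : S p := algebraMap ℝ (S p) (g (κ p)) + ∑ i, H i * K i
  have hK : ∀ i x, (K i).1 x = b.coord i (κ x) - b.coord i (κ p) := fun i x => rfl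
  have hΦ : f =ᶠ[𝓝 p] Φ.1 := by
    filter_upwards [hf, hκ.continuousAt.eventually hgh] with x hx hgx
    rw [hx, Function.comp_apply, hgx]
    have h1 : Φ.1 x = g (κ p) + ∑ i, h (κ x) (b i) * (b.coord i (κ x) - b.coord i (κ p)) := by
      change (algebraMap ℝ (S p) (g (κ p)) : S p).1 x +
        ((∑ i, H i * K i : S p) : M → ℝ) x = _
      rw [AddSubmonoidClass.coe_finsetSum, Finset.sum_apply]
      rfl
    rw [h1]
    congr 1
    conv_lhs => rw [← b.sum_repr (κ x - κ p)]
    simp only [map_sum, map_smul, map_sub, smul_eq_mul, Module.Basis.coord_apply, Finsupp.coe_sub,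
      Pi.sub_apply]
    exact Finset.sum_congr rfl fun i _ => mul_comm _ _
  rw [dAt_congr hκ.congr hΦ, dAt_apply Φ.2, coordT_apply, map_sum]
  change ξ.1 (algebraMap ℝ (S p) (g (κ p)) + ∑ i, H i * K i) = _
  rw [map_add, Tangent.apply_algebraMap, zero_add, map_sum]
  refine Finset.sum_congr rfl fun i _ => ?_
  rw [ξ.2, hK i p, sub_self, zero_mul, add_zero, map_smul, smul_eq_mul, mul_comm, dAt_apply (hl i)]
  rw [map_sub ξ.1, Tangent.apply_algebraMap, sub_zero]
  change _ * h (κ p) (b i) = _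
  rw [h0]

lemma IsCoordAt.clm_mem {κ : M → V} {p : M} (hκ : IsCoordAt S κ p) (l : V →L[ℝ] ℝ) :
    (fun x => l (κ x)) ∈ S p :=
  hκ.comp_mem (g := fun z => l z) (l.contDiff.smoothNear _)

lemma IsCoordAt.clm_coordT {κ : M → V} {p : M} (hκ : IsCoordAt S κ p) (l : V →L[ℝ] ℝ)
    (ξ : Tangent S p) : dAt S p (fun x => l (κ x)) ξ = l (coordT S κ p ξ) := by
  have h := hκ.dAt_eq (g := fun z => l z) (l.contDiff.smoothNear _)
    (Filter.EventuallyEq.refl _ _) ξ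
  rwa [show fderiv ℝ (fun z => l z) (κ p) = l from l.fderiv] at h

lemma IsCoordAt.coordT_eq {κ : M → V} {p : M} (hκ : IsCoordAt S κ p) {ξ : Tangent S p} {v : V}
    (h : ∀ l : V →L[ℝ] ℝ, dAt S p (fun x => l (κ x)) ξ = l v) : coordT S κ p ξ = v := by
  refine (Module.finBasis ℝ V).ext_elem fun i => ?_
  have := h (LinearMap.toContinuousLinearMap ((Module.finBasis ℝ V).coord i))
  rw [hκ.clm_coordT] at this
  exact this

/-- A functional vanishing on P is zero along κ near p, hence annihilates the components of every
tangent vector. Applied to `jetSub`, this gives the constraints on components of tangent vectors of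
jet spaces. -/
lemma IsCoordAt.coordT_mem {κ : M → V} {p : M} (hκ : IsCoordAt S κ p) {P : Submodule ℝ V}
    (h : ∀ᶠ p' in 𝓝 p, κ p' ∈ P) (ξ : Tangent S p) : coordT S κ p ξ ∈ P := by
  by_contra hv
  obtain ⟨l, hl, hle⟩ := Submodule.exists_le_ker_of_notMem hv
  let l' : V →L[ℝ] ℝ := LinearMap.toContinuousLinearMap l
  have h1 : (fun p' => l' (κ p')) =ᶠ[𝓝 p] fun _ => 0 := h.mono fun p' hp' => hle hp'
  have h2 := hκ.clm_coordT l' ξ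
  rw [hκ.dAt_eq (SmoothNear.const (0 : ℝ) _) h1, fderiv_fun_const] at h2
  exact hl h2.symm

lemma IsCoordAt.coordT_comp {V' : Type*} [NormedAddCommGroup V'] [NormedSpace ℝ V']
    [FiniteDimensional ℝ V'] {κ : M → V} {κ' : M → V'} {p : M} (hκ : IsCoordAt S κ p) {G : V → V'}
    (hG : SmoothNear G (κ p)) (h : κ' =ᶠ[𝓝 p] G ∘ κ) (ξ : Tangent S p) :
    coordT S κ' p ξ = fderiv ℝ G (κ p) (coordT S κ p ξ) := by
  have h1 : ∀ i, dAt S p (fun x => (Module.finBasis ℝ V').coord i (κ' x)) ξ =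
      (Module.finBasis ℝ V').coord i (fderiv ℝ G (κ p) (coordT S κ p ξ)) := by
    intro i
    let l : V' →L[ℝ] ℝ := LinearMap.toContinuousLinearMap ((Module.finBasis ℝ V').coord i)
    rw [hκ.dAt_eq (g := fun z => l (G z)) (hG.clm_comp l) (h.mono fun x hx => by
      simp only [Function.comp_apply] at hx ⊢; rw [hx]; rfl)]
    have h2 : fderiv ℝ (fun z => l (G z)) (κ p) = l.comp (fderiv ℝ G (κ p)) :=
      (l.hasFDerivAt.comp (κ p) hG.differentiableAt.hasFDerivAt).fderiv
    rw [h2]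
    rfl
  rw [coordT_apply]
  simp only [h1]
  exact (Module.finBasis ℝ V').sum_repr _

lemma coordT_pushforward {F : M → N} (hF : IsSmoothMap S S' F) {κ : N → V} {p : M}
    (hκ : IsCoordAt S' κ (F p)) (ξ : Tangent S p) :
    coordT S' κ (F p) (pushforward hF p ξ) = coordT S (κ ∘ F) p ξ := by
  rw [coordT_apply, coordT_apply]
  refine Finset.sum_congr rfl fun i _ => ?_
  let l : V →L[ℝ] ℝ := LinearMap.toContinuousLinearMap ((Module.finBasis ℝ V).coord i)
  congr 1
  exact dAt_pushforward hF (hκ.clm_mem l) ξ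

lemma IsCoordAt.coordT_curveTangent {κ : M → V} {p : M} (hκ : IsCoordAt S κ p) {γ : ℝ → M} {t₀ : ℝ}
    (hp : γ t₀ = p) (h : ∀ f ∈ S p, DifferentiableAt ℝ (f ∘ γ) t₀) {v : V}
    (hv : HasDerivAt (κ ∘ γ) v t₀) : coordT S κ p (curveTangent γ t₀ hp h) = v := by
  refine hκ.coordT_eq fun l => ?_
  rw [dAt_curveTangent hp h (hκ.clm_mem l)]
  exact (l.hasFDerivAt.comp_hasDerivAt t₀ hv).deriv

/-! #### Forms in coordinates -/

variable (S) in
/-- Near `p₀`, the form `α` is given by `A` in the coordinates `κ`. -/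
def HasRep (κ : M → V) (p₀ : M) {n : ℕ} (α : Form S n) (A : V → V [⋀^Fin n]→L[ℝ] ℝ) : Prop :=
  ∀ᶠ p in 𝓝 p₀, ∀ ξ : Fin n → Tangent S p, α p ξ = A (κ p) fun a => coordT S κ p (ξ a)

lemma HasRep.congr_right {κ : M → V} {p₀ : M} {n : ℕ} {α : Form S n}
    {A A' : V → V [⋀^Fin n]→L[ℝ] ℝ} (h : HasRep S κ p₀ α A) (hκ : ContinuousAt κ p₀)
    (hA : A' =ᶠ[𝓝 (κ p₀)] A) : HasRep S κ p₀ α A' := by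
  filter_upwards [h, hκ.eventually hA] with p h1 h2 ξ
  rw [h1, h2]

lemma IsCoordAt.isExprAt_iff {κ : M → V} {p : M} (hκ : IsCoordAt S κ p) {J : Type*} [Fintype J]
    {n : ℕ} {α : Form S n} {f : J → M → ℝ} {g : J → Fin n → M → ℝ}
    {F : J → V → ℝ} {G : J → Fin n → V → ℝ} (hF : ∀ j, SmoothNear (F j) (κ p))
    (hG : ∀ j b, SmoothNear (G j b) (κ p)) (hf : ∀ j, f j =ᶠ[𝓝 p] F j ∘ κ)
    (hg : ∀ j b, g j b =ᶠ[𝓝 p] G j b ∘ κ) : IsExprAt S p α f g ↔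
      ∀ ξ : Fin n → Tangent S p, α p ξ = sumForm F G (κ p) fun a => coordT S κ p (ξ a) := by
  have h1 : ∀ j, f j ∈ S p ∧ ∀ i, g j i ∈ S p := fun j =>
    ⟨hκ.congr (hκ.comp_mem (hF j)) (hf j), fun b => hκ.congr (hκ.comp_mem (hG j b)) (hg j b)⟩
  simp only [IsExprAt, h1, implies_true, and_self, true_and, sumForm_apply,
    (hf _).self_of_nhds, Function.comp_apply, fun j b => hκ.dAt_eq (hG j b) (hg j b)]

lemma hasRep_of_isExprAt {κ : M → V} {p₀ : M} (hκ : ∀ᶠ p in 𝓝 p₀, IsCoordAt S κ p)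
    {J : Type*} [Finite J] [Fintype J] {n : ℕ} {α : Form S n} {f : J → M → ℝ}
    {g : J → Fin n → M → ℝ}
    {F : J → V → ℝ} {G : J → Fin n → V → ℝ} (hF : ∀ j, SmoothNear (F j) (κ p₀))
    (hG : ∀ j b, SmoothNear (G j b) (κ p₀)) (hf : ∀ j, f j =ᶠ[𝓝 p₀] F j ∘ κ)
    (hg : ∀ j b, g j b =ᶠ[𝓝 p₀] G j b ∘ κ) (h : ∀ᶠ p in 𝓝 p₀, IsExprAt S p α f g) :
    HasRep S κ p₀ α (sumForm F G) := by
  have hc := hκ.self_of_nhds.continuousAt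
  filter_upwards [h, hκ, hc.eventually (eventually_all.mpr fun j => (hF j).eventually),
    hc.eventually (eventually_all.mpr fun j => eventually_all.mpr fun b => (hG j b).eventually),
    eventually_all.mpr fun j => (hf j).eventuallyEq_nhds,
    eventually_all.mpr fun j => eventually_all.mpr fun b => (hg j b).eventuallyEq_nhds]
    with p h1 h2 h3 h4 h5 h6
  exact (h2.isExprAt_iff h3 h4 h5 h6).mp h1

lemma smoothNear_cons {n : ℕ} {F : V → ℝ} {G : Fin n → V → ℝ} {z : V} (hF : SmoothNear F z)
    (hG : ∀ b, SmoothNear (G b) z) (b : Fin (n + 1)) :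
    SmoothNear ((Fin.cons F G : Fin (n + 1) → V → ℝ) b) z :=
  Fin.cases hF hG b

lemma cons_eventuallyEq {κ : M → V} {p₀ : M} {n : ℕ} {f : M → ℝ} {g : Fin n → M → ℝ} {F : V → ℝ}
    {G : Fin n → V → ℝ} (hf : f =ᶠ[𝓝 p₀] F ∘ κ) (hg : ∀ b, g b =ᶠ[𝓝 p₀] G b ∘ κ) (b : Fin (n + 1)) :
    (Fin.cons f g : Fin (n + 1) → M → ℝ) b =ᶠ[𝓝 p₀] (Fin.cons F G : Fin (n + 1) → V → ℝ) b ∘ κ :=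
  Fin.cases hf hg b

lemma hasRep_extDeriv_of_isExprAt {κ : M → V} {p₀ : M} (hκ : ∀ᶠ p in 𝓝 p₀, IsCoordAt S κ p)
    {J : Type*} [Fintype J] {n : ℕ} {ψ : Form S (n + 1)} {f : J → M → ℝ} {g : J → Fin n → M → ℝ}
    {F : J → V → ℝ} {G : J → Fin n → V → ℝ} (hF : ∀ j, SmoothNear (F j) (κ p₀))
    (hG : ∀ j b, SmoothNear (G j b) (κ p₀)) (hf : ∀ j, f j =ᶠ[𝓝 p₀] F j ∘ κ)
    (hg : ∀ j b, g j b =ᶠ[𝓝 p₀] G j b ∘ κ)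
    (h : ∀ᶠ p in 𝓝 p₀, IsExprAt S p ψ (fun _ _ => 1) (fun j => Fin.cons (f j) (g j))) :
    HasRep S κ p₀ ψ (extDeriv (sumForm F G)) := by
  have h1 := hasRep_of_isExprAt hκ (F := fun _ _ => 1)
    (G := fun j => (Fin.cons (F j) (G j) : Fin (n + 1) → V → ℝ))
    (fun j => SmoothNear.const _ _) (fun j => smoothNear_cons (hF j) (hG j))
    (fun j => Filter.EventuallyEq.refl _ _) (fun j => cons_eventuallyEq (hf j) (hg j)) h
  refine h1.congr_right hκ.self_of_nhds.continuousAt ?_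
  filter_upwards [eventually_all.mpr fun j => (hF j).eventually,
    eventually_all.mpr fun j => eventually_all.mpr fun b => (hG j b).eventually] with z h2 h3
  exact extDeriv_sumForm h2 h3

/-- Near `p`, `α = ∑ⱼ fⱼ dgⱼ₁ ∧ … ∧ dgⱼₙ` and `ψ = ∑ⱼ dfⱼ ∧ dgⱼ₁ ∧ … ∧ dgⱼₙ`. -/
def ExtDerivAt (S : M → Subalgebra ℝ (M → ℝ)) (p : M) {n : ℕ} (α : Form S n)
    (ψ : Form S (n + 1)) : Prop :=
  ∃ (J : ℕ) (f : Fin J → M → ℝ) (g : Fin J → Fin n → M → ℝ), ∀ᶠ p' in 𝓝 p, IsExprAt S p' α f g ∧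
    IsExprAt S p' ψ (fun _ _ => 1) (fun j => Fin.cons (f j) (g j))

lemma isExtDeriv_iff {n : ℕ} {α : Form S n} {ψ : Form S (n + 1)} :
    IsExtDeriv S α ψ ↔ ∀ p, ExtDerivAt S p α ψ := by
  refine forall_congr' fun p => ⟨?_, ?_⟩
  · rintro ⟨U, hU, hp, J, f, g, h1, h2⟩
    exact ⟨J, f, g, Filter.mem_of_superset (hU.mem_nhds hp) fun p' hp' =>
      ⟨isExpr_iff.mp h1 p' hp', isExpr_iff.mp h2 p' hp'⟩⟩
  · rintro ⟨J, f, g, h⟩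
    obtain ⟨U, hU, hUo, hp⟩ := eventually_nhds_iff.mp h
    exact ⟨U, hUo, hp, J, f, g, isExpr_iff.mpr fun p' hp' => (hU p' hp').1,
      isExpr_iff.mpr fun p' hp' => (hU p' hp').2⟩

lemma isSmoothFormOn_iff {W : Set M} {n : ℕ} {α : Form S n} : IsSmoothFormOn S W α ↔
    ∀ p ∈ W, ∃ (J : ℕ) (f : Fin J → M → ℝ) (g : Fin J → Fin n → M → ℝ),
      ∀ᶠ p' in 𝓝 p, IsExprAt S p' α f g := by
  refine forall₂_congr fun p _ => ⟨?_, ?_⟩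
  · rintro ⟨U, hU, hp, J, f, g, h1⟩
    exact ⟨J, f, g, Filter.mem_of_superset (hU.mem_nhds hp) fun p' hp' => isExpr_iff.mp h1 p' hp'⟩
  · rintro ⟨J, f, g, h⟩
    obtain ⟨U, hU, hUo, hp⟩ := eventually_nhds_iff.mp h
    exact ⟨U, hUo, hp, J, f, g, isExpr_iff.mpr fun p' hp' => hU p' hp'⟩

lemma ExtDerivAt.add {p : M} {n : ℕ} {α α' : Form S n} {ψ ψ' : Form S (n + 1)}
    (h : ExtDerivAt S p α ψ) (h' : ExtDerivAt S p α' ψ') :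
    ExtDerivAt S p (α + α') (ψ + ψ') := by
  obtain ⟨J, f, g, h⟩ := h
  obtain ⟨J', f', g', h'⟩ := h'
  refine ⟨J + J', fun j => Sum.elim f f' (finSumFinEquiv.symm j),
    fun j => Sum.elim g g' (finSumFinEquiv.symm j), ?_⟩
  filter_upwards [h, h'] with q h1 h2
  refine ⟨(h1.1.add h2.1).reindex finSumFinEquiv.symm, ?_⟩
  convert (h1.2.add h2.2).reindex finSumFinEquiv.symm using 1
  · funext j
    cases finSumFinEquiv.symm j <;> rfl
  · funext j
    cases finSumFinEquiv.symm j <;> rfl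

lemma ExtDerivAt.pullback {F : M → N} (hF : IsSmoothMap S S' F) {p : M} (hFp : ContinuousAt F p)
    {n : ℕ} {α : Form S' n} {ψ : Form S' (n + 1)} (h : ExtDerivAt S' (F p) α ψ) :
    ExtDerivAt S p (pullback hF α) (pullback hF ψ) := by
  obtain ⟨J, f, g, h⟩ := h
  refine ⟨J, fun j => f j ∘ F, fun j b => g j b ∘ F, ?_⟩
  filter_upwards [hFp.eventually h] with p' h'
  refine ⟨h'.1.pullback hF, ?_⟩
  have := h'.2.pullback hF
  simp only [cons_comp] at this
  exact this

/-- `IsExtDeriv` asks for the same functions f, g in the expressions of the form and of its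
derivative, whence the second clause. -/
lemma HasRep.exists_isExprAt {κ : M → V} {p₀ : M} (hκ : ∀ᶠ p in 𝓝 p₀, IsCoordAt S κ p) {n : ℕ}
    {α : Form S n} {A : V → V [⋀^Fin n]→L[ℝ] ℝ} (hA : SmoothNear A (κ p₀))
    (h : HasRep S κ p₀ α A) :
    ∃ (J : ℕ) (f : Fin J → M → ℝ) (g : Fin J → Fin n → M → ℝ),
      (∀ᶠ p in 𝓝 p₀, IsExprAt S p α f g) ∧ ∀ ψ : Form S (n + 1), HasRep S κ p₀ ψ (extDeriv A) →
        ∀ᶠ p in 𝓝 p₀, IsExprAt S p ψ (fun _ _ => 1) (fun j => Fin.cons (f j) (g j)) := by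
  obtain ⟨J, L, l, hAL⟩ := exists_eq_sumForm A
  have hF : ∀ᶠ p in 𝓝 p₀, ∀ j, SmoothNear (fun z => L j (A z)) (κ p) := by
    filter_upwards [hκ.self_of_nhds.continuousAt.eventually hA.eventually] with p hp j
    exact hp.clm_comp (L j)
  have hG : ∀ j b z, SmoothNear (fun z => l j b z) z := fun j b => (l j b).contDiff.smoothNear
  refine ⟨J, fun j => (fun z => L j (A z)) ∘ κ, fun j b => (fun z => l j b z) ∘ κ, ?_,
    fun ψ hψ => ?_⟩
  · filter_upwards [h, hκ, hF] with p h1 h2 h3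
    rw [h2.isExprAt_iff h3 (fun j b => hG j b _) (fun j => Filter.EventuallyEq.refl _ _)
      fun j b => Filter.EventuallyEq.refl _ _]
    intro ξ
    rw [h1]
    conv_lhs => rw [hAL]
  · filter_upwards [hψ, hκ, hF] with p h1 h2 h3
    refine (h2.isExprAt_iff (F := fun _ _ => 1)
      (G := fun j => (Fin.cons (fun z => L j (A z)) fun b z => l j b z : Fin (n + 1) → V → ℝ))
      (fun j => SmoothNear.const _ _) (fun j => smoothNear_cons (h3 j) fun b => hG j b _)
      (fun j => Filter.EventuallyEq.refl (𝓝 p) (fun _ => (1 : ℝ)))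
      fun j => cons_eventuallyEq (Filter.EventuallyEq.refl _ _)
        fun b => Filter.EventuallyEq.refl _ _).mpr fun ξ => ?_
    rw [h1]
    conv_lhs => rw [hAL]
    rw [extDeriv_sumForm h3 fun j b => hG j b _]

lemma HasRep.extDerivAt {κ : M → V} {p₀ : M} (hκ : ∀ᶠ p in 𝓝 p₀, IsCoordAt S κ p) {n : ℕ}
    {α : Form S n} {ψ : Form S (n + 1)} {A : V → V [⋀^Fin n]→L[ℝ] ℝ} (hA : SmoothNear A (κ p₀))
    (h : HasRep S κ p₀ α A) (h' : HasRep S κ p₀ ψ (extDeriv A)) : ExtDerivAt S p₀ α ψ := by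
  obtain ⟨J, f, g, h1, h2⟩ := h.exists_isExprAt hκ hA
  exact ⟨J, f, g, h1.and (h2 ψ h')⟩

/-- Uniqueness of the coordinate form requires that the coordinates cover a neighbourhood and that
every coordinate vector is realized. Both hold on X; on jet spaces the coordinates stay in `jetSub`.
-/
lemma HasRep.eventuallyEq {κ : M → V} {p₀ : M} (hκ : 𝓝 (κ p₀) ≤ map κ (𝓝 p₀))
    (hT : ∀ᶠ p in 𝓝 p₀, Function.Surjective (coordT S κ p)) {n : ℕ}
    {α : Form S n} {A A' : V → V [⋀^Fin n]→L[ℝ] ℝ} (h : HasRep S κ p₀ α A)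
    (h' : HasRep S κ p₀ α A') : A =ᶠ[𝓝 (κ p₀)] A' := by
  refine hκ ?_
  rw [mem_map]
  filter_upwards [h, h', hT] with p h1 h2 h3
  ext v
  choose ξ hξ using fun a => h3 (v a)
  have := (h1 ξ).symm.trans (h2 ξ)
  simpa only [hξ] using this

end Topology

end FormCalculus

open FormCalculus

namespace AffineBundle

/-! ### Jets of functions between vector spaces -/

section JetCalculus

variable {E F : Type*} [NormedAddCommGroup E] [NormedSpace ℝ E] [FiniteDimensional ℝ E]
  [NormedAddCommGroup F] [NormedSpace ℝ F] [FiniteDimensional ℝ F]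

instance (j : ℕ) : FiniteDimensional ℝ (ContinuousMultilinearMap ℝ (fun _ : Fin j => E) F) :=
  FiniteDimensional.of_injective (V₂ := MultilinearMap ℝ (fun _ : Fin j => E) F)
    ContinuousMultilinearMap.toMultilinearMapLinear fun _ _ h =>
      ContinuousMultilinearMap.toMultilinearMap_injective h

/-- The `r`-jet of a function at a point. -/
def jetC (r : ℕ) (f : E → F) (z : E) : Coord E F r := (z, fun j => iteratedFDeriv ℝ j f z)

/-- The lift of tangent vectors of `E` by the total derivatives. -/
def totalLift (r : ℕ) (Y : Coord E F (r + 1)) : E →L[ℝ] Coord E F r :=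
  (ContinuousLinearMap.id ℝ E).prod (ContinuousLinearMap.pi fun j : Fin (r + 1) =>
    (Y.2 j.succ).curryLeft)

lemma contDiff_totalLift (r : ℕ) : ContDiff ℝ ∞ (totalLift (E := E) (F := F) r) := by
  rw [contDiff_clm_apply_iff]
  intro e
  refine contDiff_const.prodMk (contDiff_pi.mpr fun j => ?_)
  let L : ContinuousMultilinearMap ℝ (fun _ : Fin ((j : ℕ) + 1) => E) F →L[ℝ]
      ContinuousMultilinearMap ℝ (fun _ : Fin (j : ℕ) => E) F :=
    (ContinuousLinearMap.apply ℝ _ e).comp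
      (continuousMultilinearCurryLeftEquiv ℝ (fun _ : Fin ((j : ℕ) + 1) => E)
        F).toContinuousLinearEquiv.toContinuousLinearMap
  let pr := ContinuousLinearMap.proj (R := ℝ)
    (φ := fun i : Fin (r + 1 + 1) => ContinuousMultilinearMap ℝ (fun _ : Fin (i : ℕ) => E) F) j.succ
  exact (L.comp (pr.comp (ContinuousLinearMap.snd ℝ E _))).contDiff

lemma iteratedFDeriv_smoothNear {f : E → F} {z : E} (hf : SmoothNear f z) (j : ℕ) :
    SmoothNear (iteratedFDeriv ℝ j f) z := by
  filter_upwards [hf] with x hx using hx.iteratedFDeriv_right (by exact_mod_cast le_top)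

lemma smoothNear_jetC (r : ℕ) {f : E → F} {z : E} (hf : SmoothNear f z) :
    SmoothNear (jetC r f) z := by
  filter_upwards [eventually_all.mpr fun j : Fin (r + 1) =>
    iteratedFDeriv_smoothNear hf j] with x hx
  exact contDiffAt_id.prodMk (contDiffAt_pi.mpr hx)

/-- Currying the derivative of order j + 1 in its first argument gives the derivative of the one of
order j. This is how the total derivatives d_λ enter: the differential of a prolonged section is
determined by its jet of one order more. -/
lemma hasFDerivAt_jetC (r : ℕ) {f : E → F} {z : E} (hf : SmoothNear f z) :
    HasFDerivAt (jetC r f) (totalLift r (jetC (r + 1) f z)) z := by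
  refine (hasFDerivAt_id z).prodMk (hasFDerivAt_pi.mpr fun j => ?_)
  have h := (iteratedFDeriv_smoothNear hf j).differentiableAt.hasFDerivAt
  exact h

lemma jetC_congr (r : ℕ) {f g : E → F} {z : E} (h : f =ᶠ[𝓝 z] g) : jetC r f z = jetC r g z :=
  Prod.ext rfl (funext fun j => (h.iteratedFDeriv ℝ j).self_of_nhds)

/-- The transformation of derivatives under a change of coordinates. -/
lemma exists_iteratedFDeriv_transform {Ω : Set E} (hΩ : IsOpen Ω) {θ : E → E} {P : E → E →L[ℝ] E}
    {A : E × F → F} (hθ : ContDiffOn ℝ ∞ θ Ω) (hP : ContDiffOn ℝ ∞ P Ω)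
    (hθP : ∀ z ∈ Ω, (fderiv ℝ θ z).comp (P z) = ContinuousLinearMap.id ℝ E)
    (hA : ContDiffOn ℝ ∞ A (Prod.fst ⁻¹' Ω)) (j : ℕ) :
    ∃ Ψ : Coord E F j → ContinuousMultilinearMap ℝ (fun _ : Fin j => E) F,
      ContDiffOn ℝ ∞ Ψ (Prod.fst ⁻¹' Ω) ∧ ∀ z ∈ Ω, ∀ f g : E → F, SmoothNear f z →
        SmoothNear g (θ z) → (g ∘ θ) =ᶠ[𝓝 z] (fun x => A (x, f x)) →
          iteratedFDeriv ℝ j g (θ z) = Ψ (jetC j f z) := by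
  have hΩ' : ∀ r, IsOpen (Prod.fst ⁻¹' Ω : Set (Coord E F r)) := fun r =>
    hΩ.preimage continuous_fst
  induction j with
  | zero =>
    refine ⟨fun Y => (continuousMultilinearCurryFin0 ℝ E F).symm
      (A (Y.1, continuousMultilinearCurryFin0 ℝ E F (Y.2 0))), ?_, ?_⟩
    · refine (continuousMultilinearCurryFin0 ℝ E F).symm.contDiff.comp_contDiffOn ?_
      refine hA.comp (ContDiff.contDiffOn ?_) fun Y hY => hY
      refine contDiff_fst.prodMk ((continuousMultilinearCurryFin0 ℝ E F).contDiff.comp ?_)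
      exact ((ContinuousLinearMap.proj (R := ℝ) (φ := fun i : Fin (0 + 1) =>
        ContinuousMultilinearMap ℝ (fun _ : Fin (i : ℕ) => E) F) 0).comp
          (ContinuousLinearMap.snd ℝ E _)).contDiff
    · intro z hz f g hf hg h
      have h0 : g (θ z) = A (z, f z) := h.self_of_nhds
      ext v
      simp [jetC, h0]
  | succ j ih =>
    obtain ⟨Ψ, hΨ, hΨ'⟩ := ih
    -- Differentiate (Dʲg) ∘ θ = Ψ ∘ jʲf and cancel Dθ by composing with its right inverse P. By
    -- `hasFDerivAt_jetC` the result is a function of the jet of order j + 1.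
    refine ⟨fun Y => (continuousMultilinearCurryLeftEquiv ℝ (fun _ : Fin (j + 1) => E) F).symm
      (((fderiv ℝ Ψ (coordTrunc E F j.le_succ Y)).comp (totalLift j Y)).comp (P Y.1)), ?_, ?_⟩
    · let L : (E →L[ℝ] ContinuousMultilinearMap ℝ (fun _ : Fin j => E) F) →L[ℝ]
          ContinuousMultilinearMap ℝ (fun _ : Fin (j + 1) => E) F :=
        (continuousMultilinearCurryLeftEquiv ℝ (fun _ : Fin (j + 1) => E)
          F).symm.toContinuousLinearEquiv.toContinuousLinearMap
      refine ContDiff.comp_contDiffOn (ContinuousLinearMap.contDiff (𝕜 := ℝ)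
        (E := E →L[ℝ] ContinuousMultilinearMap ℝ (fun _ : Fin j => E) F)
        (F := ContinuousMultilinearMap ℝ (fun _ : Fin (j + 1) => E) F) L) ?_
      refine ContDiffOn.clm_comp (ContDiffOn.clm_comp ?_ (contDiff_totalLift j).contDiffOn)
        (hP.comp contDiff_fst.contDiffOn fun Y hY => hY)
      exact (hΨ.fderiv_of_isOpen (hΩ' j) (by simp)).comp
        (contDiff_coordTrunc j.le_succ).contDiffOn fun Y hY => hY
    · intro z hz f g hf hg h
      have hθz : SmoothNear θ z := hθ.smoothNear hΩ hz
      have h1 : (iteratedFDeriv ℝ j g) ∘ θ =ᶠ[𝓝 z] Ψ ∘ jetC j f := by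
        filter_upwards [hΩ.mem_nhds hz, hf.eventually, hθz.continuousAt.eventually hg.eventually,
          h.eventuallyEq_nhds] with x h1 h2 h3 h4
        exact hΨ' x h1 f g h2 h3 h4
      have h2 : HasFDerivAt ((iteratedFDeriv ℝ j g) ∘ θ)
          ((fderiv ℝ (iteratedFDeriv ℝ j g) (θ z)).comp (fderiv ℝ θ z)) z :=
        (iteratedFDeriv_smoothNear hg j).differentiableAt.hasFDerivAt.comp z
          hθz.differentiableAt.hasFDerivAt
      have h3 : HasFDerivAt (Ψ ∘ jetC j f)
          ((fderiv ℝ Ψ (jetC j f z)).comp (totalLift j (jetC (j + 1) f z))) z :=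
        (hΨ.smoothNear (hΩ' j) (z := jetC j f z) hz).differentiableAt.hasFDerivAt.comp z
          (hasFDerivAt_jetC j hf)
      have h4 := h2.unique (h3.congr_of_eventuallyEq h1)
      have h5 : fderiv ℝ (iteratedFDeriv ℝ j g) (θ z) =
          ((fderiv ℝ Ψ (jetC j f z)).comp (totalLift j (jetC (j + 1) f z))).comp (P z) := by
        rw [← h4, ContinuousLinearMap.comp_assoc, hθP z hz, ContinuousLinearMap.comp_id]
      rw [iteratedFDeriv_succ_eq_comp_left, Function.comp_apply, h5]
      rfl

end JetCalculus

variable {E E' F X Y : Type*}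
  [NormedAddCommGroup E] [NormedSpace ℝ E] [FiniteDimensional ℝ E]
  [NormedAddCommGroup E'] [NormedSpace ℝ E']
  [NormedAddCommGroup F] [NormedSpace ℝ F] [FiniteDimensional ℝ F]
  [TopologicalSpace X] [ChartedSpace E X] [IsManifold 𝓘(ℝ, E) ∞ X]
  [TopologicalSpace Y] [ChartedSpace E' Y] [IsManifold 𝓘(ℝ, E') ∞ Y]
  {B : AffineBundle E E' F X Y}

/-! ### Bundle charts and local sections -/

lemma BundleChart.isOpen_dom (c : B.BundleChart) : IsOpen c.dom :=
  c.base.open_source.inter c.triv.open_baseSet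

lemma BundleChart.smooth_base_symm (c : B.BundleChart) :
    ContMDiffOn 𝓘(ℝ, E) 𝓘(ℝ, E) ∞ c.base.symm c.base.target :=
  contMDiffOn_symm_of_mem_maximalAtlas c.base_mem

lemma BundleChart.smooth_base (c : B.BundleChart) :
    ContMDiffOn 𝓘(ℝ, E) 𝓘(ℝ, E) ∞ c.base c.base.source :=
  contMDiffOn_of_mem_maximalAtlas c.base_mem

lemma exists_bundleChart (B : AffineBundle E E' F X Y) (x : X) :
    ∃ c : B.BundleChart, x ∈ c.dom := by
  obtain ⟨e, he, hx⟩ := B.exists_mem x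
  exact ⟨⟨e, he, chartAt E x, IsManifold.chart_mem_maximalAtlas x⟩, mem_chart_source E x, hx⟩

lemma LocalSection.mem_source (s : B.LocalSection) {e : Bundle.Trivialization F B.proj} {x : X}
    (hx : x ∈ s.dom) (he : x ∈ e.baseSet) : s.toFun x ∈ e.source := by
  rw [e.mem_source, s.proj_eq x hx]
  exact he

lemma LocalSection.smooth_snd (s : B.LocalSection) {e : Bundle.Trivialization F B.proj}
    (he : e ∈ B.atlas) : ContMDiffOn 𝓘(ℝ, E) 𝓘(ℝ, F) ∞ (fun x => (e (s.toFun x)).2)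
      (s.dom ∩ e.baseSet) := by
  have h1 : ContMDiffOn 𝓘(ℝ, E) (𝓘(ℝ, E).prod 𝓘(ℝ, F)) ∞ (fun x => e (s.toFun x))
      (s.dom ∩ e.baseSet) :=
    (B.smooth e he).comp (s.smooth.mono inter_subset_left) fun x hx => s.mem_source hx.1 hx.2
  exact contMDiff_snd.comp_contMDiffOn h1

lemma BundleChart.smoothNear_rep (c : B.BundleChart) (s : B.LocalSection) {x : X} (hx : x ∈ c.dom)
    (hs : x ∈ s.dom) : SmoothNear (c.rep s) (c.base x) := by
  have hO : IsOpen (c.base.target ∩ c.base.symm ⁻¹' (s.dom ∩ c.triv.baseSet)) :=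
    c.base.isOpen_inter_preimage_symm (s.isOpen_dom.inter c.triv.open_baseSet)
  have h1 : ContMDiffOn 𝓘(ℝ, E) 𝓘(ℝ, F) ∞ (c.rep s)
      (c.base.target ∩ c.base.symm ⁻¹' (s.dom ∩ c.triv.baseSet)) :=
    (s.smooth_snd c.triv_mem).comp (c.smooth_base_symm.mono inter_subset_left) fun z hz => hz.2
  refine (contMDiffOn_iff_contDiffOn.mp h1).smoothNear hO ⟨c.base.map_source hx.1, ?_⟩
  rw [mem_preimage, c.base.left_inv hx.1]
  exact ⟨hs, hx.2⟩

/-- The local section with prescribed fibre coordinate in a trivialization. -/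
lemma exists_localSection_of_contMDiffOn {e : Bundle.Trivialization F B.proj} (he : e ∈ B.atlas)
    {U : Set X} (hU : IsOpen U) (hUe : U ⊆ e.baseSet) {v : X → F}
    (hv : ContMDiffOn 𝓘(ℝ, E) 𝓘(ℝ, F) ∞ v U) :
    ∃ s : B.LocalSection, s.dom = U ∧
      ∀ x ∈ U, s.toFun x = e.toOpenPartialHomeomorph.symm (x, v x) := by
  refine ⟨⟨U, hU, fun x => e.toOpenPartialHomeomorph.symm (x, v x), ?_, fun x hx => ?_⟩, rfl,
    fun x _ => rfl⟩
  · exact (B.smooth_symm e he).comp (contMDiffOn_id.prodMk hv) fun x hx =>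
      e.mem_target.mpr (hUe hx)
  · exact e.proj_symm_apply (e.mem_target.mpr (hUe hx))

lemma BundleChart.exists_localSection (c : B.BundleChart) {x : X} (hx : x ∈ c.dom) {f : E → F}
    (hf : SmoothNear f (c.base x)) :
    ∃ s : B.LocalSection, x ∈ s.dom ∧ c.rep s =ᶠ[𝓝 (c.base x)] f := by
  obtain ⟨O, hO, hxO, hfO⟩ := hf.exists_contDiffOn
  have hU : IsOpen (c.triv.baseSet ∩ (c.base.source ∩ c.base ⁻¹' O)) :=
    c.triv.open_baseSet.inter (c.base.isOpen_inter_preimage hO)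
  obtain ⟨s, hs, hs'⟩ := exists_localSection_of_contMDiffOn c.triv_mem hU inter_subset_left
    (v := f ∘ c.base) ((contMDiffOn_iff_contDiffOn.mpr hfO).comp
      (c.smooth_base.mono fun x hx => hx.2.1) fun x hx => hx.2.2)
  refine ⟨s, hs ▸ ⟨hx.2, hx.1, hxO⟩, ?_⟩
  have h1 : c.base.target ∩ c.base.symm ⁻¹' (c.triv.baseSet ∩ (c.base.source ∩ c.base ⁻¹' O)) ∈
      𝓝 (c.base x) := by
    refine (c.base.isOpen_inter_preimage_symm hU).mem_nhds ⟨c.base.map_source hx.1, ?_⟩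
    rw [mem_preimage, c.base.left_inv hx.1]
    exact ⟨hx.2, hx.1, hxO⟩
  filter_upwards [h1] with z hz
  rw [BundleChart.rep, hs' _ hz.2, c.triv.apply_symm_apply (c.triv.mem_target.mpr hz.2.1),
    Function.comp_apply, c.base.right_inv hz.1]

/-! ### Coordinates of jets and their transformations -/

lemma exists_eq_jet {r : ℕ} (q : B.Jet r) :
    ∃ (s : B.LocalSection) (h : q.pt ∈ s.dom), q = jet r s q.pt h := by
  induction q using Quotient.inductionOn with
  | h p => exact ⟨p.1.2, p.2, rfl⟩

lemma trunc_jet {r r' : ℕ} (h : r ≤ r') (s : B.LocalSection) (x : X) (hx : x ∈ s.dom) :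
    (jet r' s x hx).trunc h = jet r s x hx := rfl

lemma coord_jet (c : B.BundleChart) (r : ℕ) (s : B.LocalSection) {x : X} (hx : x ∈ s.dom)
    (hc : x ∈ c.dom) : c.coord r (jet r s x hx) = jetC r (c.rep s) (c.base x) := by
  classical
  exact if_pos hc

/-- The overlap of two bundle charts, in the coordinates of the first. -/
def BundleChart.overlap (c c' : B.BundleChart) : Set E :=
  c.base.target ∩ c.base.symm ⁻¹' (c.dom ∩ c'.dom)

lemma BundleChart.isOpen_overlap (c c' : B.BundleChart) : IsOpen (c.overlap c') :=
  c.base.isOpen_inter_preimage_symm (c.isOpen_dom.inter c'.isOpen_dom)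

lemma BundleChart.mem_overlap {c c' : B.BundleChart} {x : X} (hx : x ∈ c.dom) :
    c.base x ∈ c.overlap c' ↔ x ∈ c'.dom := by
  simp [overlap, c.base.map_source hx.1, c.base.left_inv hx.1, hx]

lemma BundleChart.contDiffOn_transition (c c' : B.BundleChart) :
    ContDiffOn ℝ ∞ (c'.base ∘ c.base.symm) (c.overlap c') :=
  contMDiffOn_iff_contDiffOn.mp (c'.smooth_base.comp
    (c.smooth_base_symm.mono inter_subset_left) fun _ hz => hz.2.2.1)

/-- `exists_iteratedFDeriv_transform` for the change θ of base charts, the derivative P of its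
inverse and the fibre transition A. Only smoothness of the transition maps is used here, not
affineness. -/
lemma BundleChart.exists_transform (c c' : B.BundleChart) (r : ℕ) :
    ∃ Ψ : Coord E F r → Coord E F r, ContDiffOn ℝ ∞ Ψ (Prod.fst ⁻¹' c.overlap c') ∧
      ∀ q : B.Jet r, q.pt ∈ c.dom → q.pt ∈ c'.dom → c'.coord r q = Ψ (c.coord r q) := by
  let θ : E → E := c'.base ∘ c.base.symm
  let P : E → E →L[ℝ] E := fun z => fderiv ℝ (c.base ∘ c'.base.symm) (θ z)
  let A : E × F → F := fun p =>
    (c'.triv (c.triv.toOpenPartialHomeomorph.symm (c.base.symm p.1, p.2))).2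
  have hθ := c.contDiffOn_transition c'
  have hθmem : ∀ z ∈ c.overlap c', θ z ∈ c'.overlap c := fun z hz =>
    (BundleChart.mem_overlap (c := c') hz.2.2).mpr hz.2.1
  have hP : ContDiffOn ℝ ∞ P (c.overlap c') :=
    ((c'.contDiffOn_transition c).fderiv_of_isOpen (c'.isOpen_overlap c) (by simp)).comp hθ hθmem
  have hinv : ∀ z ∈ c.overlap c', (c.base ∘ c'.base.symm) (θ z) = z := by
    intro z hz
    simp only [θ, Function.comp_apply]
    rw [c'.base.left_inv hz.2.2.1, c.base.right_inv hz.1]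
  have hθP : ∀ z ∈ c.overlap c', (fderiv ℝ θ z).comp (P z) = ContinuousLinearMap.id ℝ E := by
    intro z hz
    have h1 : HasFDerivAt (c.base ∘ c'.base.symm) (P z) (θ z) :=
      (((c'.contDiffOn_transition c).smoothNear (c'.isOpen_overlap c)
        (hθmem z hz)).differentiableAt).hasFDerivAt
    have h2 : HasFDerivAt θ (fderiv ℝ θ z) ((c.base ∘ c'.base.symm) (θ z)) := by
      rw [hinv z hz]
      exact (hθ.smoothNear (c.isOpen_overlap c') hz).differentiableAt.hasFDerivAt
    refine (h2.comp (θ z) h1).unique ((hasFDerivAt_id (θ z)).congr_of_eventuallyEq ?_)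
    filter_upwards [(c'.isOpen_overlap c).mem_nhds (hθmem z hz)] with w hw
    simp only [θ, Function.comp_apply]
    rw [c.base.left_inv hw.2.2.1, c'.base.right_inv hw.1]
    rfl
  have hA : ContDiffOn ℝ ∞ A (Prod.fst ⁻¹' c.overlap c') := by
    have h1 : ContMDiffOn (𝓘(ℝ, E).prod 𝓘(ℝ, F)) (𝓘(ℝ, E).prod 𝓘(ℝ, F)) ∞
        (fun p : E × F => (c.base.symm p.1, p.2)) (Prod.fst ⁻¹' c.overlap c') :=
      ((c.smooth_base_symm.mono (t := c.base.target) fun _ h => h).comp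
        contMDiff_fst.contMDiffOn fun p hp => hp.1).prodMk contMDiff_snd.contMDiffOn
    have h2 : ContMDiffOn (𝓘(ℝ, E).prod 𝓘(ℝ, F)) 𝓘(ℝ, E') ∞
        (fun p : E × F => c.triv.toOpenPartialHomeomorph.symm (c.base.symm p.1, p.2))
        (Prod.fst ⁻¹' c.overlap c') :=
      (B.smooth_symm c.triv c.triv_mem).comp h1 fun p hp => c.triv.mem_target.mpr hp.2.1.2
    have h3 : ContMDiffOn (𝓘(ℝ, E).prod 𝓘(ℝ, F)) (𝓘(ℝ, E).prod 𝓘(ℝ, F)) ∞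
        (fun p : E × F => c'.triv (c.triv.toOpenPartialHomeomorph.symm (c.base.symm p.1, p.2)))
        (Prod.fst ⁻¹' c.overlap c') := by
      refine (B.smooth c'.triv c'.triv_mem).comp h2 fun p hp => ?_
      rw [mem_preimage, c'.triv.mem_source,
        c.triv.proj_symm_apply (c.triv.mem_target.mpr hp.2.1.2)]
      exact hp.2.2.2
    have h4 : ContMDiffOn (𝓘(ℝ, E).prod 𝓘(ℝ, F)) 𝓘(ℝ, F) ∞ A (Prod.fst ⁻¹' c.overlap c') :=
      contMDiff_snd.comp_contMDiffOn h3
    rw [← contMDiffOn_iff_contDiffOn, modelWithCornersSelf_prod, ← chartedSpaceSelf_prod]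
    exact h4
  choose Ψ hΨ hΨ' using exists_iteratedFDeriv_transform (c.isOpen_overlap c') hθ hP hθP hA
  refine ⟨fun Y => (θ Y.1, fun j => Ψ j (coordTrunc E F (Nat.lt_succ_iff.mp j.2) Y)), ?_, ?_⟩
  · refine (hθ.comp contDiff_fst.contDiffOn fun Y hY => hY).prodMk (contDiffOn_pi.mpr fun j => ?_)
    exact (hΨ j).comp (contDiff_coordTrunc _).contDiffOn fun Y hY => hY
  · intro q hc hc'
    obtain ⟨s, hs, hq⟩ := exists_eq_jet q
    generalize q.pt = x at hs hq hc hc'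
    subst hq
    rw [coord_jet c r s hs hc, coord_jet c' r s hs hc']
    have hx : c.base x ∈ c.overlap c' := (BundleChart.mem_overlap hc).mpr hc'
    have hθx : θ (c.base x) = c'.base x := by
      simp only [θ, Function.comp_apply]
      rw [c.base.left_inv hc.1]
    refine Prod.ext hθx.symm (funext fun j => ?_)
    change iteratedFDeriv ℝ j (c'.rep s) (c'.base x) = Ψ j (jetC j (c.rep s) (c.base x))
    rw [← hθx]
    refine hΨ' j _ hx _ _ (c.smoothNear_rep s hc hs) ?_ ?_
    · change SmoothNear (c'.rep s) (θ (c.base x))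
      rw [hθx]
      exact c'.smoothNear_rep s hc' hs
    · have h1 : c.base.target ∩ c.base.symm ⁻¹' (s.dom ∩ (c.dom ∩ c'.dom)) ∈ 𝓝 (c.base x) := by
        refine (c.base.isOpen_inter_preimage_symm (s.isOpen_dom.inter
          (c.isOpen_dom.inter c'.isOpen_dom))).mem_nhds ⟨c.base.map_source hc.1, ?_⟩
        rw [mem_preimage, c.base.left_inv hc.1]
        exact ⟨hs, hc, hc'⟩
      filter_upwards [h1] with z hz
      have h2 := s.mem_source hz.2.1 hz.2.2.1.2
      have h3 : (c.base.symm z, (c.triv (s.toFun (c.base.symm z))).2) =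
          c.triv (s.toFun (c.base.symm z)) :=
        Prod.ext ((c.triv.coe_fst h2).trans (s.proj_eq _ hz.2.1)).symm rfl
      have h4 : c.triv.toOpenPartialHomeomorph.symm (c.triv (s.toFun (c.base.symm z))) =
          s.toFun (c.base.symm z) := c.triv.toOpenPartialHomeomorph.left_inv h2
      simp only [BundleChart.rep, A, Function.comp_apply]
      rw [c'.base.left_inv hz.2.2.2.1, h3, h4]

/-- Jets are defined by comparing derivatives in all charts; `BundleChart.exists_transform` carries
equality from one chart to every other. -/
lemma Jet.eq_of_coord_eq (c : B.BundleChart) {r : ℕ} {q q' : B.Jet r} (hq : q.pt ∈ c.dom)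
    (hq' : q'.pt ∈ c.dom) (h : c.coord r q = c.coord r q') : q = q' := by
  have hpt : q.pt = q'.pt := by
    refine c.base.injOn hq.1 hq'.1 ?_
    rw [← coord_fst c q hq, ← coord_fst c q' hq', h]
  obtain ⟨s, hs, e⟩ := exists_eq_jet q
  obtain ⟨s', hs', e'⟩ := exists_eq_jet q'
  generalize q'.pt = x at hs' e' hpt hq'
  generalize q.pt = x' at hs e hpt hq
  subst hpt e e'
  refine Quotient.sound (s := jetSetoid B r) ⟨rfl, fun c' hc' j hj => ?_⟩
  obtain ⟨Ψ, -, hΨ⟩ := c.exists_transform c' r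
  have h1 := hΨ (jet r s x' hs) hq hc'
  rw [h, ← hΨ (jet r s' x' hs') hq' hc'] at h1
  rw [coord_jet c' r s hs hc', coord_jet c' r s' hs' hc'] at h1
  exact congrFun (congrArg Prod.snd h1) ⟨j, Nat.lt_succ_of_le hj⟩

end AffineBundle

namespace AffineBundle

variable {E E' F X Y : Type*}
  [NormedAddCommGroup E] [NormedSpace ℝ E] [FiniteDimensional ℝ E]
  [NormedAddCommGroup E'] [NormedSpace ℝ E']
  [NormedAddCommGroup F] [NormedSpace ℝ F] [FiniteDimensional ℝ F]
  [TopologicalSpace X] [ChartedSpace E X] [IsManifold 𝓘(ℝ, E) ∞ X]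
  [TopologicalSpace Y] [ChartedSpace E' Y] [IsManifold 𝓘(ℝ, E') ∞ Y]
  {B : AffineBundle E E' F X Y}

/-! ### The topology and the smooth functions of the jet manifolds -/

/-- The topology is generated by all charts at once. Continuity of the coordinate transformations
makes a single chart around q sufficient for describing neighbourhoods of q. -/
lemma mem_nhds_jet_iff (c : B.BundleChart) {r : ℕ} {q : B.Jet r} (hq : q.pt ∈ c.dom)
    {U : Set (B.Jet r)} : U ∈ 𝓝 q ↔ ∃ O : Set (Coord E F r), IsOpen O ∧ c.coord r q ∈ O ∧
      ∀ q' : B.Jet r, q'.pt ∈ c.dom → c.coord r q' ∈ O → q' ∈ U := by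
  constructor
  · intro hU
    suffices h : comap (c.coord r) (𝓝 (c.coord r q)) ⊓ 𝓟 {q' | q'.pt ∈ c.dom} ≤ 𝓝 q by
      have h1 := h hU
      rw [mem_inf_principal, mem_comap] at h1
      obtain ⟨O, hO, hOU⟩ := h1
      obtain ⟨O', hO', hO'o, hqO'⟩ := mem_nhds_iff.mp hO
      exact ⟨O', hO'o, hqO', fun q' h1 h2 => hOU (hO' h2) h1⟩
    refine le_of_le_of_eq ?_ (TopologicalSpace.nhds_generateFrom (a := q)).symm
    simp only [le_iInf_iff]
    rintro W ⟨hqW, c', O, hO, rfl⟩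
    rw [le_principal_iff, mem_inf_principal, mem_comap]
    obtain ⟨Ψ, hΨ, hΨ'⟩ := c.exists_transform c' r
    have hx : c.coord r q ∈ Prod.fst ⁻¹' c.overlap c' := by
      rw [mem_preimage, coord_fst c q hq]
      exact (BundleChart.mem_overlap hq).mpr hqW.1
    have hopen : IsOpen (Prod.fst ⁻¹' c.overlap c' : Set (Coord E F r)) :=
      (c.isOpen_overlap c').preimage continuous_fst
    refine ⟨Prod.fst ⁻¹' c.overlap c' ∩ Ψ ⁻¹' O, ?_, ?_⟩
    · refine (hΨ.continuousOn.isOpen_inter_preimage hopen hO).mem_nhds ⟨hx, ?_⟩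
      rw [mem_preimage, ← hΨ' q hq hqW.1]
      exact hqW.2
    · intro q' hq' hq'c
      have h1 : q'.pt ∈ c'.dom := by
        have := hq'.1
        rw [mem_preimage, coord_fst c q' hq'c] at this
        exact (BundleChart.mem_overlap hq'c).mp this
      refine ⟨h1, ?_⟩
      rw [hΨ' q' hq'c h1]
      exact hq'.2
  · rintro ⟨O, hO, hqO, h⟩
    refine mem_of_superset (IsOpen.mem_nhds
      (TopologicalSpace.isOpen_generateFrom_of_mem ⟨c, O, hO, rfl⟩) ⟨hq, hqO⟩) ?_
    exact fun q' hq' => h q' hq'.1 hq'.2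

lemma continuousAt_coord (c : B.BundleChart) {r : ℕ} {q : B.Jet r} (hq : q.pt ∈ c.dom) :
    ContinuousAt (c.coord r) q := by
  intro U hU
  obtain ⟨O, hO, hOo, hqO⟩ := mem_nhds_iff.mp hU
  exact (mem_nhds_jet_iff c hq).mpr ⟨O, hOo, hqO, fun q' _ h => hO h⟩

lemma eventually_pt_mem (c : B.BundleChart) {r : ℕ} {q : B.Jet r} (hq : q.pt ∈ c.dom) :
    ∀ᶠ q' : B.Jet r in 𝓝 q, q'.pt ∈ c.dom :=
  (mem_nhds_jet_iff c hq).mpr ⟨univ, isOpen_univ, mem_univ _, fun _ h _ => h⟩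

lemma tendsto_jet (c : B.BundleChart) {r : ℕ} {q : B.Jet r} (hq : q.pt ∈ c.dom) {Z : Type*}
    {l : Filter Z} {f : Z → B.Jet r} (h1 : ∀ᶠ z in l, (f z).pt ∈ c.dom)
    (h2 : Tendsto (fun z => c.coord r (f z)) l (𝓝 (c.coord r q))) : Tendsto f l (𝓝 q) := by
  intro U hU
  obtain ⟨O, hO, hqO, h⟩ := (mem_nhds_jet_iff c hq).mp hU
  rw [mem_map]
  filter_upwards [h1, h2 (hO.mem_nhds hqO)] with z hz1 hz2 using h _ hz1 hz2

lemma smoothJet_rep (c : B.BundleChart) {r : ℕ} {q : B.Jet r} (hq : q.pt ∈ c.dom)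
    {f : B.Jet r → ℝ} (hf : f ∈ smoothJet B r q) :
    ∃ g : Coord E F r → ℝ, SmoothNear g (c.coord r q) ∧ f =ᶠ[𝓝 q] g ∘ c.coord r := by
  obtain ⟨O, g, hO, hqO, hg, h⟩ := hf c hq
  exact ⟨g, hg.smoothNear hO hqO, (mem_nhds_jet_iff c hq).mpr ⟨O, hO, hqO, h⟩⟩

lemma smoothJet_congr {r : ℕ} {q : B.Jet r} {f f' : B.Jet r → ℝ} (hf : f ∈ smoothJet B r q)
    (h : f' =ᶠ[𝓝 q] f) : f' ∈ smoothJet B r q := by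
  intro c hc
  obtain ⟨O, g, hO, hqO, hg, hfg⟩ := hf c hc
  obtain ⟨O', hO', hqO', h'⟩ := (mem_nhds_jet_iff c hc).mp h
  exact ⟨O ∩ O', g, hO.inter hO', ⟨hqO, hqO'⟩, hg.mono inter_subset_left, fun q' h1 h2 =>
    (h' q' h1 h2.2).trans (hfg q' h1 h2.1)⟩

lemma isCoordAt_coord (c : B.BundleChart) {r : ℕ} {q : B.Jet r} (hq : q.pt ∈ c.dom) :
    IsCoordAt (smoothJet B r) (c.coord r) q where
  congr := smoothJet_congr
  comp_mem := by
    intro g hg c' hc'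
    obtain ⟨O, hO, hqO, hgO⟩ := hg.exists_contDiffOn
    obtain ⟨Ψ, hΨ, hΨ'⟩ := c'.exists_transform c r
    have hopen : IsOpen (Prod.fst ⁻¹' c'.overlap c : Set (Coord E F r)) :=
      (c'.isOpen_overlap c).preimage continuous_fst
    refine ⟨Prod.fst ⁻¹' c'.overlap c ∩ Ψ ⁻¹' O, g ∘ Ψ,
      hΨ.continuousOn.isOpen_inter_preimage hopen hO, ⟨?_, ?_⟩,
      hgO.comp (hΨ.mono inter_subset_left) fun z hz => hz.2, fun q' h1 h2 => ?_⟩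
    · rw [mem_preimage, coord_fst c' q hc']
      exact (BundleChart.mem_overlap hc').mpr hq
    · rwa [mem_preimage, ← hΨ' q hc' hq]
    · have h3 := h2.1
      rw [mem_preimage, coord_fst c' q' h1] at h3
      rw [Function.comp_apply, Function.comp_apply, hΨ' q' h1 ((BundleChart.mem_overlap h1).mp h3)]
  continuousAt := continuousAt_coord c hq

/-! ### Coordinates on the infinite-order jet space -/

/-- The coordinates of order at most `r` on `J^∞ Y`. -/
def BundleChart.coordInf (c : B.BundleChart) (r : ℕ) (q : B.JetInf) : Coord E F r :=
  c.coord r (toJet r q)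

lemma continuous_toJet (r : ℕ) : Continuous (toJet (B := B) r) :=
  (continuous_apply r).comp continuous_subtype_val

lemma eventually_toBase_mem (c : B.BundleChart) {q : B.JetInf} (hq : toBase q ∈ c.dom) :
    ∀ᶠ q' : B.JetInf in 𝓝 q, toBase q' ∈ c.dom :=
  (continuous_toJet 0).continuousAt.eventually (eventually_pt_mem c hq)

lemma tendsto_jetInf (c : B.BundleChart) {q : B.JetInf} (hq : toBase q ∈ c.dom) {Z : Type*}
    {l : Filter Z} {f : Z → B.JetInf} (h1 : ∀ᶠ z in l, toBase (f z) ∈ c.dom)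
    (h2 : ∀ r, Tendsto (fun z => c.coordInf r (f z)) l (𝓝 (c.coordInf r q))) :
    Tendsto f l (𝓝 q) := by
  rw [tendsto_subtype_rng, tendsto_pi_nhds]
  intro r
  refine tendsto_jet c ?_ ?_ (h2 r)
  · exact (pt_toJet r q).symm ▸ hq
  · filter_upwards [h1] with z hz
    exact (pt_toJet r (f z)).symm ▸ hz

lemma coordInf_trunc (c : B.BundleChart) {r r' : ℕ} (h : r ≤ r') (q : B.JetInf) :
    coordTrunc E F h (c.coordInf r' q) = c.coordInf r q := by
  rw [BundleChart.coordInf, ← coord_trunc, toJet_trunc]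
  rfl

lemma coordInf_fst (c : B.BundleChart) (r : ℕ) {q : B.JetInf} (hq : toBase q ∈ c.dom) :
    (c.coordInf r q).1 = c.base (toBase q) := by
  rw [BundleChart.coordInf, coord_fst c _ ((pt_toJet r q).symm ▸ hq), pt_toJet]

lemma JetInf.eq_of_coordInf_eq (c : B.BundleChart) {q q' : B.JetInf} (hq : toBase q ∈ c.dom)
    (hq' : toBase q' ∈ c.dom) (h : ∀ r, c.coordInf r q = c.coordInf r q') : q = q' :=
  Subtype.ext (funext fun r => Jet.eq_of_coord_eq c ((pt_toJet r q).symm ▸ hq)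
    ((pt_toJet r q').symm ▸ hq') (h r))

lemma continuousAt_coordInf (c : B.BundleChart) (r : ℕ) {q : B.JetInf} (hq : toBase q ∈ c.dom) :
    ContinuousAt (c.coordInf r) q :=
  (continuousAt_coord c ((pt_toJet r q).symm ▸ hq)).comp (continuous_toJet r).continuousAt

lemma isCoordAt_coordInf (c : B.BundleChart) (r : ℕ) {q : B.JetInf} (hq : toBase q ∈ c.dom) :
    IsCoordAt (smoothInf B) (c.coordInf r) q where
  congr := fun ⟨k, g, hg, h⟩ h' => ⟨k, g, hg, h'.trans h⟩
  comp_mem := fun {g} hg => isSmoothMap_toJet r q (g ∘ c.coord r)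
    ((isCoordAt_coord c ((pt_toJet r q).symm ▸ hq)).comp_mem hg)
  continuousAt := continuousAt_coordInf c r hq

lemma eventually_isCoordAt (c : B.BundleChart) (r : ℕ) {q : B.JetInf} (hq : toBase q ∈ c.dom) :
    ∀ᶠ q' in 𝓝 q, IsCoordAt (smoothInf B) (c.coordInf r) q' := by
  filter_upwards [eventually_toBase_mem c hq] with q' h using isCoordAt_coordInf c r h

/-- `coordTrunc` as a continuous linear map. -/
def coordTruncL (E F : Type*) [NormedAddCommGroup E] [NormedSpace ℝ E]
    [NormedAddCommGroup F] [NormedSpace ℝ F] {r r' : ℕ} (h : r ≤ r') :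
    Coord E F r' →L[ℝ] Coord E F r :=
  (ContinuousLinearMap.fst ℝ E _).prod ((ContinuousLinearMap.pi fun j : Fin (r + 1) =>
    ContinuousLinearMap.proj (R := ℝ)
      (φ := fun i : Fin (r' + 1) => ContinuousMultilinearMap ℝ (fun _ : Fin (i : ℕ) => E) F)
      ⟨j, lt_of_lt_of_le j.2 (Nat.succ_le_succ h)⟩).comp (ContinuousLinearMap.snd ℝ E _))

lemma coordTruncL_apply {r r' : ℕ} (h : r ≤ r') (z : Coord E F r') :
    coordTruncL E F h z = coordTrunc E F h z := rfl

/-- All large orders are allowed, so that finitely many functions can later be expressed at one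
common order, as in `ExtDerivAt.exists_rep`. -/
lemma smoothInf_rep (c : B.BundleChart) {q : B.JetInf} (hq : toBase q ∈ c.dom)
    {f : B.JetInf → ℝ} (hf : f ∈ smoothInf B q) :
    ∀ᶠ r in atTop, ∃ g : Coord E F r → ℝ, SmoothNear g (c.coordInf r q) ∧
      f =ᶠ[𝓝 q] g ∘ c.coordInf r := by
  obtain ⟨k, g, hg, h⟩ := hf
  obtain ⟨G, hG, hgG⟩ := smoothJet_rep c ((pt_toJet k q).symm ▸ hq) hg
  filter_upwards [eventually_ge_atTop k] with r hr
  refine ⟨fun z => G (coordTruncL E F hr z), ?_, ?_⟩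
  · refine SmoothNear.comp (g := G) (f := coordTruncL E F hr) ?_
      ((coordTruncL E F hr).contDiff.smoothNear _)
    rw [coordTruncL_apply, coordInf_trunc]
    exact hG
  · filter_upwards [h, (continuous_toJet k).continuousAt.eventually hgG] with q' h1 h2
    rw [h1, Function.comp_apply, h2, Function.comp_apply, Function.comp_apply, coordTruncL_apply,
      coordInf_trunc]
    rfl

/-! ### Coherent sequences of coordinates and tangent vectors of `J^∞ Y` -/

/-- The coordinates realized by jets of smooth functions. -/
def jetSub (E F : Type*) [NormedAddCommGroup E] [NormedSpace ℝ E]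
    [NormedAddCommGroup F] [NormedSpace ℝ F] (r : ℕ) : Submodule ℝ (Coord E F r) where
  carrier := {v | ∃ f : E → F, SmoothNear f 0 ∧ ∀ j, v.2 j = iteratedFDeriv ℝ j f 0}
  zero_mem' := ⟨fun _ => 0, SmoothNear.const _ _, fun j => by
    rw [iteratedFDeriv_fun_zero]; rfl⟩
  add_mem' := by
    rintro v w ⟨f, hf, hv⟩ ⟨g, hg, hw⟩
    refine ⟨fun x => f x + g x, hf.add hg, fun j => ?_⟩
    have := iteratedFDeriv_add_apply (i := j) (hf.contDiffAt.of_le (by exact_mod_cast le_top))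
      (hg.contDiffAt.of_le (by exact_mod_cast le_top))
    refine Eq.trans ?_ this.symm
    rw [← hv, ← hw]
    rfl
  smul_mem' := by
    rintro a v ⟨f, hf, hv⟩
    refine ⟨fun x => a • f x, (SmoothNear.const a _).smul hf, fun j => ?_⟩
    have := iteratedFDeriv_const_smul_apply (i := j) (a := a)
      (hf.contDiffAt.of_le (by exact_mod_cast le_top))
    refine Eq.trans ?_ this.symm
    rw [← hv]
    rfl

lemma jetC_mem_jetSub (r : ℕ) {f : E → F} {z : E} (hf : SmoothNear f z) :
    jetC r f z ∈ jetSub E F r := by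
  refine ⟨fun x => f (x + z), ?_, fun j => ?_⟩
  · exact SmoothNear.comp (g := f) (f := fun x => x + z) (by simpa using hf)
      (ContDiff.smoothNear (by fun_prop) _)
  · rw [iteratedFDeriv_comp_add_right, zero_add]
    rfl

lemma exists_jetC_eq {r : ℕ} {v : Coord E F r} (hv : v ∈ jetSub E F r) :
    ∃ f : E → F, SmoothNear f v.1 ∧ jetC r f v.1 = v := by
  obtain ⟨f, hf, h⟩ := hv
  refine ⟨fun x => f (x - v.1), ?_, Prod.ext rfl (funext fun j => ?_)⟩
  · exact SmoothNear.comp (g := f) (f := fun x => x - v.1) (by simpa using hf)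
      (ContDiff.smoothNear (by fun_prop) _)
  · change iteratedFDeriv ℝ j (fun x => f (x - v.1)) v.1 = _
    rw [iteratedFDeriv_comp_sub, sub_self, h]

/-- Compatible sequences of coordinates of jets. -/
def cohSub (E F : Type*) [NormedAddCommGroup E] [NormedSpace ℝ E]
    [NormedAddCommGroup F] [NormedSpace ℝ F] : Submodule ℝ (∀ r, Coord E F r) where
  carrier := {v | (∀ r r' (h : r ≤ r'), coordTruncL E F h (v r') = v r) ∧ ∀ r, v r ∈ jetSub E F r}
  zero_mem' := ⟨fun _ _ _ => map_zero _, fun r => (jetSub E F r).zero_mem⟩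
  add_mem' := fun {v w} hv hw => ⟨fun r r' h => by
    rw [Pi.add_apply, map_add, hv.1, hw.1, Pi.add_apply], fun r => add_mem (hv.2 r) (hw.2 r)⟩
  smul_mem' := fun a v hv => ⟨fun r r' h => by
    rw [Pi.smul_apply, map_smul, hv.1, Pi.smul_apply], fun r => Submodule.smul_mem _ a (hv.2 r)⟩

lemma coord_mem_jetSub (c : B.BundleChart) {r : ℕ} {q : B.Jet r} (hq : q.pt ∈ c.dom) :
    c.coord r q ∈ jetSub E F r := by
  obtain ⟨s, hs, e⟩ := exists_eq_jet q
  generalize q.pt = x at hs e hq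
  subst e
  rw [coord_jet c r s hs hq]
  exact jetC_mem_jetSub r (c.smoothNear_rep s hq hs)

lemma coordInf_mem_cohSub (c : B.BundleChart) {q : B.JetInf} (hq : toBase q ∈ c.dom) :
    (fun r => c.coordInf r q) ∈ cohSub E F :=
  ⟨fun _ _ h => coordInf_trunc c h q, fun r => coord_mem_jetSub c ((pt_toJet r q).symm ▸ hq)⟩

lemma cohSub_fst {v : ∀ r, Coord E F r} (hv : v ∈ cohSub E F) (r : ℕ) : (v r).1 = (v 0).1 := by
  rw [← hv.1 0 r (Nat.zero_le r)]
  rfl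

lemma exists_jet_of_coord (c : B.BundleChart) {r : ℕ} {v : Coord E F r} (hv : v ∈ jetSub E F r)
    (hz : v.1 ∈ c.overlap c) : ∃ q : B.Jet r, q.pt = c.base.symm v.1 ∧ c.coord r q = v := by
  obtain ⟨f, hf, h⟩ := exists_jetC_eq hv
  have hx : c.base.symm v.1 ∈ c.dom := hz.2.1
  have hb : c.base (c.base.symm v.1) = v.1 := c.base.right_inv hz.1
  obtain ⟨s, hs, hsf⟩ := c.exists_localSection hx (f := f) (hb.symm ▸ hf)
  refine ⟨jet r s _ hs, rfl, ?_⟩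
  rw [coord_jet c r s hs hx, jetC_congr r hsf, hb, h]

/-- Each finite order is realized by a section of its own, and coherence of the coordinates makes
the resulting jets compatible. No section realizing all orders at once, as in Borel's lemma, is
required. -/
lemma exists_jetInf_of_coord (c : B.BundleChart) {v : ∀ r, Coord E F r} (hv : v ∈ cohSub E F)
    (hz : (v 0).1 ∈ c.overlap c) :
    ∃ q : B.JetInf, toBase q = c.base.symm (v 0).1 ∧ ∀ r, c.coordInf r q = v r := by
  choose q hq hq' using fun r => exists_jet_of_coord c (hv.2 r) ((cohSub_fst hv r).symm ▸ hz)
  have hx : ∀ r, (q r).pt = c.base.symm (v 0).1 := fun r => by rw [hq, cohSub_fst hv]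
  have hd : ∀ r, (q r).pt ∈ c.dom := fun r => (hx r).symm ▸ hz.2.1
  refine ⟨⟨q, fun r r' h => Jet.eq_of_coord_eq c ?_ (hd r) ?_⟩, hx 0, hq'⟩
  · rw [Jet.pt_trunc]
    exact hd r'
  · rw [coord_trunc, hq', hq', ← coordTruncL_apply, hv.1]

/-- The components of a tangent vector of `J^∞ Y` in a bundle chart. -/
def BundleChart.tan (c : B.BundleChart) (r : ℕ) {q : B.JetInf} :
    Tangent (smoothInf B) q →ₗ[ℝ] Coord E F r :=
  coordT (smoothInf B) (c.coordInf r) q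

/-- Every function in `smoothInf B q` depends near q on coordinates of some finite order. Together
with `tan_mem_cohSub` and `exists_tangent` this identifies the tangent space at q with `cohSub E F`.
-/
lemma Tangent.eq_of_tan_eq (c : B.BundleChart) {q : B.JetInf} (hq : toBase q ∈ c.dom)
    {ξ η : Tangent (smoothInf B) q} (h : ∀ r, c.tan r ξ = c.tan r η) : ξ = η := by
  refine Tangent.ext_dAt fun f hf => ?_
  obtain ⟨r, g, hg, hfg⟩ := (smoothInf_rep c hq hf).exists
  rw [(isCoordAt_coordInf c r hq).dAt_eq hg hfg, (isCoordAt_coordInf c r hq).dAt_eq hg hfg]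
  exact congrArg _ (h r)

lemma tan_mem_jetSub (c : B.BundleChart) {q : B.JetInf} (hq : toBase q ∈ c.dom)
    (ξ : Tangent (smoothInf B) q) (r : ℕ) : c.tan r ξ ∈ jetSub E F r :=
  (isCoordAt_coordInf c r hq).coordT_mem
    ((eventually_toBase_mem c hq).mono fun _ hq' => (coordInf_mem_cohSub c hq').2 r) ξ

lemma tan_trunc (c : B.BundleChart) {q : B.JetInf} (hq : toBase q ∈ c.dom)
    (ξ : Tangent (smoothInf B) q) {r r' : ℕ} (h : r ≤ r') :
    coordTruncL E F h (c.tan r' ξ) = c.tan r ξ := by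
  have := (isCoordAt_coordInf c r' hq).coordT_comp (κ' := c.coordInf r) (G := coordTruncL E F h)
    ((coordTruncL E F h).contDiff.smoothNear _)
    (Eventually.of_forall fun q' => (coordInf_trunc c h q').symm) ξ
  rw [(coordTruncL E F h).fderiv] at this
  exact this.symm

lemma tan_mem_cohSub (c : B.BundleChart) {q : B.JetInf} (hq : toBase q ∈ c.dom)
    (ξ : Tangent (smoothInf B) q) : (fun r => c.tan r ξ) ∈ cohSub E F :=
  ⟨fun _ _ h => tan_trunc c hq ξ h, tan_mem_jetSub c hq ξ⟩

lemma differentiableAt_comp_curve (c : B.BundleChart) {q : B.JetInf} (hq : toBase q ∈ c.dom)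
    {γ : ℝ → B.JetInf} {t₀ : ℝ} (hγ : γ t₀ = q) (hc : ∀ᶠ t in 𝓝 t₀, toBase (γ t) ∈ c.dom)
    (hv : ∀ r, DifferentiableAt ℝ (fun t => c.coordInf r (γ t)) t₀) :
    ∀ f ∈ smoothInf B q, DifferentiableAt ℝ (f ∘ γ) t₀ := by
  have hcont : Tendsto γ (𝓝 t₀) (𝓝 q) := by
    refine tendsto_jetInf c hq hc fun r => ?_
    have := (hv r).continuousAt.tendsto
    rwa [hγ] at this
  intro f hf
  obtain ⟨r, g, hg, hfg⟩ := (smoothInf_rep c hq hf).exists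
  have h1 : f ∘ γ =ᶠ[𝓝 t₀] g ∘ fun t => c.coordInf r (γ t) := hcont.eventually hfg
  refine DifferentiableAt.congr_of_eventuallyEq ?_ h1
  refine DifferentiableAt.comp t₀ ?_ (hv r)
  rw [hγ]
  exact hg.differentiableAt

lemma exists_tangent_of_curve (c : B.BundleChart) {q : B.JetInf} (hq : toBase q ∈ c.dom)
    {γ : ℝ → B.JetInf} {t₀ : ℝ} (hγ : γ t₀ = q) (hc : ∀ᶠ t in 𝓝 t₀, toBase (γ t) ∈ c.dom)
    {v : ∀ r, Coord E F r} (hv : ∀ r, HasDerivAt (fun t => c.coordInf r (γ t)) (v r) t₀) :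
    ∃ ξ : Tangent (smoothInf B) q, ∀ r, c.tan r ξ = v r := by
  have hd := differentiableAt_comp_curve c hq hγ hc fun r => (hv r).differentiableAt
  exact ⟨curveTangent γ t₀ hγ hd, fun r =>
    (isCoordAt_coordInf c r hq).coordT_curveTangent hγ hd (hv r)⟩

/-- Coherent sequences form a linear space, so the straight line through q in coordinates consists
of points of J^∞Y as long as its base point stays in the chart. For other t the curve takes the
default value q. -/
lemma exists_curve (c : B.BundleChart) {q : B.JetInf} (hq : toBase q ∈ c.dom)
    {v : ∀ r, Coord E F r} (hv : v ∈ cohSub E F) :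
    ∃ γ : ℝ → B.JetInf, γ 0 = q ∧ ∀ᶠ t in 𝓝 0, toBase (γ t) ∈ c.dom ∧
      ∀ r, c.coordInf r (γ t) = c.coordInf r q + t • v r := by
  have h0 : ∀ t : ℝ, (fun r => c.coordInf r q) + t • v ∈ cohSub E F := fun t =>
    add_mem (coordInf_mem_cohSub c hq) (Submodule.smul_mem _ t hv)
  have hz : ∀ᶠ t : ℝ in 𝓝 0, (c.coordInf 0 q + t • v 0).1 ∈ c.overlap c := by
    have h1 : ContinuousAt (fun t : ℝ => (c.coordInf 0 q + t • v 0).1) 0 := by fun_prop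
    refine h1.eventually ((c.isOpen_overlap c).mem_nhds ?_)
    simp only [zero_smul, add_zero, coordInf_fst c 0 hq]
    exact (BundleChart.mem_overlap hq).mpr hq
  have h1 : ∀ t : ℝ, ∃ q' : B.JetInf, (c.coordInf 0 q + t • v 0).1 ∈ c.overlap c →
      toBase q' ∈ c.dom ∧ ∀ r, c.coordInf r q' = c.coordInf r q + t • v r := by
    intro t
    by_cases ht : (c.coordInf 0 q + t • v 0).1 ∈ c.overlap c
    · obtain ⟨q', hq', h⟩ := exists_jetInf_of_coord c (h0 t) ht
      exact ⟨q', fun _ => ⟨hq'.symm ▸ ht.2.1, h⟩⟩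
    · exact ⟨q, fun h => absurd h ht⟩
  choose γ hγ using h1
  refine ⟨γ, ?_, hz.mono hγ⟩
  have h2 := hγ 0 hz.self_of_nhds
  refine JetInf.eq_of_coordInf_eq c h2.1 hq fun r => ?_
  rw [h2.2, zero_smul, add_zero]

lemma exists_tangent (c : B.BundleChart) {q : B.JetInf} (hq : toBase q ∈ c.dom)
    {v : ∀ r, Coord E F r} (hv : v ∈ cohSub E F) :
    ∃ ξ : Tangent (smoothInf B) q, ∀ r, c.tan r ξ = v r := by
  obtain ⟨γ, hγ, h⟩ := exists_curve c hq hv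
  refine exists_tangent_of_curve c hq hγ (h.mono fun t ht => ht.1) fun r => ?_
  have h3 : HasDerivAt (fun t : ℝ => c.coordInf r q + t • v r) (v r) 0 := by
    simpa using ((hasDerivAt_id (0 : ℝ)).smul_const (v r)).const_add (c.coordInf r q)
  exact h3.congr_of_eventuallyEq (h.mono fun t ht => ht.2 r)

end AffineBundle

namespace AffineBundle

variable {E E' F X Y : Type*}
  [NormedAddCommGroup E] [NormedSpace ℝ E] [FiniteDimensional ℝ E]
  [NormedAddCommGroup E'] [NormedSpace ℝ E']
  [NormedAddCommGroup F] [NormedSpace ℝ F] [FiniteDimensional ℝ F]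
  [TopologicalSpace X] [ChartedSpace E X] [IsManifold 𝓘(ℝ, E) ∞ X]
  [TopologicalSpace Y] [ChartedSpace E' Y] [IsManifold 𝓘(ℝ, E') ∞ Y]
  {B : AffineBundle E E' F X Y}

/-! ### Locally pull-back forms in coordinates -/

/-- Near `q`, the form `φ` is the pull-back of an exterior form on an open subset of `J^r Y`. -/
def PullbackNear (r : ℕ) (q : B.JetInf) {n : ℕ} (φ : B.InfForm n) : Prop :=
  ∃ (W : Set (B.Jet r)) (α : Form (smoothJet B r) n),
    IsOpen W ∧ toJet r q ∈ W ∧ IsSmoothFormOn (smoothJet B r) W α ∧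
      ∀ q' : B.JetInf, toJet r q' ∈ W → φ q' = pullback (isSmoothMap_toJet r) α q'

/-- The neighbourhoods of `q` that are preimages of neighbourhoods in `J^r Y`. -/
def jetNhds (r : ℕ) (q : B.JetInf) : Filter B.JetInf := comap (toJet r) (𝓝 (toJet r q))

lemma nhds_le_jetNhds (r : ℕ) (q : B.JetInf) : 𝓝 q ≤ jetNhds r q :=
  (continuous_toJet r).continuousAt.le_comap

lemma eventually_jetNhds_toBase_mem (c : B.BundleChart) (r : ℕ) {q : B.JetInf}
    (hq : toBase q ∈ c.dom) : ∀ᶠ q' in jetNhds r q, toBase q' ∈ c.dom := by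
  filter_upwards [(eventually_pt_mem c ((pt_toJet r q).symm ▸ hq)).comap (toJet r)] with q' h
  exact pt_toJet r q' ▸ h

lemma tendsto_coordInf_jetNhds (c : B.BundleChart) (r : ℕ) {q : B.JetInf}
    (hq : toBase q ∈ c.dom) : Tendsto (c.coordInf r) (jetNhds r q) (𝓝 (c.coordInf r q)) :=
  (continuousAt_coord c ((pt_toJet r q).symm ▸ hq)).tendsto.comp tendsto_comap

lemma tendsto_jetNhds (c : B.BundleChart) {r : ℕ} {q : B.JetInf} (hq : toBase q ∈ c.dom)
    {Z : Type*} {l : Filter Z} {f : Z → B.JetInf} (h1 : ∀ᶠ z in l, toBase (f z) ∈ c.dom)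
    (h2 : Tendsto (fun z => c.coordInf r (f z)) l (𝓝 (c.coordInf r q))) :
    Tendsto f l (jetNhds r q) := by
  refine tendsto_comap_iff.mpr (tendsto_jet c ((pt_toJet r q).symm ▸ hq) ?_ h2)
  filter_upwards [h1] with z hz
  exact (pt_toJet r (f z)).symm ▸ hz

lemma jetNhds_mono {r r' : ℕ} (h : r ≤ r') (q : B.JetInf) : jetNhds r' q ≤ jetNhds r q := by
  obtain ⟨c, hc⟩ := exists_bundleChart B (toBase q)
  refine tendsto_id'.mp (tendsto_jetNhds c hc (eventually_jetNhds_toBase_mem c r' hc) ?_)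
  have h1 := (coordTruncL E F h).continuous.continuousAt.tendsto.comp
    (tendsto_coordInf_jetNhds c r' hc)
  simp only [coordTruncL_apply, coordInf_trunc, Function.comp_def] at h1
  exact h1

/-- The form `φ` is given by `A` in the chart `c`, for the points in the sets of the filter `l`. -/
def RepAlong (l : Filter B.JetInf) (c : B.BundleChart) (r : ℕ) {n : ℕ} (φ : B.InfForm n)
    (A : Coord E F r → Coord E F r [⋀^Fin n]→L[ℝ] ℝ) : Prop :=
  ∀ᶠ q in l, ∀ ξ : Fin n → Tangent (smoothInf B) q,
    φ q ξ = A (c.coordInf r q) fun a => c.tan r (ξ a)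

lemma RepAlong.pullForm {l l' : Filter B.JetInf} (hl : l ≤ l') {c : B.BundleChart}
    (hc : ∀ᶠ q in l, toBase q ∈ c.dom) {r r' : ℕ} (h : r ≤ r') {n : ℕ} {φ : B.InfForm n}
    {A : Coord E F r → Coord E F r [⋀^Fin n]→L[ℝ] ℝ} (hA : RepAlong l' c r φ A) :
    RepAlong l c r' φ (pullForm (coordTruncL E F h) A) := by
  filter_upwards [hl hA, hc] with q h1 h2 ξ
  have h3 : coordTruncL E F h (c.coordInf r' q) = c.coordInf r q := coordInf_trunc c h q
  rw [h1, _root_.pullForm, ContinuousAlternatingMap.compContinuousLinearMap_apply,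
    (coordTruncL E F h).fderiv, h3]
  congr 1
  funext a
  exact (tan_trunc c h2 (ξ a) h).symm

/-- The formula holds along `jetNhds r q`, not merely along `𝓝 q`. A neighbourhood in J^∞Y may
restrict coordinates of order above r, and `pullbackNear_of_rep` could not recover a form on an open
subset of J^rY from it. -/
lemma PullbackNear.exists_rep {r : ℕ} {q : B.JetInf} {n : ℕ} {φ : B.InfForm n}
    (hφ : PullbackNear r q φ) (c : B.BundleChart) (hc : toBase q ∈ c.dom) :
    ∃ A : Coord E F r → Coord E F r [⋀^Fin n]→L[ℝ] ℝ, SmoothNear A (c.coordInf r q) ∧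
      RepAlong (jetNhds r q) c r φ A := by
  obtain ⟨W, α, hW, hqW, hα, h⟩ := hφ
  obtain ⟨J, f, g, hfg⟩ := isSmoothFormOn_iff.mp hα _ hqW
  have hpt : (toJet r q).pt ∈ c.dom := (pt_toJet r q).symm ▸ hc
  have hfg0 := hfg.self_of_nhds
  choose F' hF' hf using fun j => smoothJet_rep c hpt (hfg0.1 j).1
  choose G hG hg using fun j b => smoothJet_rep c hpt ((hfg0.1 j).2 b)
  have hcoord : ∀ᶠ p in 𝓝 (toJet r q), IsCoordAt (smoothJet B r) (c.coord r) p := by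
    filter_upwards [eventually_pt_mem c hpt] with p hp using isCoordAt_coord c hp
  have hrep := hasRep_of_isExprAt hcoord hF' hG hf hg hfg
  refine ⟨sumForm F' G, smoothNear_sumForm hF' hG, ?_⟩
  have h1 : ∀ᶠ p in 𝓝 (toJet r q), p ∈ W ∧ IsCoordAt (smoothJet B r) (c.coord r) p ∧
      ∀ ξ : Fin n → Tangent (smoothJet B r) p,
        α p ξ = sumForm F' G (c.coord r p) fun a => coordT (smoothJet B r) (c.coord r) p (ξ a) :=
    (hW.eventually_mem hqW).and (hcoord.and hrep)
  filter_upwards [h1.comap (toJet r)] with q' h2 ξ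
  rw [h q' h2.1]
  refine (h2.2.2 fun a => pushforward (isSmoothMap_toJet r) q' (ξ a)).trans ?_
  congr 1
  funext a
  exact coordT_pushforward (isSmoothMap_toJet r) h2.2.1 (ξ a)

lemma pullbackNear_of_rep {r : ℕ} {q : B.JetInf} {n : ℕ} {φ : B.InfForm n} (c : B.BundleChart)
    (hc : toBase q ∈ c.dom) {A : Coord E F r → Coord E F r [⋀^Fin n]→L[ℝ] ℝ}
    (hA : SmoothNear A (c.coordInf r q)) (h : RepAlong (jetNhds r q) c r φ A) :
    PullbackNear r q φ := by
  have hpt : (toJet r q).pt ∈ c.dom := (pt_toJet r q).symm ▸ hc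
  obtain ⟨U, hU, hUφ⟩ := mem_comap.mp h
  have h1 : ∀ᶠ p in 𝓝 (toJet r q), p ∈ U ∧ p.pt ∈ c.dom ∧ SmoothNear A (c.coord r p) := by
    filter_upwards [hU, eventually_pt_mem c hpt,
      (continuousAt_coord c hpt).eventually hA.eventually] with p h2 h3 h4 using ⟨h2, h3, h4⟩
  obtain ⟨W, hW, hWo, hqW⟩ := eventually_nhds_iff.mp h1
  let α : Form (smoothJet B r) n := fun p =>
    (A (c.coord r p)).toAlternatingMap.compLinearMap (coordT (smoothJet B r) (c.coord r) p)
  refine ⟨W, α, hWo, hqW, isSmoothFormOn_iff.mpr fun p hp => ?_, fun q' hq' => ?_⟩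
  · have hcoord : ∀ᶠ p' in 𝓝 p, IsCoordAt (smoothJet B r) (c.coord r) p' := by
      filter_upwards [eventually_pt_mem c (hW p hp).2.1] with p hp using isCoordAt_coord c hp
    have hrep : HasRep (smoothJet B r) (c.coord r) p α A := Eventually.of_forall fun _ _ => rfl
    obtain ⟨J, f, g, hfg, -⟩ := hrep.exists_isExprAt hcoord (hW p hp).2.2
    exact ⟨J, f, g, hfg⟩
  · ext ξ
    rw [hUφ (hW _ hq').1 ξ]
    change _ = A (c.coord r (toJet r q')) fun a => coordT (smoothJet B r) (c.coord r) _
      (pushforward (isSmoothMap_toJet r) q' (ξ a))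
    rw [BundleChart.coordInf]
    congr 1
    funext a
    exact (coordT_pushforward (isSmoothMap_toJet r) (isCoordAt_coord c (hW _ hq').2.1) (ξ a)).symm

lemma PullbackNear.mono {r r' : ℕ} (h : r ≤ r') {q : B.JetInf} {n : ℕ} {φ : B.InfForm n}
    (hφ : PullbackNear r q φ) : PullbackNear r' q φ := by
  obtain ⟨c, hc⟩ := exists_bundleChart B (toBase q)
  obtain ⟨A, hA, hAφ⟩ := hφ.exists_rep c hc
  refine pullbackNear_of_rep c hc (A := pullForm (coordTruncL E F h) A) ?_
    (hAφ.pullForm (jetNhds_mono h q) (eventually_jetNhds_toBase_mem c r' hc) h)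
  refine smoothNear_pullForm ((coordTruncL E F h).contDiff.smoothNear _) ?_
  rw [coordTruncL_apply, coordInf_trunc]
  exact hA

lemma PullbackNear.add {r : ℕ} {q : B.JetInf} {n : ℕ} {φ φ' : B.InfForm n}
    (h : PullbackNear r q φ) (h' : PullbackNear r q φ') : PullbackNear r q (φ + φ') := by
  obtain ⟨c, hc⟩ := exists_bundleChart B (toBase q)
  obtain ⟨A, hA, hAφ⟩ := h.exists_rep c hc
  obtain ⟨A', hA', hAφ'⟩ := h'.exists_rep c hc
  refine pullbackNear_of_rep c hc (hA.add hA') ?_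
  filter_upwards [hAφ, hAφ'] with q h1 h2 ξ
  rw [Pi.add_apply, AlternatingMap.add_apply, h1, h2]
  rfl

lemma PullbackNear.neg {r : ℕ} {q : B.JetInf} {n : ℕ} {φ : B.InfForm n}
    (h : PullbackNear r q φ) : PullbackNear r q (-φ) := by
  obtain ⟨c, hc⟩ := exists_bundleChart B (toBase q)
  obtain ⟨A, hA, hAφ⟩ := h.exists_rep c hc
  refine pullbackNear_of_rep c hc ((SmoothNear.const (-1 : ℝ) _).smul hA) ?_
  filter_upwards [hAφ] with q h1 ξ
  rw [Pi.neg_apply, AlternatingMap.neg_apply, h1]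
  simp

lemma pullbackNear_zero (r : ℕ) (q : B.JetInf) {n : ℕ} : PullbackNear r q (0 : B.InfForm n) := by
  obtain ⟨c, hc⟩ := exists_bundleChart B (toBase q)
  exact pullbackNear_of_rep c hc (SmoothNear.const 0 _) (Eventually.of_forall fun _ _ => rfl)

lemma isLocallyPullbackForm_iff {n : ℕ} {φ : B.InfForm n} :
    IsLocallyPullbackForm φ ↔ ∀ q, ∃ r, PullbackNear r q φ := Iff.rfl

lemma IsLocallyPullbackForm.add {n : ℕ} {φ φ' : B.InfForm n} (h : IsLocallyPullbackForm φ)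
    (h' : IsLocallyPullbackForm φ') : IsLocallyPullbackForm (φ + φ') := by
  intro q
  obtain ⟨r, hr⟩ := h q
  obtain ⟨r', hr'⟩ := h' q
  exact ⟨max r r', PullbackNear.add (PullbackNear.mono (le_max_left r r') hr)
    (PullbackNear.mono (le_max_right r r') hr')⟩

lemma IsLocallyPullbackForm.neg {n : ℕ} {φ : B.InfForm n} (h : IsLocallyPullbackForm φ) :
    IsLocallyPullbackForm (-φ) := fun q => (h q).imp fun _ => PullbackNear.neg

lemma IsPullbackForm.pullbackNear {n : ℕ} {φ : B.InfForm n} (h : IsPullbackForm φ) :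
    ∃ r, ∀ q, PullbackNear r q φ := by
  obtain ⟨r, α, hα, rfl⟩ := h
  exact ⟨r, fun q => ⟨univ, α, isOpen_univ, mem_univ _, hα, fun _ _ => rfl⟩⟩

lemma IsPullbackForm.isLocallyPullbackForm {n : ℕ} {φ : B.InfForm n} (h : IsPullbackForm φ) :
    IsLocallyPullbackForm φ := by
  obtain ⟨r, hr⟩ := h.pullbackNear
  exact fun q => ⟨r, hr q⟩

/-! ### Lifting jets and their tangent vectors to `J^∞ Y` -/

/-- A function realizing the finite jet also supplies the derivatives of all higher orders. -/
lemma exists_cohSub_of_jetSub {r : ℕ} {v : Coord E F r} (hv : v ∈ jetSub E F r) :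
    ∃ w ∈ cohSub E F, w r = v := by
  obtain ⟨f, hf, h⟩ := exists_jetC_eq hv
  exact ⟨fun k => jetC k f v.1, ⟨fun _ _ _ => rfl, fun k => jetC_mem_jetSub k hf⟩, h⟩

lemma toJet_surjective (r : ℕ) : Function.Surjective (toJet (B := B) r) := by
  intro p
  obtain ⟨c, hc⟩ := exists_bundleChart B p.pt
  obtain ⟨w, hw, hwr⟩ := exists_cohSub_of_jetSub (coord_mem_jetSub c hc)
  have hz : (w 0).1 = c.base p.pt := by
    rw [← cohSub_fst hw r, hwr, coord_fst c p hc]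
  obtain ⟨q, hq, hqw⟩ := exists_jetInf_of_coord c hw (hz ▸ (BundleChart.mem_overlap hc).mpr hc)
  refine ⟨q, Jet.eq_of_coord_eq c ?_ hc ((hqw r).trans hwr)⟩
  rw [pt_toJet, hq, hz, c.base.left_inv hc.1]
  exact hc

lemma pushforward_toJet_surjective (r : ℕ) (q : B.JetInf) :
    Function.Surjective (pushforward (isSmoothMap_toJet r) q) := by
  intro η
  obtain ⟨c, hc⟩ := exists_bundleChart B (toBase q)
  have hpt : (toJet r q).pt ∈ c.dom := (pt_toJet r q).symm ▸ hc
  have hκ := isCoordAt_coord c hpt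
  have hv : coordT (smoothJet B r) (c.coord r) _ η ∈ jetSub E F r :=
    hκ.coordT_mem (eventually_pt_mem c hpt |>.mono fun p hp => coord_mem_jetSub c hp) η
  obtain ⟨w, hw, hwr⟩ := exists_cohSub_of_jetSub hv
  obtain ⟨ξ, hξ⟩ := exists_tangent c hc hw
  refine ⟨ξ, Tangent.ext_dAt fun f hf => ?_⟩
  obtain ⟨g, hg, hfg⟩ := smoothJet_rep c hpt hf
  rw [hκ.dAt_eq hg hfg, hκ.dAt_eq hg hfg, coordT_pushforward (isSmoothMap_toJet r) hκ]
  congr 1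
  exact (hξ r).trans hwr

/-- Points and tangent vectors of J^rY lift to J^∞Y. So a form on J^rY is determined by its
pull-back, and the local forms of the common order r agree on overlaps and glue. -/
lemma isPullbackForm_of_pullbackNear {r : ℕ} {n : ℕ} {φ : B.InfForm n}
    (h : ∀ q, PullbackNear r q φ) : IsPullbackForm φ := by
  have h1 : ∀ p : B.Jet r, ∃ β : Tangent (smoothJet B r) p [⋀^Fin n]→ₗ[ℝ] ℝ,
      ∀ (W : Set (B.Jet r)) (α : Form (smoothJet B r) n), p ∈ W →
        (∀ q' : B.JetInf, toJet r q' ∈ W → φ q' = pullback (isSmoothMap_toJet r) α q') →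
          α p = β := by
    intro p
    obtain ⟨q, rfl⟩ := toJet_surjective r p
    obtain ⟨W₀, α₀, -, hq₀, -, hφ₀⟩ := h q
    refine ⟨α₀ (toJet r q), fun W α hp hφ => ?_⟩
    ext η
    choose ξ hξ using fun a => pushforward_toJet_surjective r q (η a)
    have h2 := congrArg (fun β => β ξ) ((hφ q hp).symm.trans (hφ₀ q hq₀))
    have h3 : α (toJet r q) (fun a => pushforward (isSmoothMap_toJet r) q (ξ a)) =
      α₀ (toJet r q) (fun a => pushforward (isSmoothMap_toJet r) q (ξ a)) := h2
    simpa only [hξ] using h3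
  choose β hβ using h1
  refine ⟨r, β, isSmoothFormOn_iff.mpr fun p _ => ?_, ?_⟩
  · obtain ⟨q, rfl⟩ := toJet_surjective r p
    obtain ⟨W, α, hW, hq, hα, hφ⟩ := h q
    obtain ⟨J, f, g, hfg⟩ := isSmoothFormOn_iff.mp hα _ hq
    refine ⟨J, f, g, ?_⟩
    filter_upwards [hfg, hW.mem_nhds hq] with p' h1 h2
    refine ⟨h1.1, fun ξ => ?_⟩
    rw [← hβ p' W α h2 hφ]
    exact h1.2 ξ
  · funext q
    obtain ⟨W, α, hW, hq, hα, hφ⟩ := h q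
    rw [hφ q hq, pullback, pullback, hβ _ W α hq hφ]

end AffineBundle

namespace AffineBundle

variable {E E' F X Y : Type*}
  [NormedAddCommGroup E] [NormedSpace ℝ E] [FiniteDimensional ℝ E]
  [NormedAddCommGroup E'] [NormedSpace ℝ E']
  [NormedAddCommGroup F] [NormedSpace ℝ F] [FiniteDimensional ℝ F]
  [TopologicalSpace X] [ChartedSpace E X] [IsManifold 𝓘(ℝ, E) ∞ X]
  [TopologicalSpace Y] [ChartedSpace E' Y] [IsManifold 𝓘(ℝ, E') ∞ Y]
  {B : AffineBundle E E' F X Y}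

/-! ### The fibrewise homotopy along a section -/

/-- The place where affineness creates the homotopy. Affine maps commute with `AffineMap.lineMap`,
so the section s + t(σ − s), built in one trivialization, has the same expression in all charts. -/
lemma BundleChart.exists_lineSection (s σ : B.LocalSection) {x : X} (hs : x ∈ s.dom)
    (hσ : x ∈ σ.dom) (t : ℝ) : ∃ L : B.LocalSection, x ∈ L.dom ∧ ∀ c : B.BundleChart, x ∈ c.dom →
      c.rep L =ᶠ[𝓝 (c.base x)] fun z => c.rep s z + t • (c.rep σ z - c.rep s z) := by
  obtain ⟨e, he, hx⟩ := B.exists_mem x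
  have hU : IsOpen ((s.dom ∩ σ.dom) ∩ e.baseSet) :=
    (s.isOpen_dom.inter σ.isOpen_dom).inter e.open_baseSet
  have h1 := (s.smooth_snd he).mono (t := (s.dom ∩ σ.dom) ∩ e.baseSet)
    fun y hy => ⟨hy.1.1, hy.2⟩
  have h2 := (σ.smooth_snd he).mono (t := (s.dom ∩ σ.dom) ∩ e.baseSet)
    fun y hy => ⟨hy.1.2, hy.2⟩
  have ht : ContMDiffOn 𝓘(ℝ, E) 𝓘(ℝ, ℝ) ∞ (fun _ : X => t) ((s.dom ∩ σ.dom) ∩ e.baseSet) :=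
    contMDiffOn_const
  obtain ⟨L, hL, hL'⟩ := exists_localSection_of_contMDiffOn he hU inter_subset_right
    (h1.add (ht.smul (h2.sub h1)))
  refine ⟨L, hL ▸ ⟨⟨hs, hσ⟩, hx⟩, fun c hc => ?_⟩
  have h3 : c.base.target ∩ c.base.symm ⁻¹' (((s.dom ∩ σ.dom) ∩ e.baseSet) ∩ c.dom) ∈
      𝓝 (c.base x) := by
    refine (c.base.isOpen_inter_preimage_symm (hU.inter c.isOpen_dom)).mem_nhds
      ⟨c.base.map_source hc.1, ?_⟩
    rw [mem_preimage, c.base.left_inv hc.1]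
    exact ⟨⟨⟨hs, hσ⟩, hx⟩, hc⟩
  filter_upwards [h3] with z hz
  obtain ⟨-, ⟨⟨hzs, hzσ⟩, hze⟩, hzc⟩ := hz
  simp only [BundleChart.rep]
  generalize c.base.symm z = y at hzs hzσ hze hzc
  obtain ⟨a, ha⟩ := B.affine e he c.triv c.triv_mem y ⟨hze, hzc.2⟩
  have h4 : ∀ τ : B.LocalSection, y ∈ τ.dom → (c.triv (τ.toFun y)).2 = a (e (τ.toFun y)).2 := by
    intro τ hτ
    have h5 := τ.mem_source hτ hze
    have h6 : (y, (e (τ.toFun y)).2) = e (τ.toFun y) :=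
      Prod.ext ((e.coe_fst h5).trans (τ.proj_eq _ hτ)).symm rfl
    have h7 : e.toOpenPartialHomeomorph.symm (e (τ.toFun y)) = τ.toFun y :=
      e.toOpenPartialHomeomorph.left_inv h5
    rw [← ha, h6, h7]
  rw [hL' y ⟨⟨hzs, hzσ⟩, hze⟩, h4 s hzs, h4 σ hzσ, ha]
  have h8 := a.apply_lineMap (e (s.toFun y)).2 (e (σ.toFun y)).2 t
  simp only [AffineMap.lineMap_apply, vsub_eq_sub, vadd_eq_add] at h8
  simp only [Pi.smul_apply', Pi.add_apply]
  rw [add_comm, h8, add_comm]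

lemma jetC_line (r : ℕ) {f g : E → F} {z : E} (hf : SmoothNear f z) (hg : SmoothNear g z) (t : ℝ) :
    jetC r (fun z => f z + t • (g z - f z)) z = jetC r f z + t • (jetC r g z - jetC r f z) := by
  refine Prod.ext (by simp [jetC]) (funext fun j => ?_)
  have hf' : ContDiffAt ℝ j f z := hf.contDiffAt.of_le (by exact_mod_cast le_top)
  have hg' : ContDiffAt ℝ j g z := hg.contDiffAt.of_le (by exact_mod_cast le_top)
  have h1 : iteratedFDeriv ℝ j (fun z => f z + t • (g z - f z)) z =
      iteratedFDeriv ℝ j f z + iteratedFDeriv ℝ j (fun z => t • (g z - f z)) z :=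
    iteratedFDeriv_add_apply hf' ((hg'.sub hf').const_smul t)
  have h2 : iteratedFDeriv ℝ j (fun z => t • (g z - f z)) z =
      t • iteratedFDeriv ℝ j (fun z => g z - f z) z :=
    iteratedFDeriv_const_smul_apply (hg'.sub hf')
  have h3 : iteratedFDeriv ℝ j (fun z => g z - f z) z =
      iteratedFDeriv ℝ j g z - iteratedFDeriv ℝ j f z :=
    iteratedFDeriv_sub_apply hg' hf'
  change iteratedFDeriv ℝ j (fun z => f z + t • (g z - f z)) z = _
  rw [h1, h2, h3]
  rfl

/-- The infinite jet of a global section. -/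
def secInf (s : B.LocalSection) (hs : s.dom = univ) (x : X) : B.JetInf :=
  ⟨fun r => jet r s x (hs ▸ mem_univ x), fun _ _ _ => rfl⟩

lemma coordInf_secInf (s : B.LocalSection) (hs : s.dom = univ) (c : B.BundleChart) (r : ℕ) {x : X}
    (hx : x ∈ c.dom) : c.coordInf r (secInf s hs x) = jetC r (c.rep s) (c.base x) :=
  coord_jet c r s _ hx

/-- The homotopy `(t, x, y) ↦ (x, t y)` in coordinates, the fibre coordinates being relative
to `s`. -/
def BundleChart.scale (c : B.BundleChart) (s : B.LocalSection) (r : ℕ) (p : ℝ × Coord E F r) :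
    Coord E F r :=
  jetC r (c.rep s) p.2.1 + p.1 • (p.2 - jetC r (c.rep s) p.2.1)

lemma BundleChart.smoothNear_scale (c : B.BundleChart) {s : B.LocalSection} (hs : s.dom = univ)
    {r : ℕ} (t : ℝ) {q : B.JetInf} (hq : toBase q ∈ c.dom) :
    SmoothNear (c.scale s r) (t, c.coordInf r q) := by
  have h1 : SmoothNear (fun p : ℝ × Coord E F r => jetC r (c.rep s) p.2.1) (t, c.coordInf r q) := by
    refine SmoothNear.comp (g := jetC r (c.rep s)) (f := fun p : ℝ × Coord E F r => p.2.1)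
      (smoothNear_jetC r ?_) (ContDiff.smoothNear (by fun_prop) _)
    change SmoothNear (c.rep s) (c.coordInf r q).1
    rw [coordInf_fst c r hq]
    exact c.smoothNear_rep s hq (hs ▸ mem_univ _)
  filter_upwards [h1] with p hp
  exact hp.add (contDiffAt_fst.smul (contDiffAt_snd.sub hp))

/-- At each order r take a section σ through the r-jet of q, and the r-jet of s + t(σ − s). The
coordinate formula holds in every chart at once and commutes with truncation, so these jets form a
point of J^∞Y. -/
lemma exists_htpy (s : B.LocalSection) (hs : s.dom = univ) (t : ℝ) (q : B.JetInf) :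
    ∃ q' : B.JetInf, toBase q' = toBase q ∧ ∀ c : B.BundleChart, toBase q ∈ c.dom → ∀ r,
      c.coordInf r q' = c.scale s r (t, c.coordInf r q) := by
  have hsx : toBase q ∈ s.dom := hs ▸ mem_univ _
  have h1 : ∀ r, ∃ p : B.Jet r, p.pt = toBase q ∧ ∀ c : B.BundleChart, toBase q ∈ c.dom →
      c.coord r p = c.scale s r (t, c.coordInf r q) := by
    intro r
    obtain ⟨σ, hσ, e⟩ := exists_eq_jet (toJet r q)
    rw [pt_toJet] at hσ
    obtain ⟨L, hL, hLc⟩ := BundleChart.exists_lineSection s σ hsx hσ t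
    refine ⟨jet r L _ hL, rfl, fun c hc => ?_⟩
    have h2 : c.coordInf r q = jetC r (c.rep σ) (c.base (toBase q)) := by
      rw [BundleChart.coordInf, e, coord_jet c r σ _ ((pt_toJet r q).symm ▸ hc), pt_toJet]
    rw [coord_jet c r L hL hc, jetC_congr r (hLc c hc),
      jetC_line r (c.smoothNear_rep s hc hsx) (c.smoothNear_rep σ hc hσ), h2]
    rfl
  choose p hp hpc using h1
  obtain ⟨c, hc⟩ := exists_bundleChart B (toBase q)
  refine ⟨⟨p, fun r r' h => Jet.eq_of_coord_eq c ?_ ((hp r).symm ▸ hc) ?_⟩, hp 0, fun c hc r =>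
    hpc r c hc⟩
  · rw [Jet.pt_trunc, hp]
    exact hc
  · rw [coord_trunc, hpc r' c hc, hpc r c hc, ← coordInf_trunc c h q]
    rfl

/-- The homotopy `(t, x, y) ↦ (x, t y)` of `J^∞ Y`, the fibre coordinates being relative to `s`. -/
def htpy (s : B.LocalSection) (hs : s.dom = univ) (t : ℝ) (q : B.JetInf) : B.JetInf :=
  (exists_htpy s hs t q).choose

section Homotopy

variable {s : B.LocalSection} {hs : s.dom = univ}

lemma toBase_htpy (t : ℝ) (q : B.JetInf) : toBase (htpy s hs t q) = toBase q :=
  (exists_htpy s hs t q).choose_spec.1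

lemma coordInf_htpy (c : B.BundleChart) (r : ℕ) (t : ℝ) {q : B.JetInf} (hq : toBase q ∈ c.dom) :
    c.coordInf r (htpy s hs t q) = c.scale s r (t, c.coordInf r q) :=
  (exists_htpy s hs t q).choose_spec.2 c hq r

lemma htpy_one (q : B.JetInf) : htpy s hs 1 q = q := by
  obtain ⟨c, hc⟩ := exists_bundleChart B (toBase q)
  refine JetInf.eq_of_coordInf_eq c ((toBase_htpy 1 q).symm ▸ hc) hc fun r => ?_
  rw [coordInf_htpy c r 1 hc, BundleChart.scale]
  simp

lemma htpy_zero (q : B.JetInf) : htpy s hs 0 q = secInf s hs (toBase q) := by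
  obtain ⟨c, hc⟩ := exists_bundleChart B (toBase q)
  refine JetInf.eq_of_coordInf_eq c ((toBase_htpy 0 q).symm ▸ hc) hc fun r => ?_
  rw [coordInf_htpy c r 0 hc, coordInf_secInf s hs c r hc, BundleChart.scale]
  simp [coordInf_fst c r hc]

lemma tendsto_coordInf_htpy (c : B.BundleChart) (r : ℕ) (t₀ : ℝ) {q₀ : B.JetInf}
    (hq₀ : toBase q₀ ∈ c.dom) {l : Filter B.JetInf} (hl : ∀ᶠ q in l, toBase q ∈ c.dom)
    (h : Tendsto (c.coordInf r) l (𝓝 (c.coordInf r q₀))) :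
    Tendsto (fun p : ℝ × B.JetInf => c.coordInf r (htpy s hs p.1 p.2)) (𝓝 t₀ ×ˢ l)
      (𝓝 (c.coordInf r (htpy s hs t₀ q₀))) := by
  rw [coordInf_htpy c r t₀ hq₀]
  have h1 := (c.smoothNear_scale hs (r := r) t₀ hq₀).continuousAt.tendsto
  rw [nhds_prod_eq] at h1
  refine (h1.comp (tendsto_id.prodMap h)).congr' ?_
  filter_upwards [tendsto_snd.eventually hl] with p hp
  exact (coordInf_htpy c r p.1 hp).symm

lemma tendsto_htpy (t₀ : ℝ) (q₀ : B.JetInf) : Tendsto (fun p : ℝ × B.JetInf => htpy s hs p.1 p.2)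
    (𝓝 t₀ ×ˢ 𝓝 q₀) (𝓝 (htpy s hs t₀ q₀)) := by
  obtain ⟨c, hc⟩ := exists_bundleChart B (toBase q₀)
  have h1 := eventually_toBase_mem c hc
  refine tendsto_jetInf c ((toBase_htpy t₀ q₀).symm ▸ hc) ?_ fun r =>
    tendsto_coordInf_htpy c r t₀ hc h1 (continuousAt_coordInf c r hc)
  filter_upwards [tendsto_snd.eventually h1] with p hp
  exact (toBase_htpy p.1 p.2).symm ▸ hp

/-- The homotopy acts on the coordinates of order at most r by themselves, so it is also continuous
for the coarser neighbourhoods coming from J^rY. For this reason the order of a pull-back form does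
not grow. -/
lemma tendsto_htpy_jetNhds (r : ℕ) (t₀ : ℝ) (q₀ : B.JetInf) :
    Tendsto (fun p : ℝ × B.JetInf => htpy s hs p.1 p.2)
      (𝓝 t₀ ×ˢ jetNhds r q₀) (jetNhds r (htpy s hs t₀ q₀)) := by
  obtain ⟨c, hc⟩ := exists_bundleChart B (toBase q₀)
  have h1 := eventually_jetNhds_toBase_mem c r hc
  refine tendsto_jetNhds c ((toBase_htpy t₀ q₀).symm ▸ hc) ?_
    (tendsto_coordInf_htpy c r t₀ hc h1 (tendsto_coordInf_jetNhds c r hc))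
  filter_upwards [tendsto_snd.eventually h1] with p hp
  exact (toBase_htpy p.1 p.2).symm ▸ hp

lemma continuous_htpy (t : ℝ) : Continuous (htpy s hs t) :=
  continuous_iff_continuousAt.mpr fun q =>
    (tendsto_htpy t q).comp ((tendsto_const_nhds (x := t)).prodMk tendsto_id)

lemma BundleChart.smoothNear_scale_slice (c : B.BundleChart) (hs : s.dom = univ) {r : ℕ} (t : ℝ)
    {q : B.JetInf} (hq : toBase q ∈ c.dom) :
    SmoothNear (fun z => c.scale s r (t, z)) (c.coordInf r q) :=
  SmoothNear.comp (g := c.scale s r) (f := fun z => (t, z)) (c.smoothNear_scale hs t hq)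
    (ContDiff.smoothNear (by fun_prop) _)

lemma isSmoothMap_htpy (t : ℝ) : IsSmoothMap (smoothInf B) (smoothInf B) (htpy s hs t) := by
  intro q f hf
  obtain ⟨c, hc⟩ := exists_bundleChart B (toBase q)
  obtain ⟨r, g, hg, hfg⟩ := (smoothInf_rep c ((toBase_htpy t q).symm ▸ hc) hf).exists
  have h1 : SmoothNear (g ∘ fun z => c.scale s r (t, z)) (c.coordInf r q) := by
    refine SmoothNear.comp ?_ (c.smoothNear_scale_slice hs t hc)
    rwa [coordInf_htpy c r t hc] at hg
  refine (isCoordAt_coordInf c r hc).congr ((isCoordAt_coordInf c r hc).comp_mem h1) ?_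
  filter_upwards [(continuous_htpy t).continuousAt.eventually hfg, eventually_toBase_mem c hc]
    with q' h2 h3
  rw [Function.comp_apply, h2, Function.comp_apply, coordInf_htpy c r t h3]
  rfl

lemma BundleChart.hasDerivAt_scale (c : B.BundleChart) (r : ℕ) (t : ℝ) (z : Coord E F r) :
    HasDerivAt (fun t => c.scale s r (t, z)) (z - jetC r (c.rep s) z.1) t := by
  simpa [scale] using ((hasDerivAt_id t).smul_const (z - jetC r (c.rep s) z.1)).const_add
    (jetC r (c.rep s) z.1)

lemma hasDerivAt_coordInf_htpy (c : B.BundleChart) (r : ℕ) (t : ℝ) {q : B.JetInf}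
    (hq : toBase q ∈ c.dom) : HasDerivAt (fun t => c.coordInf r (htpy s hs t q))
      (c.coordInf r q - jetC r (c.rep s) (c.coordInf r q).1) t := by
  simp only [coordInf_htpy c r _ hq]
  exact c.hasDerivAt_scale r t _

lemma differentiableAt_htpy (t : ℝ) (q : B.JetInf) (f : B.JetInf → ℝ)
    (hf : f ∈ smoothInf B (htpy s hs t q)) :
    DifferentiableAt ℝ (f ∘ fun t => htpy s hs t q) t := by
  obtain ⟨c, hc⟩ := exists_bundleChart B (toBase q)
  exact differentiableAt_comp_curve c ((toBase_htpy t q).symm ▸ hc) rfl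
    (Eventually.of_forall fun t => (toBase_htpy t q).symm ▸ hc) (fun r =>
      (hasDerivAt_coordInf_htpy c r t hc).differentiableAt) f hf

variable (s hs) in
/-- The velocity of the homotopy: `ȳ = y^i_Λ ∂_i^Λ` with the `y^i_Λ` of `q`, at `htpy s hs t q`. -/
def vel (t : ℝ) (q : B.JetInf) : Tangent (smoothInf B) (htpy s hs t q) :=
  curveTangent (fun t => htpy s hs t q) t rfl (differentiableAt_htpy t q)

lemma tan_vel (c : B.BundleChart) (r : ℕ) (t : ℝ) {q : B.JetInf} (hq : toBase q ∈ c.dom) :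
    c.tan r (vel s hs t q) = c.coordInf r q - jetC r (c.rep s) (c.coordInf r q).1 := by
  have h1 : toBase (htpy s hs t q) ∈ c.dom := (toBase_htpy t q).symm ▸ hq
  exact (isCoordAt_coordInf c r h1).coordT_curveTangent (γ := fun t => htpy s hs t q) rfl
    (differentiableAt_htpy t q) (hasDerivAt_coordInf_htpy c r t hq)

lemma tan_vel_eq_fderiv (c : B.BundleChart) (r : ℕ) (t : ℝ) {q : B.JetInf}
    (hq : toBase q ∈ c.dom) :
    c.tan r (vel s hs t q) = fderiv ℝ (c.scale s r) (t, c.coordInf r q) (1, 0) := by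
  rw [tan_vel c r t hq]
  refine (c.hasDerivAt_scale r t _).unique ?_
  have h1 := (c.smoothNear_scale hs (r := r) t hq).differentiableAt.hasFDerivAt
  exact h1.comp_hasDerivAt (f := fun t => (t, c.coordInf r q)) t
    ((hasDerivAt_id t).prodMk (hasDerivAt_const t _))

lemma tan_pushforward_htpy (c : B.BundleChart) (r : ℕ) (t : ℝ) {q : B.JetInf}
    (hq : toBase q ∈ c.dom) (ξ : Tangent (smoothInf B) q) :
    c.tan r (pushforward (isSmoothMap_htpy (hs := hs) t) q ξ) =
      fderiv ℝ (c.scale s r) (t, c.coordInf r q) (0, c.tan r ξ) := by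
  refine (coordT_pushforward (isSmoothMap_htpy (hs := hs) t)
    (isCoordAt_coordInf c r ((toBase_htpy t q).symm ▸ hq)) ξ).trans ?_
  have h1 : c.coordInf r ∘ htpy s hs t =ᶠ[𝓝 q] (fun z => c.scale s r (t, z)) ∘ c.coordInf r := by
    filter_upwards [eventually_toBase_mem c hq] with q' h
    exact coordInf_htpy c r t h
  rw [(isCoordAt_coordInf c r hq).coordT_comp (c.smoothNear_scale_slice hs t hq) h1]
  have h2 := (c.smoothNear_scale hs (r := r) t hq).differentiableAt.hasFDerivAt
  have h3 := h2.comp (c.coordInf r q)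
    ((hasFDerivAt_const t (c.coordInf r q)).prodMk (hasFDerivAt_id (c.coordInf r q)))
  rw [show fderiv ℝ (fun z => c.scale s r (t, z)) (c.coordInf r q) = _ from h3.fderiv]
  rfl

end Homotopy

end AffineBundle

/-! ### Contraction of a form with the velocity of a homotopy of a vector space -/

section ContractTime

variable {V : Type u} [NormedAddCommGroup V] [NormedSpace ℝ V] [FiniteDimensional ℝ V] {n : ℕ}

/-- The pull-back of a form by a homotopy. -/
def homForm (H : ℝ × V → V) (A : V → V [⋀^Fin n]→L[ℝ] ℝ) : ℝ × V → (ℝ × V) [⋀^Fin n]→L[ℝ] ℝ :=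
  pullForm H A

lemma homForm_apply (H : ℝ × V → V) (A : V → V [⋀^Fin n]→L[ℝ] ℝ) (t : ℝ) (z : V)
    (v : Fin n → ℝ × V) : homForm H A (t, z) v = A (H (t, z)) fun a => fderiv ℝ H (t, z) (v a) :=
  rfl

lemma smoothNear_homForm {H : ℝ × V → V} {A : V → V [⋀^Fin n]→L[ℝ] ℝ} {t : ℝ} {z : V}
    (hH : SmoothNear H (t, z)) (hA : SmoothNear A (H (t, z))) : SmoothNear (homForm H A) (t, z) :=
  smoothNear_pullForm hH hA

lemma extDeriv_homForm {H : ℝ × V → V} {A : V → V [⋀^Fin n]→L[ℝ] ℝ} {t : ℝ} {z : V}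
    (hH : SmoothNear H (t, z)) (hA : SmoothNear A (H (t, z))) :
    extDeriv (homForm H A) (t, z) = homForm H (extDeriv A) (t, z) :=
  extDeriv_pullForm hH hA

/-- The contraction of `homForm` with the velocity of the homotopy. -/
def contractForm (H : ℝ × V → V) (A : V → V [⋀^Fin (n + 1)]→L[ℝ] ℝ) (t : ℝ) (z : V) :
    V [⋀^Fin n]→L[ℝ] ℝ :=
  contractTime (homForm H A (t, z))

lemma contractForm_apply (H : ℝ × V → V) (A : V → V [⋀^Fin (n + 1)]→L[ℝ] ℝ) (t : ℝ) (z : V)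
    (v : Fin n → V) : contractForm H A t z v = A (H (t, z))
      (Fin.cons (fderiv ℝ H (t, z) (1, 0)) fun a => fderiv ℝ H (t, z) (0, v a)) := by
  rw [contractForm, contractTime_apply, homForm_apply]
  refine congrArg _ (funext fun a => ?_)
  exact Fin.cases rfl (fun a => rfl) a

lemma continuousAt_contractTime {β : ℝ × V → (ℝ × V) [⋀^Fin (n + 1)]→L[ℝ] ℝ} {t : ℝ} {z : V}
    (h : SmoothNear β (t, z)) : ContinuousAt (fun t => contractTime (β (t, z))) t :=
  (contractTime (n := n) (V := V)).continuous.continuousAt.comp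
    (h.continuousAt.comp (f := fun t : ℝ => (t, z)) (x := t) (by fun_prop))

lemma continuousAt_contractForm_apply {H : ℝ × V → V} {A : V → V [⋀^Fin (n + 1)]→L[ℝ] ℝ} {t : ℝ}
    {z : V} (h : SmoothNear (homForm H A) (t, z)) (v : Fin n → V) :
    ContinuousAt (fun t => contractForm H A t z v) t :=
  (ContinuousAlternatingMap.apply ℝ V ℝ v).continuous.continuousAt.comp
    (continuousAt_contractTime h)

lemma integral_contractForm_apply {H : ℝ × V → V} {A : V → V [⋀^Fin (n + 1)]→L[ℝ] ℝ} {a b : ℝ}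
    {z : V} (h : ∀ t ∈ uIcc a b, SmoothNear (homForm H A) (t, z)) (v : Fin n → V) :
    (∫ t in a..b, contractForm H A t z) v = ∫ t in a..b, contractForm H A t z v :=
  ((ContinuousAlternatingMap.apply ℝ V ℝ v).intervalIntegral_comp_comm
    (ContinuousOn.intervalIntegrable fun t ht =>
      (continuousAt_contractTime (h t ht)).continuousWithinAt)).symm

lemma smoothNear_integral_contractForm {H : ℝ × V → V} {A : V → V [⋀^Fin (n + 1)]→L[ℝ] ℝ} {a b : ℝ}
    {z : V} (h : ∀ t ∈ uIcc a b, SmoothNear (homForm H A) (t, z)) :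
    SmoothNear (fun z => ∫ t in a..b, contractForm H A t z) z :=
  SmoothNear.intervalIntegral (g := fun p => contractTime (homForm H A p)) fun t ht =>
    (h t ht).clm_comp contractTime

end ContractTime

namespace AffineBundle

variable {E E' F X Y : Type*}
  [NormedAddCommGroup E] [NormedSpace ℝ E] [FiniteDimensional ℝ E]
  [NormedAddCommGroup E'] [NormedSpace ℝ E']
  [NormedAddCommGroup F] [NormedSpace ℝ F] [FiniteDimensional ℝ F]
  [TopologicalSpace X] [ChartedSpace E X] [IsManifold 𝓘(ℝ, E) ∞ X]
  [TopologicalSpace Y] [ChartedSpace E' Y] [IsManifold 𝓘(ℝ, E') ∞ Y]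
  {B : AffineBundle E E' F X Y}

variable {s : B.LocalSection} {hs : s.dom = univ} {n : ℕ}

/-! ### The homotopy operator -/

variable (s hs) in
/-- The contraction of `φ` with the velocity of the homotopy, pulled back at the time `t`. -/
def contractHtpy (φ : B.InfForm (n + 1)) (t : ℝ) : B.InfForm n := fun q =>
  ((φ (htpy s hs t q)).curryLeft (vel s hs t q)).compLinearMap
    (pushforward (isSmoothMap_htpy (hs := hs) t) q)

lemma contractHtpy_apply (φ : B.InfForm (n + 1)) (t : ℝ) (q : B.JetInf)
    (ξ : Fin n → Tangent (smoothInf B) q) : contractHtpy s hs φ t q ξ =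
      φ (htpy s hs t q) (Fin.cons (vel s hs t q) fun a =>
        pushforward (isSmoothMap_htpy (hs := hs) t) q (ξ a)) := rfl

open Classical in
variable (s hs) in
/-- The homotopy operator of the homotopy `htpy s hs`, for times from `a` to `b`. -/
def htpyOp (a b : ℝ) (φ : B.InfForm (n + 1)) : B.InfForm n := fun q =>
  -- The integral is additive only for integrable functions of t. Continuity is guaranteed for
  -- locally pull-back forms by `IsLocallyPullbackForm.continuous_contractHtpy`; where it fails the
  -- value is 0 by default.
  if h : ∀ ξ : Fin n → Tangent (smoothInf B) q,
      Continuous fun t => contractHtpy s hs φ t q ξ then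
    { toFun := fun ξ => ∫ t in a..b, contractHtpy s hs φ t q ξ
      map_update_add' := fun {hd} ξ i x y => by
        cases Subsingleton.elim hd (instDecidableEqFin n)
        simp only [AlternatingMap.map_update_add]
        exact intervalIntegral.integral_add ((h _).intervalIntegrable a b)
          ((h _).intervalIntegrable a b)
      map_update_smul' := fun {hd} ξ i r x => by
        cases Subsingleton.elim hd (instDecidableEqFin n)
        simp only [AlternatingMap.map_update_smul]
        exact intervalIntegral.integral_smul _ _
      map_eq_zero_of_eq' := fun ξ i j hij hne => by
        simp only [AlternatingMap.map_eq_zero_of_eq _ _ hij hne, intervalIntegral.integral_zero] }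
  else 0

/-- The filters are left free for three uses: `pure q` for continuity in t, `jetNhds r q` for the
order of the form, and `𝓝 q` for the exterior derivative. -/
lemma eventually_contractHtpy_rep (c : B.BundleChart) (r : ℕ) (t₀ : ℝ)
    {φ : B.InfForm (n + 1)} {A : Coord E F r → Coord E F r [⋀^Fin (n + 1)]→L[ℝ] ℝ}
    {l l' : Filter B.JetInf} (hl : ∀ᶠ q in l, toBase q ∈ c.dom)
    (hH : Tendsto (fun p : ℝ × B.JetInf => htpy s hs p.1 p.2) (𝓝 t₀ ×ˢ l) l')
    (hA : RepAlong l' c r φ A) :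
    ∀ᶠ p : ℝ × B.JetInf in 𝓝 t₀ ×ˢ l, ∀ ξ : Fin n → Tangent (smoothInf B) p.2,
      contractHtpy s hs φ p.1 p.2 ξ =
        contractForm (c.scale s r) A p.1 (c.coordInf r p.2) fun a => c.tan r (ξ a) := by
  filter_upwards [hH.eventually hA, tendsto_snd.eventually hl] with p h1 h2 ξ
  rw [contractHtpy_apply, h1, contractForm_apply, coordInf_htpy c r p.1 h2]
  refine congrArg _ (funext fun a => ?_)
  refine Fin.cases ?_ (fun a => ?_) a
  · exact tan_vel_eq_fderiv c r p.1 h2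
  · exact tan_pushforward_htpy c r p.1 h2 (ξ a)

lemma eventually_pullback_htpy_rep (c : B.BundleChart) (r : ℕ) (t₀ : ℝ)
    {φ : B.InfForm n} {A : Coord E F r → Coord E F r [⋀^Fin n]→L[ℝ] ℝ}
    {l l' : Filter B.JetInf} (hl : ∀ᶠ q in l, toBase q ∈ c.dom)
    (hH : Tendsto (fun p : ℝ × B.JetInf => htpy s hs p.1 p.2) (𝓝 t₀ ×ˢ l) l')
    (hA : RepAlong l' c r φ A) :
    ∀ᶠ p : ℝ × B.JetInf in 𝓝 t₀ ×ˢ l, ∀ ξ : Fin n → Tangent (smoothInf B) p.2,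
      pullback (isSmoothMap_htpy (hs := hs) p.1) φ p.2 ξ =
        homForm (c.scale s r) A (p.1, c.coordInf r p.2) fun a => (0, c.tan r (ξ a)) := by
  filter_upwards [hH.eventually hA, tendsto_snd.eventually hl] with p h1 h2 ξ
  refine (h1 _).trans ?_
  rw [homForm_apply, coordInf_htpy c r p.1 h2]
  refine congrArg _ (funext fun a => ?_)
  exact tan_pushforward_htpy c r p.1 h2 (ξ a)

lemma IsLocallyPullbackForm.continuous_contractHtpy {φ : B.InfForm (n + 1)}
    (hφ : IsLocallyPullbackForm φ) (q : B.JetInf) (ξ : Fin n → Tangent (smoothInf B) q) :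
    Continuous fun t => contractHtpy s hs φ t q ξ := by
  refine continuous_iff_continuousAt.mpr fun t => ?_
  obtain ⟨c, hc⟩ := exists_bundleChart B (toBase q)
  obtain ⟨r, hr⟩ := isLocallyPullbackForm_iff.mp hφ (htpy s hs t q)
  obtain ⟨A, hA, hAφ⟩ := hr.exists_rep c ((toBase_htpy t q).symm ▸ hc)
  -- Taking `pure q` freezes the point and leaves a statement about nearby times alone.
  have h1 := eventually_contractHtpy_rep (hs := hs) c r t (l := pure q)
    (eventually_pure.mpr hc) ((tendsto_htpy_jetNhds r t q).mono_left (Filter.prod_mono le_rfl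
      ((pure_le_nhds q).trans (nhds_le_jetNhds r q)))) hAφ
  rw [prod_pure, eventually_map] at h1
  have h2 : SmoothNear (homForm (c.scale s r) A) (t, c.coordInf r q) := by
    refine smoothNear_homForm (c.smoothNear_scale hs t hc) ?_
    rwa [coordInf_htpy c r t hc] at hA
  exact (continuousAt_contractForm_apply h2 fun a => c.tan r (ξ a)).congr
    (h1.mono fun t ht => (ht ξ).symm)

lemma IsLocallyPullbackForm.htpyOp_apply {φ : B.InfForm (n + 1)}
    (hφ : IsLocallyPullbackForm φ) (a b : ℝ) (q : B.JetInf)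
    (ξ : Fin n → Tangent (smoothInf B) q) :
    htpyOp s hs a b φ q ξ = ∫ t in a..b, contractHtpy s hs φ t q ξ := by
  rw [htpyOp, dif_pos (hφ.continuous_contractHtpy q)]
  rfl

lemma IsLocallyPullbackForm.htpyOp_add_adjacent {φ : B.InfForm (n + 1)}
    (hφ : IsLocallyPullbackForm φ) (a b b' : ℝ) :
    htpyOp s hs a b φ + htpyOp s hs b b' φ = htpyOp s hs a b' φ := by
  funext q
  ext ξ
  rw [Pi.add_apply, AlternatingMap.add_apply, hφ.htpyOp_apply, hφ.htpyOp_apply, hφ.htpyOp_apply]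
  exact intervalIntegral.integral_add_adjacent_intervals
    ((hφ.continuous_contractHtpy q ξ).intervalIntegrable _ _)
    ((hφ.continuous_contractHtpy q ξ).intervalIntegrable _ _)

lemma IsLocallyPullbackForm.htpyOp_add {φ φ' : B.InfForm (n + 1)}
    (hφ : IsLocallyPullbackForm φ) (hφ' : IsLocallyPullbackForm φ') (a b : ℝ) :
    htpyOp s hs a b (φ + φ') = htpyOp s hs a b φ + htpyOp s hs a b φ' := by
  funext q
  ext ξ
  rw [Pi.add_apply, AlternatingMap.add_apply, hφ.htpyOp_apply, hφ'.htpyOp_apply,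
    (hφ.add hφ').htpyOp_apply]
  exact intervalIntegral.integral_add
    ((hφ.continuous_contractHtpy q ξ).intervalIntegrable _ _)
    ((hφ'.continuous_contractHtpy q ξ).intervalIntegrable _ _)

/-- The form A represents φ only near the point reached at time t₀. By continuity of the homotopy
this covers a box of times near t₀ and points near q₀, so the integral can be computed from A only
over short intervals. -/
lemma exists_htpyOp_rep (c : B.BundleChart) (r : ℕ) (t₀ : ℝ) {q₀ : B.JetInf}
    (hq₀ : toBase q₀ ∈ c.dom)
    {φ : B.InfForm (n + 1)} (hφ : IsLocallyPullbackForm φ)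
    {A : Coord E F r → Coord E F r [⋀^Fin (n + 1)]→L[ℝ] ℝ}
    {l l' : Filter B.JetInf} (hl : ∀ᶠ q in l, toBase q ∈ c.dom)
    (hlq : Tendsto (c.coordInf r) l (𝓝 (c.coordInf r q₀)))
    (hH : Tendsto (fun p : ℝ × B.JetInf => htpy s hs p.1 p.2) (𝓝 t₀ ×ˢ l) l')
    (hA : SmoothNear A (c.coordInf r (htpy s hs t₀ q₀))) (hAφ : RepAlong l' c r φ A) :
    ∀ᶠ t₁ in 𝓝 t₀,
      (∀ t ∈ uIcc t₀ t₁, SmoothNear (homForm (c.scale s r) A) (t, c.coordInf r q₀)) ∧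
      RepAlong l c r (htpyOp s hs t₀ t₁ φ) fun z =>
        ∫ t in t₀..t₁, contractForm (c.scale s r) A t z := by
  have h0 : SmoothNear (homForm (c.scale s r) A) (t₀, c.coordInf r q₀) := by
    refine smoothNear_homForm (c.smoothNear_scale hs t₀ hq₀) ?_
    rwa [coordInf_htpy c r t₀ hq₀] at hA
  have h1 : ∀ᶠ t in 𝓝 t₀, SmoothNear (homForm (c.scale s r) A) (t, c.coordInf r q₀) :=
    (show ContinuousAt (fun t => (t, c.coordInf r q₀)) t₀ by fun_prop).eventually h0.eventually
  have h2 : ∀ᶠ p : ℝ × B.JetInf in 𝓝 t₀ ×ˢ l,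
      SmoothNear (homForm (c.scale s r) A) (p.1, c.coordInf r p.2) := by
    have h3 := h0.eventually
    rw [nhds_prod_eq] at h3
    exact (tendsto_id.prodMap hlq).eventually h3
  obtain ⟨I, hI, Q, hQ, hIQ⟩ := eventually_prod_iff.mp
    (h2.and (eventually_contractHtpy_rep c r t₀ hl hH hAφ))
  obtain ⟨ε, hε, hball⟩ := Metric.eventually_nhds_iff_ball.mp (h1.and hI)
  filter_upwards [Metric.ball_mem_nhds t₀ hε] with t₁ ht₁
  have hsub : uIcc t₀ t₁ ⊆ Metric.ball t₀ ε := by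
    rw [← segment_eq_uIcc]
    exact (convex_ball t₀ ε).segment_subset (Metric.mem_ball_self hε) ht₁
  refine ⟨fun t ht => (hball t (hsub ht)).1, ?_⟩
  filter_upwards [hQ] with q hq ξ
  have h4 : ∀ t ∈ uIcc t₀ t₁, SmoothNear (homForm (c.scale s r) A) (t, c.coordInf r q) :=
    fun t ht => (hIQ (hball t (hsub ht)).2 hq).1
  rw [hφ.htpyOp_apply, integral_contractForm_apply h4]
  exact intervalIntegral.integral_congr fun t ht => (hIQ (hball t (hsub ht)).2 hq).2 ξ

/-- Connectedness of ℝ takes the place of subdividing the time interval. It is needed because the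
order and the coordinate form representing φ may change along the path of a point under the
homotopy. -/
lemma induction_Icc {P : ℝ → ℝ → Prop} (h : ∀ t, ∀ᶠ t' in 𝓝 t, P t t')
    (hsymm : ∀ t t', P t t' → P t' t) (htrans : ∀ t t' t'', P t t' → P t' t'' → P t t'')
    (a b : ℝ) : P a b := by
  refine isPreconnected_univ.induction₂' P (fun t _ => ?_) (fun t t' t'' _ _ _ => htrans t t' t'')
    (mem_univ a) (mem_univ b)
  filter_upwards [mem_nhdsWithin_of_mem_nhds (h t)] with t' ht' using ⟨ht', hsymm _ _ ht'⟩

lemma IsLocallyPullbackForm.htpyOp_symm {φ : B.InfForm (n + 1)} (hφ : IsLocallyPullbackForm φ)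
    (a b : ℝ) : htpyOp s hs b a φ = - htpyOp s hs a b φ := by
  funext q
  ext ξ
  rw [Pi.neg_apply, AlternatingMap.neg_apply, hφ.htpyOp_apply, hφ.htpyOp_apply,
    intervalIntegral.integral_symm]

lemma eventually_pullbackNear_htpyOp {φ : B.InfForm (n + 1)} (hφ : IsLocallyPullbackForm φ)
    {r : ℕ} {t₀ : ℝ} {q : B.JetInf} (h : PullbackNear r (htpy s hs t₀ q) φ) :
    ∀ᶠ t₁ in 𝓝 t₀, PullbackNear r q (htpyOp s hs t₀ t₁ φ) := by
  obtain ⟨c, hc⟩ := exists_bundleChart B (toBase q)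
  obtain ⟨A, hA, hAφ⟩ := h.exists_rep c ((toBase_htpy t₀ q).symm ▸ hc)
  filter_upwards [exists_htpyOp_rep c r t₀ hc hφ (eventually_jetNhds_toBase_mem c r hc)
    (tendsto_coordInf_jetNhds c r hc) (tendsto_htpy_jetNhds r t₀ q) hA hAφ] with t₁ ht₁
  exact pullbackNear_of_rep c hc
    (smoothNear_integral_contractForm ht₁.1) ht₁.2

lemma IsLocallyPullbackForm.htpyOp {φ : B.InfForm (n + 1)} (hφ : IsLocallyPullbackForm φ)
    (a b : ℝ) : IsLocallyPullbackForm (htpyOp s hs a b φ) := by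
  refine isLocallyPullbackForm_iff.mpr fun q => ?_
  refine induction_Icc (P := fun a b => ∃ r, PullbackNear r q (AffineBundle.htpyOp s hs a b φ))
    (fun t => ?_) (fun t t' ⟨r, hr⟩ => ?_) (fun t t' t'' ⟨r, hr⟩ ⟨r', hr'⟩ => ?_) a b
  · obtain ⟨r, hr⟩ := isLocallyPullbackForm_iff.mp hφ (htpy s hs t q)
    exact (eventually_pullbackNear_htpyOp hφ hr).mono fun _ h => ⟨r, h⟩
  · exact ⟨r, hφ.htpyOp_symm (hs := hs) t t' ▸ hr.neg⟩
  · exact ⟨max r r', hφ.htpyOp_add_adjacent (hs := hs) t t' t'' ▸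
      (hr.mono (le_max_left r r')).add (hr'.mono (le_max_right r r'))⟩

/-- The same induction over time as for locally pull-back forms, now with one order r throughout, so
the result is again of order r at every point. -/
lemma IsPullbackForm.htpyOp {φ : B.InfForm (n + 1)} (h : IsPullbackForm φ)
    (a b : ℝ) : IsPullbackForm (htpyOp s hs a b φ) := by
  have hφ := h.isLocallyPullbackForm
  obtain ⟨r, hr⟩ := h.pullbackNear
  refine isPullbackForm_of_pullbackNear (r := r) fun q => ?_
  exact induction_Icc (P := fun a b => PullbackNear r q (AffineBundle.htpyOp s hs a b φ))
    (fun t => eventually_pullbackNear_htpyOp hφ (hr _))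
    (fun t t' h => hφ.htpyOp_symm (hs := hs) t t' ▸ h.neg)
    (fun t t' t'' h h' => hφ.htpyOp_add_adjacent (hs := hs) t t' t'' ▸ h.add h') a b

end AffineBundle

/-! ### The homotopy formula for forms on a vector space -/

section ContractTime

variable {V : Type u} [NormedAddCommGroup V] [NormedSpace ℝ V] [FiniteDimensional ℝ V] {n : ℕ}

lemma SmoothNear.extDeriv {A : V → V [⋀^Fin n]→L[ℝ] ℝ} {z : V} (hA : SmoothNear A z) :
    SmoothNear (extDeriv A) z :=
  hA.fderiv_right.clm_comp (ContinuousAlternatingMap.alternatizeUncurryFinCLM ℝ V ℝ)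

/-- `extDeriv_integral_contractTime` for the pull-back of A by H, using that pull-back commutes with
d. Compactness of the time interval gives one neighbourhood of z₀ on which all data are smooth. -/
lemma eventually_extDeriv_integral_contractForm {H : ℝ × V → V} {A : V → V [⋀^Fin (n + 1)]→L[ℝ] ℝ}
    {a b : ℝ} {z₀ : V}
    (h : ∀ t ∈ uIcc a b, SmoothNear H (t, z₀) ∧ SmoothNear A (H (t, z₀))) :
    ∀ᶠ z in 𝓝 z₀, ∀ v : Fin (n + 1) → V,
      extDeriv (fun z => ∫ t in a..b, contractForm H A t z) z v =
        homForm H A (b, z) (fun i => (0, v i)) - homForm H A (a, z) (fun i => (0, v i)) -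
          (∫ t in a..b, contractForm H (extDeriv A) t z) v := by
  have h1 : ∀ᶠ z in 𝓝 z₀, ∀ t ∈ uIcc a b, SmoothNear H (t, z) ∧ SmoothNear A (H (t, z)) := by
    refine isCompact_uIcc.eventually_forall_of_forall_eventually fun t ht => ?_
    have h2 : ∀ᶠ p in 𝓝 (t, z₀), SmoothNear H p ∧ SmoothNear A (H p) :=
      (h t ht).1.eventually.and ((h t ht).1.continuousAt.eventually (h t ht).2.eventually)
    exact (continuous_swap.tendsto (z₀, t)).eventually h2
  filter_upwards [h1] with z hz v
  have h3 : ∀ t ∈ uIcc a b, SmoothNear (homForm H A) (t, z) := fun t ht =>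
    smoothNear_homForm (hz t ht).1 (hz t ht).2
  have h4 : ∀ t ∈ uIcc a b, SmoothNear (homForm H (extDeriv A)) (t, z) := fun t ht =>
    smoothNear_homForm (hz t ht).1 (hz t ht).2.extDeriv
  refine (extDeriv_integral_contractTime h3 v).trans ?_
  rw [integral_contractForm_apply h4]
  congr 1
  refine intervalIntegral.integral_congr fun t ht => ?_
  simp only [extDeriv_homForm (hz t ht).1 (hz t ht).2]
  rfl

end ContractTime

namespace AffineBundle

variable {E E' F X Y : Type*}
  [NormedAddCommGroup E] [NormedSpace ℝ E] [FiniteDimensional ℝ E]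
  [NormedAddCommGroup E'] [NormedSpace ℝ E']
  [NormedAddCommGroup F] [NormedSpace ℝ F] [FiniteDimensional ℝ F]
  [TopologicalSpace X] [ChartedSpace E X] [IsManifold 𝓘(ℝ, E) ∞ X]
  [TopologicalSpace Y] [ChartedSpace E' Y] [IsManifold 𝓘(ℝ, E') ∞ Y]
  {B : AffineBundle E E' F X Y}

variable {s : B.LocalSection} {hs : s.dom = univ} {n : ℕ}

/-! ### The homotopy formula -/

lemma ExtDerivAt.exists_rep {q : B.JetInf} {φ : B.InfForm n} {ψ : B.InfForm (n + 1)}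
    (h : ExtDerivAt (smoothInf B) q φ ψ) (c : B.BundleChart) (hc : toBase q ∈ c.dom) :
    ∃ (r : ℕ) (A : Coord E F r → Coord E F r [⋀^Fin n]→L[ℝ] ℝ),
      SmoothNear A (c.coordInf r q) ∧ RepAlong (𝓝 q) c r φ A ∧
        RepAlong (𝓝 q) c r ψ (extDeriv A) := by
  obtain ⟨J, f, g, h⟩ := h
  have h0 := h.self_of_nhds.1.1
  obtain ⟨r, hf, hg⟩ := ((eventually_all.mpr fun j => smoothInf_rep c hc (h0 j).1).and
    (eventually_all.mpr fun j => eventually_all.mpr fun b =>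
      smoothInf_rep c hc ((h0 j).2 b))).exists
  choose F' hF' hf using hf
  choose G hG hg using hg
  have hκ := eventually_isCoordAt c r hc
  exact ⟨r, sumForm F' G, smoothNear_sumForm hF' hG,
    hasRep_of_isExprAt hκ hF' hG hf hg (h.mono fun _ h => h.1),
    hasRep_extDeriv_of_isExprAt hκ hF' hG hf hg (h.mono fun _ h => h.2)⟩

/-- For short times a single A represents φ along the path and `extDeriv A` represents ψ, so the
formula on the coordinate space applies. -/
lemma eventually_extDerivAt_htpyOp {φ : B.InfForm (n + 1)} {ψ : B.InfForm (n + 2)}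
    (hφ : IsLocallyPullbackForm φ) (hψ : IsLocallyPullbackForm ψ)
    (h : IsExtDeriv (smoothInf B) φ ψ) (t₀ : ℝ) (q : B.JetInf) :
    ∀ᶠ t₁ in 𝓝 t₀, ExtDerivAt (smoothInf B) q (htpyOp s hs t₀ t₁ φ)
      (pullback (isSmoothMap_htpy (hs := hs) t₁) φ - pullback (isSmoothMap_htpy (hs := hs) t₀) φ -
        htpyOp s hs t₀ t₁ ψ) := by
  obtain ⟨c, hc⟩ := exists_bundleChart B (toBase q)
  obtain ⟨r, A, hA, hAφ, hAψ⟩ := ExtDerivAt.exists_rep (isExtDeriv_iff.mp h (htpy s hs t₀ q)) c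
    ((toBase_htpy t₀ q).symm ▸ hc)
  have hl := eventually_toBase_mem c hc
  have hlc := (continuousAt_coordInf c r hc).tendsto
  have hH := tendsto_htpy (hs := hs) t₀ q
  have h1 : ∀ᶠ t in 𝓝 t₀, ∀ᶠ q' in 𝓝 q, ∀ ξ : Fin (n + 1) → Tangent (smoothInf B) q',
      pullback (isSmoothMap_htpy (hs := hs) t) φ q' ξ =
        homForm (c.scale s r) A (t, c.coordInf r q') fun a => (0, c.tan r (ξ a)) :=
    (eventually_pullback_htpy_rep c r t₀ hl hH hAφ).curry
  have h2 : ∀ᶠ t in 𝓝 t₀, SmoothNear A (c.scale s r (t, c.coordInf r q)) := by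
    rw [coordInf_htpy c r t₀ hc] at hA
    exact (c.hasDerivAt_scale r t₀ (c.coordInf r q)).continuousAt.eventually hA.eventually
  obtain ⟨ε, hε, hball⟩ := Metric.eventually_nhds_iff_ball.mp h2
  filter_upwards [exists_htpyOp_rep c r t₀ hc hφ hl hlc hH hA hAφ,
    exists_htpyOp_rep c r t₀ hc hψ hl hlc hH hA.extDeriv hAψ, h1, Metric.ball_mem_nhds t₀ hε]
    with t₁ h3 h4 h5 ht₁
  have hκ := eventually_isCoordAt c r hc
  have hsub : uIcc t₀ t₁ ⊆ Metric.ball t₀ ε := by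
    rw [← segment_eq_uIcc]
    exact (convex_ball t₀ ε).segment_subset (Metric.mem_ball_self hε) ht₁
  refine HasRep.extDerivAt hκ (smoothNear_integral_contractForm h3.1) h3.2 ?_
  filter_upwards [h5, h1.self_of_nhds, h4.2, hlc.eventually
    (eventually_extDeriv_integral_contractForm fun t ht =>
      ⟨c.smoothNear_scale hs (r := r) t hc, hball t (hsub ht)⟩)] with q' h6 h7 h8 h9 ξ
  refine Eq.trans ?_ (h9 _).symm
  exact congrArg₂ (· - ·) (congrArg₂ (· - ·) (h6 ξ) (h7 ξ)) (h8 ξ)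

lemma ExtDerivAt.neg {q : B.JetInf} {φ : B.InfForm n} {ψ : B.InfForm (n + 1)}
    (h : ExtDerivAt (smoothInf B) q φ ψ) : ExtDerivAt (smoothInf B) q (-φ) (-ψ) := by
  obtain ⟨J, f, g, h⟩ := h
  obtain ⟨c, hc⟩ := exists_bundleChart B (toBase q)
  obtain ⟨r, A, hA, hAφ, hAψ⟩ := ExtDerivAt.exists_rep ⟨J, f, g, h⟩ c hc
  refine HasRep.extDerivAt (A := (-1 : ℝ) • A) (eventually_isCoordAt c r hc)
    ((SmoothNear.const (-1 : ℝ) _).smul hA) ?_ ?_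
  · filter_upwards [hAφ] with q' h1 ξ
    rw [Pi.neg_apply, AlternatingMap.neg_apply, h1]
    simp
    rfl
  · filter_upwards [hAψ] with q' h1 ξ
    rw [Pi.neg_apply, AlternatingMap.neg_apply, h1, extDeriv_smul]
    simp
    rfl

/-- The homotopy formula for `htpy s hs` on the times from `a` to `b`. -/
lemma IsExtDeriv.htpyOp {φ : B.InfForm (n + 1)} {ψ : B.InfForm (n + 2)}
    (hφ : IsLocallyPullbackForm φ) (hψ : IsLocallyPullbackForm ψ)
    (h : IsExtDeriv (smoothInf B) φ ψ) (a b : ℝ) :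
    IsExtDeriv (smoothInf B) (htpyOp s hs a b φ)
      (pullback (isSmoothMap_htpy (hs := hs) b) φ - pullback (isSmoothMap_htpy (hs := hs) a) φ -
        htpyOp s hs a b ψ) := by
  refine isExtDeriv_iff.mpr fun q => ?_
  -- The formula is additive over adjacent intervals: the pull-backs at the intermediate time
  -- cancel.
  refine induction_Icc (P := fun a b => ExtDerivAt (smoothInf B) q (AffineBundle.htpyOp s hs a b φ)
    (pullback (isSmoothMap_htpy (hs := hs) b) φ - pullback (isSmoothMap_htpy (hs := hs) a) φ -
        AffineBundle.htpyOp s hs a b ψ)) (fun t => eventually_extDerivAt_htpyOp hφ hψ h t q)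
    (fun t t' h1 => ?_) (fun t t' t'' h1 h2 => ?_) a b
  · rw [hφ.htpyOp_symm t t', hψ.htpyOp_symm t t']
    convert ExtDerivAt.neg h1 using 1
    abel
  · rw [← hφ.htpyOp_add_adjacent t t' t'', ← hψ.htpyOp_add_adjacent t t' t'']
    convert ExtDerivAt.add h1 h2 using 1
    abel

end AffineBundle

namespace AffineBundle

variable {E E' F X Y : Type*}
  [NormedAddCommGroup E] [NormedSpace ℝ E] [FiniteDimensional ℝ E]
  [NormedAddCommGroup E'] [NormedSpace ℝ E']
  [NormedAddCommGroup F] [NormedSpace ℝ F] [FiniteDimensional ℝ F]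
  [TopologicalSpace X] [ChartedSpace E X] [IsManifold 𝓘(ℝ, E) ∞ X]
  [TopologicalSpace Y] [ChartedSpace E' Y] [IsManifold 𝓘(ℝ, E') ∞ Y]
  {B : AffineBundle E E' F X Y}

/-! ### Coordinates, tangent vectors and forms on the base -/

lemma isCoordAt_base (c : B.BundleChart) {x : X} (hx : x ∈ c.base.source) :
    IsCoordAt (smoothX E X) c.base x where
  congr := by
    intro f f' hf h
    filter_upwards [(hf : ∀ᶠ z in 𝓝 x, ContMDiffAt 𝓘(ℝ, E) 𝓘(ℝ, ℝ) ∞ f z),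
      h.eventuallyEq_nhds] with z h1 h2 using h1.congr_of_eventuallyEq h2
  comp_mem := by
    intro g hg
    have h1 : ∀ᶠ z in 𝓝 x, ContDiffAt ℝ ∞ g (c.base z) := (c.base.continuousAt hx).eventually hg
    change ∀ᶠ z in 𝓝 x, _
    filter_upwards [h1, c.base.open_source.mem_nhds hx] with z h2 h3
    exact h2.contMDiffAt.comp z ((c.smooth_base z h3).contMDiffAt (c.base.open_source.mem_nhds h3))
  continuousAt := c.base.continuousAt hx

lemma smoothX_rep (c : B.BundleChart) {x : X} (hx : x ∈ c.base.source) {f : X → ℝ}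
    (hf : f ∈ smoothX E X x) :
    ∃ g : E → ℝ, SmoothNear g (c.base x) ∧ f =ᶠ[𝓝 x] g ∘ c.base := by
  refine ⟨f ∘ c.base.symm, ?_, ?_⟩
  · have h1 : Tendsto c.base.symm (𝓝 (c.base x)) (𝓝 x) := c.base.tendsto_symm hx
    filter_upwards [h1.eventually hf, c.base.open_target.mem_nhds (c.base.map_source hx)]
      with z h2 h3
    refine contMDiffAt_iff_contDiffAt.mp (ContMDiffAt.comp z h2 ?_)
    exact (c.smooth_base_symm z h3).contMDiffAt (c.base.open_target.mem_nhds h3)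
  · filter_upwards [c.base.open_source.mem_nhds hx] with z hz
    simp [c.base.left_inv hz]

lemma tangentX_eq_of_coordT_eq (c : B.BundleChart) {x : X} (hx : x ∈ c.base.source)
    {ξ η : Tangent (smoothX E X) x}
    (h : coordT (smoothX E X) c.base x ξ = coordT (smoothX E X) c.base x η) : ξ = η := by
  refine Tangent.ext_dAt fun f hf => ?_
  obtain ⟨g, hg, hfg⟩ := smoothX_rep c hx hf
  rw [(isCoordAt_base c hx).dAt_eq hg hfg, (isCoordAt_base c hx).dAt_eq hg hfg, h]

lemma coordT_base_surjective (c : B.BundleChart) {x : X} (hx : x ∈ c.base.source) :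
    Function.Surjective (coordT (smoothX E X) c.base x) := by
  intro v
  let γ : ℝ → X := fun t => c.base.symm (c.base x + t • v)
  have h0 : γ 0 = x := by simp [γ, c.base.left_inv hx]
  have h1 : HasDerivAt (fun t : ℝ => c.base x + t • v) v 0 := by
    simpa using ((hasDerivAt_id (0 : ℝ)).smul_const v).const_add (c.base x)
  have h2 : (c.base ∘ γ) =ᶠ[𝓝 0] fun t : ℝ => c.base x + t • v := by
    have h3 : ∀ᶠ z in 𝓝 (c.base x + (0 : ℝ) • v), z ∈ c.base.target := by
      rw [zero_smul, add_zero]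
      exact c.base.open_target.mem_nhds (c.base.map_source hx)
    filter_upwards [h1.continuousAt.eventually h3] with t ht using c.base.right_inv ht
  have h3 : HasDerivAt (c.base ∘ γ) v 0 := h1.congr_of_eventuallyEq h2
  have h4 : ContinuousAt γ 0 := by
    refine ContinuousAt.comp (g := c.base.symm) ?_ h1.continuousAt
    rw [zero_smul, add_zero]
    exact c.base.symm.continuousAt (c.base.map_source hx)
  have hd : ∀ f ∈ smoothX E X x, DifferentiableAt ℝ (f ∘ γ) 0 := by
    intro f hf
    obtain ⟨g, hg, hfg⟩ := smoothX_rep c hx hf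
    have h5 : f ∘ γ =ᶠ[𝓝 0] g ∘ (c.base ∘ γ) := by
      have := h4.tendsto
      rw [h0] at this
      exact this.eventually hfg
    refine DifferentiableAt.congr_of_eventuallyEq (DifferentiableAt.comp 0 ?_
      h3.differentiableAt) h5
    rw [Function.comp_apply, h0]
    exact hg.differentiableAt
  exact ⟨curveTangent γ 0 h0 hd, (isCoordAt_base c hx).coordT_curveTangent h0 hd h3⟩

lemma eventually_isCoordAt_base (c : B.BundleChart) {x : X} (hx : x ∈ c.base.source) :
    ∀ᶠ y in 𝓝 x, IsCoordAt (smoothX E X) c.base y := by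
  filter_upwards [c.base.open_source.mem_nhds hx] with y hy using isCoordAt_base c hy

/-- Two expressions of α lead to the same coordinate form near the point, because base charts are
open and realize every vector. The two derivatives then agree as well. -/
lemma extDerivAt_unique_base (c : B.BundleChart) {x : X} (hx : x ∈ c.base.source) {n : ℕ}
    {α : Form (smoothX E X) n} {ψ ψ' : Form (smoothX E X) (n + 1)}
    (h : ExtDerivAt (smoothX E X) x α ψ) (h' : ExtDerivAt (smoothX E X) x α ψ') : ψ x = ψ' x := by
  have key : ∀ {ψ : Form (smoothX E X) (n + 1)}, ExtDerivAt (smoothX E X) x α ψ →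
      ∃ A : E → E [⋀^Fin n]→L[ℝ] ℝ, HasRep (smoothX E X) c.base x α A ∧
        HasRep (smoothX E X) c.base x ψ (extDeriv A) := by
    rintro ψ ⟨J, f, g, h⟩
    have h0 := h.self_of_nhds.1.1
    choose F' hF' hf using fun j => smoothX_rep c hx (h0 j).1
    choose G hG hg using fun j b => smoothX_rep c hx ((h0 j).2 b)
    have hκ := eventually_isCoordAt_base c hx
    exact ⟨sumForm F' G, hasRep_of_isExprAt hκ hF' hG hf hg (h.mono fun _ h => h.1),
      hasRep_extDeriv_of_isExprAt hκ hF' hG hf hg (h.mono fun _ h => h.2)⟩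
  obtain ⟨A, h1, h2⟩ := key h
  obtain ⟨A', h1', h2'⟩ := key h'
  have h3 : A =ᶠ[𝓝 (c.base x)] A' := by
    refine h1.eventuallyEq (c.base.map_nhds_eq hx).ge ?_ h1'
    filter_upwards [c.base.open_source.mem_nhds hx] with y hy using coordT_base_surjective c hy
  ext ξ
  rw [h2.self_of_nhds, h2'.self_of_nhds, extDeriv, extDeriv, h3.fderiv_eq]

lemma IsExprAt.congr {M : Type*} {S : M → Subalgebra ℝ (M → ℝ)} {p : M} {J : Type*} [Fintype J]
    {n : ℕ} {α α' : Form S n} {f : J → M → ℝ} {g : J → Fin n → M → ℝ} (h : IsExprAt S p α f g)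
    (hα : α' p = α p) : IsExprAt S p α' f g :=
  ⟨h.1, fun ξ => by rw [hα, h.2]⟩

lemma exists_isExtDeriv_base (B : AffineBundle E E' F X Y) {n : ℕ} {α : Form (smoothX E X) n}
    (hα : IsSmoothFormOn (smoothX E X) univ α) :
    ∃ ψ : Form (smoothX E X) (n + 1), IsExtDeriv (smoothX E X) α ψ := by
  have h1 : ∀ x, ∃ ψ : Form (smoothX E X) (n + 1), ExtDerivAt (smoothX E X) x α ψ := by
    intro x
    obtain ⟨c, hc⟩ := exists_bundleChart B x
    obtain ⟨J, f, g, h⟩ := isSmoothFormOn_iff.mp hα x (mem_univ x)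
    have h0 := h.self_of_nhds.1
    choose F' hF' hf using fun j => smoothX_rep c hc.1 (h0 j).1
    choose G hG hg using fun j b => smoothX_rep c hc.1 ((h0 j).2 b)
    have hκ := eventually_isCoordAt_base c hc.1
    exact ⟨fun y => (extDeriv (sumForm F' G) (c.base y)).toAlternatingMap.compLinearMap
      (coordT (smoothX E X) c.base y), HasRep.extDerivAt hκ (smoothNear_sumForm hF' hG)
        (hasRep_of_isExprAt hκ hF' hG hf hg h) (Eventually.of_forall fun _ _ => rfl)⟩
  choose Ψ hΨ using h1
  -- Derivatives chosen around different points agree pointwise by uniqueness, so the diagonal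
  -- choice coincides near each x with Ψ x.
  refine ⟨fun x => Ψ x x, isExtDeriv_iff.mpr fun x => ?_⟩
  obtain ⟨J, f, g, h⟩ := hΨ x
  refine ⟨J, f, g, ?_⟩
  filter_upwards [eventually_eventually_nhds.mpr h] with y hy
  obtain ⟨c, hc⟩ := exists_bundleChart B y
  exact ⟨hy.self_of_nhds.1, IsExprAt.congr hy.self_of_nhds.2
    (extDerivAt_unique_base c hc.1 (hΨ y) ⟨J, f, g, hy⟩)⟩

lemma IsExtDeriv.isSmoothFormOn {M : Type*} [TopologicalSpace M] {S : M → Subalgebra ℝ (M → ℝ)}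
    {n : ℕ} {α : Form S n} {ψ : Form S (n + 1)} (h : IsExtDeriv S α ψ) :
    IsSmoothFormOn S univ α ∧ IsSmoothFormOn S univ ψ := by
  refine ⟨isSmoothFormOn_iff.mpr fun p _ => ?_, isSmoothFormOn_iff.mpr fun p _ => ?_⟩
  · obtain ⟨J, f, g, h⟩ := isExtDeriv_iff.mp h p
    exact ⟨J, f, g, h.mono fun _ h => h.1⟩
  · obtain ⟨J, f, g, h⟩ := isExtDeriv_iff.mp h p
    exact ⟨J, _, _, h.mono fun _ h => h.2⟩

lemma continuous_toBase : Continuous (toBase (B := B)) := by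
  refine continuous_iff_continuousAt.mpr fun q => ?_
  obtain ⟨c, hc⟩ := exists_bundleChart B (toBase q)
  have h1 : ContinuousAt (fun q' => c.base.symm (c.coordInf 0 q').1) q := by
    refine ContinuousAt.comp (g := c.base.symm) ?_ (continuousAt_coordInf c 0 hc).fst
    rw [coordInf_fst c 0 hc]
    exact c.base.symm.continuousAt (c.base.map_source hc.1)
  refine h1.congr ?_
  filter_upwards [eventually_toBase_mem c hc] with q' hq'
  rw [coordInf_fst c 0 hq', c.base.left_inv hq'.1]

lemma continuous_pt (r : ℕ) : Continuous (Jet.pt (B := B) (r := r)) := by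
  refine continuous_iff_continuousAt.mpr fun q => ?_
  obtain ⟨c, hc⟩ := exists_bundleChart B q.pt
  have h1 : ContinuousAt (fun q' => c.base.symm (c.coord r q').1) q := by
    refine ContinuousAt.comp (g := c.base.symm) ?_ (continuousAt_coord c hc).fst
    rw [coord_fst c q hc]
    exact c.base.symm.continuousAt (c.base.map_source hc.1)
  refine h1.congr ?_
  filter_upwards [eventually_pt_mem c hc] with q' hq'
  rw [coord_fst c q' hq', c.base.left_inv hq'.1]

lemma isPullbackForm_pullbackBase {n : ℕ} {α : Form (smoothX E X) n}
    (hα : IsSmoothFormOn (smoothX E X) univ α) : IsPullbackForm (B.pullbackBase α) := by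
  have hpt : IsSmoothMap (smoothJet B 0) (smoothX E X) Jet.pt := fun p _ hf => smoothJet_pt 0 p hf
  refine ⟨0, pullback hpt α, isSmoothFormOn_iff.mpr fun p _ => ?_, rfl⟩
  obtain ⟨J, f, g, h⟩ := isSmoothFormOn_iff.mp hα p.pt (mem_univ _)
  exact ⟨J, _, _, ((continuous_pt 0).continuousAt.eventually h).mono fun _ h' =>
    IsExprAt.pullback hpt h'⟩

lemma IsExtDeriv.pullbackBase {n : ℕ} {α : Form (smoothX E X) n} {ψ : Form (smoothX E X) (n + 1)}
    (h : IsExtDeriv (smoothX E X) α ψ) :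
    IsExtDeriv (smoothInf B) (B.pullbackBase α) (B.pullbackBase ψ) :=
  isExtDeriv_iff.mpr fun q => ExtDerivAt.pullback isSmoothMap_toBase continuous_toBase.continuousAt
    (isExtDeriv_iff.mp h (toBase q))

end AffineBundle

namespace AffineBundle

variable {E E' F X Y : Type*}
  [NormedAddCommGroup E] [NormedSpace ℝ E] [FiniteDimensional ℝ E]
  [NormedAddCommGroup E'] [NormedSpace ℝ E']
  [NormedAddCommGroup F] [NormedSpace ℝ F] [FiniteDimensional ℝ F]
  [TopologicalSpace X] [ChartedSpace E X] [IsManifold 𝓘(ℝ, E) ∞ X]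
  [TopologicalSpace Y] [ChartedSpace E' Y] [IsManifold 𝓘(ℝ, E') ∞ Y]
  {B : AffineBundle E E' F X Y}

/-! ### Vertical and Cartan tangent vectors -/

lemma coordT_pushforward_toBase (c : B.BundleChart) (r : ℕ) {q : B.JetInf} (hq : toBase q ∈ c.dom)
    (ξ : Tangent (smoothInf B) q) :
    coordT (smoothX E X) c.base (toBase q) (pushforward isSmoothMap_toBase q ξ) =
      (c.tan r ξ).1 := by
  rw [coordT_pushforward isSmoothMap_toBase (isCoordAt_base c hq.1)]
  have h1 : c.base ∘ toBase =ᶠ[𝓝 q] ContinuousLinearMap.fst ℝ E _ ∘ c.coordInf r := by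
    filter_upwards [eventually_toBase_mem c hq] with q' hq'
    exact (coordInf_fst c r hq').symm
  rw [(isCoordAt_coordInf c r hq).coordT_comp
    ((ContinuousLinearMap.fst ℝ E _).contDiff.smoothNear _)
    h1, ContinuousLinearMap.fderiv]
  rfl

lemma isVertical_iff (c : B.BundleChart) (r : ℕ) {q : B.JetInf} (hq : toBase q ∈ c.dom)
    {ξ : Tangent (smoothInf B) q} : IsVertical ξ ↔ (c.tan r ξ).1 = 0 := by
  rw [← coordT_pushforward_toBase c r hq, IsVertical]
  refine ⟨fun h => by rw [h, map_zero], fun h => tangentX_eq_of_coordT_eq c hq.1 ?_⟩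
  rw [h, map_zero]

/-- The function g ∘ j^r s ∘ π^∞ depends only on the base point. By `hasFDerivAt_jetC` the
differential of j^r s is the lift by j^{r+1} s, whose coordinates at this point are those of q. -/
lemma dAt_alongSection (c : B.BundleChart) {r : ℕ} {q : B.JetInf} (hq : toBase q ∈ c.dom)
    {s : B.LocalSection} (h : toBase q ∈ s.dom)
    (hs : jet (r + 1) s (toBase q) h = toJet (r + 1) q) {g : B.Jet r → ℝ} {G : Coord E F r → ℝ}
    (hG : SmoothNear G (c.coordInf r q)) (hgG : g =ᶠ[𝓝 (toJet r q)] G ∘ c.coord r)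
    (ξ : Tangent (smoothInf B) q) : dAt (smoothInf B) q (alongSection g s) ξ =
      fderiv ℝ G (c.coordInf r q) (totalLift r (c.coordInf (r + 1) q) (c.tan r ξ).1) := by
  have h1 : jet r s (toBase q) h = toJet r q := by
    rw [← toJet_trunc r.le_succ q, ← hs, trunc_jet]
  have hrep : SmoothNear (c.rep s) (c.coordInf r q).1 := by
    rw [coordInf_fst c r hq]
    exact c.smoothNear_rep s hq h
  have e1 : jetC r (c.rep s) (c.coordInf r q).1 = c.coordInf r q := by
    rw [coordInf_fst c r hq, ← coord_jet c r s h hq, h1]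
    rfl
  have e2 : jetC (r + 1) (c.rep s) (c.coordInf r q).1 = c.coordInf (r + 1) q := by
    rw [coordInf_fst c r hq, ← coord_jet c (r + 1) s h hq, hs]
    rfl
  let K : Coord E F r → Coord E F r := fun z => jetC r (c.rep s) z.1
  have hK : SmoothNear K (c.coordInf r q) :=
    SmoothNear.comp (g := jetC r (c.rep s)) (f := Prod.fst) (smoothNear_jetC r hrep)
      (contDiff_fst.smoothNear _)
  have hKd : HasFDerivAt K ((totalLift r (c.coordInf (r + 1) q)).comp
      (ContinuousLinearMap.fst ℝ E _)) (c.coordInf r q) := by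
    have := hasFDerivAt_jetC r hrep
    rw [e2] at this
    exact this.comp (c.coordInf r q) hasFDerivAt_fst
  have hGK : SmoothNear (G ∘ K) (c.coordInf r q) := SmoothNear.comp (e1.symm ▸ hG) hK
  have h2 : alongSection g s =ᶠ[𝓝 q] (G ∘ K) ∘ c.coordInf r := by
    have h3 : ∀ᶠ q' in 𝓝 q, toBase q' ∈ c.dom ∩ s.dom :=
      continuous_toBase.continuousAt.eventually
        ((c.isOpen_dom.inter s.isOpen_dom).mem_nhds ⟨hq, h⟩)
    have h4 : ∀ᶠ p in 𝓝 (toJet r q), g p = G (c.coord r p) := hgG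
    obtain ⟨O, hO, hqO, hOg⟩ := (mem_nhds_jet_iff c ((pt_toJet r q).symm ▸ hq)).mp h4
    have h5 : ∀ᶠ q' in 𝓝 q, K (c.coordInf r q') ∈ O := by
      refine (hK.continuousAt.comp (continuousAt_coordInf c r hq)).eventually
        (hO.mem_nhds ?_)
      rw [Function.comp_apply, show K (c.coordInf r q) = c.coordInf r q from e1]
      exact hqO
    filter_upwards [h3, h5] with q' h6 h7
    have e3 : c.coord r (jet r s (toBase q') h6.2) = K (c.coordInf r q') := by
      rw [coord_jet c r s h6.2 h6.1, ← coordInf_fst c r h6.1]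
    rw [alongSection, dif_pos h6.2, Function.comp_apply, Function.comp_apply, ← e3]
    exact hOg _ h6.1 (e3 ▸ h7)
  rw [(isCoordAt_coordInf c r hq).dAt_eq hGK h2]
  have h6 : HasFDerivAt (G ∘ K) _ (c.coordInf r q) :=
    (HasFDerivAt.comp (c.coordInf r q) (f := K) (g := G) (g' := fderiv ℝ G (c.coordInf r q))
      (by rw [show K (c.coordInf r q) = c.coordInf r q from e1]
          exact hG.differentiableAt.hasFDerivAt) hKd)
  rw [h6.fderiv]
  rfl

/-- Linear functions of the coordinates suffice as tests g, and they turn the contact conditions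
into dy_Λ = y_{λ+Λ} dx^λ on ξ. So ξ is the lift of its base component by the total derivatives at q.
-/
lemma isCartan_iff (c : B.BundleChart) {q : B.JetInf} (hq : toBase q ∈ c.dom)
    {ξ : Tangent (smoothInf B) q} :
    IsCartan ξ ↔ ∀ r, c.tan r ξ = totalLift r (c.coordInf (r + 1) q) (c.tan r ξ).1 := by
  constructor
  · intro h r
    obtain ⟨s, hs, e⟩ := exists_eq_jet (toJet (r + 1) q)
    have hs' : toBase q ∈ s.dom := by rwa [pt_toJet] at hs
    have e' : jet (r + 1) s (toBase q) hs' = toJet (r + 1) q := by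
      rw [e]
      congr 1
      exact (pt_toJet _ _).symm
    refine (isCoordAt_coordInf c r hq).coordT_eq fun l => ?_
    have hpt : (toJet r q).pt ∈ c.dom := (pt_toJet r q).symm ▸ hq
    have h1 := h r (fun p => l (c.coord r p)) ((isCoordAt_coord c hpt).clm_mem l) s hs' e'
    refine h1.trans ((dAt_alongSection c hq hs' e' (g := fun p => l (c.coord r p))
      (G := fun z => l z) (l.contDiff.smoothNear _) (Filter.EventuallyEq.refl _ _) ξ).trans ?_)
    rw [show fderiv ℝ (fun z => l z) (c.coordInf r q) = l from l.fderiv]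
  · intro h r g hg s hs e
    have hpt : (toJet r q).pt ∈ c.dom := (pt_toJet r q).symm ▸ hq
    obtain ⟨G, hG, hgG⟩ := smoothJet_rep c hpt hg
    rw [dAt_alongSection c hq hs e hG hgG]
    have h1 : g ∘ toJet r =ᶠ[𝓝 q] G ∘ c.coordInf r :=
      (continuous_toJet r).continuousAt.eventually hgG
    rw [(isCoordAt_coordInf c r hq).dAt_eq hG h1, ← h r]
    rfl

section Homotopy

variable {s : B.LocalSection} {hs : s.dom = univ} {n : ℕ}

/-- Differentiate j^r s(x) + t(z − j^r s(x)) in z, where x is the base component of z. The action of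
the homotopy on vertical and on Cartan vectors is read off from this formula. -/
lemma tan_pushforward_htpy_eq (c : B.BundleChart) (r : ℕ) (t : ℝ) {q : B.JetInf}
    (hq : toBase q ∈ c.dom) (ξ : Tangent (smoothInf B) q) :
    c.tan r (pushforward (isSmoothMap_htpy (hs := hs) t) q ξ) =
      totalLift r (jetC (r + 1) (c.rep s) (c.base (toBase q))) (c.tan r ξ).1 +
        t • (c.tan r ξ -
          totalLift r (jetC (r + 1) (c.rep s) (c.base (toBase q))) (c.tan r ξ).1) := by
  rw [tan_pushforward_htpy c r t hq]
  have hrep : SmoothNear (c.rep s) (c.coordInf r q).1 := by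
    rw [coordInf_fst c r hq]
    exact c.smoothNear_rep s hq (hs ▸ mem_univ _)
  rw [← coordInf_fst c r hq]
  have h1 : HasFDerivAt (fun z : Coord E F r => jetC r (c.rep s) z.1)
      ((totalLift r (jetC (r + 1) (c.rep s) (c.coordInf r q).1)).comp
        (ContinuousLinearMap.fst ℝ E _)) (c.coordInf r q) :=
    (hasFDerivAt_jetC r hrep).comp (c.coordInf r q) hasFDerivAt_fst
  have h2 : HasFDerivAt (fun z : Coord E F r => c.scale s r (t, z)) _ (c.coordInf r q) :=
    h1.add (((hasFDerivAt_id (c.coordInf r q)).sub h1).const_smul t)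
  have h3 := (c.smoothNear_scale hs (r := r) t hq).differentiableAt.hasFDerivAt
  have h4 := h3.comp (c.coordInf r q)
    ((hasFDerivAt_const t (c.coordInf r q)).prodMk (hasFDerivAt_id (c.coordInf r q)))
  have h5 := congrArg (fun L => L (c.tan r ξ)) (h4.unique h2)
  exact h5

lemma isVertical_vel (t : ℝ) (q : B.JetInf) : IsVertical (vel s hs t q) := by
  obtain ⟨c, hc⟩ := exists_bundleChart B (toBase q)
  rw [isVertical_iff c 0 ((toBase_htpy t q).symm ▸ hc), tan_vel c 0 t hc]
  exact sub_self (c.coordInf 0 q).1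

lemma pushforward_htpy_tan_fst (c : B.BundleChart) (r : ℕ) (t : ℝ) {q : B.JetInf}
    (hq : toBase q ∈ c.dom) (ξ : Tangent (smoothInf B) q) :
    (c.tan r (pushforward (isSmoothMap_htpy (hs := hs) t) q ξ)).1 = (c.tan r ξ).1 := by
  rw [tan_pushforward_htpy_eq c r t hq]
  simp [totalLift]

lemma IsVertical.pushforward_htpy {q : B.JetInf} {ξ : Tangent (smoothInf B) q} (h : IsVertical ξ)
    (t : ℝ) : IsVertical (pushforward (isSmoothMap_htpy (hs := hs) t) q ξ) := by
  obtain ⟨c, hc⟩ := exists_bundleChart B (toBase q)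
  rw [isVertical_iff c 0 ((toBase_htpy t q).symm ▸ hc), pushforward_htpy_tan_fst c 0 t hc]
  exact (isVertical_iff c 0 hc).mp h

lemma IsVertical.tan_pushforward_htpy {q : B.JetInf} {ξ : Tangent (smoothInf B) q}
    (h : IsVertical ξ) (c : B.BundleChart) (hc : toBase q ∈ c.dom) (r : ℕ) (t : ℝ) :
    c.tan r (pushforward (isSmoothMap_htpy (hs := hs) t) q ξ) = t • c.tan r ξ := by
  rw [tan_pushforward_htpy_eq c r t hc, (isVertical_iff c r hc).mp h, map_zero, zero_add, sub_zero]

/-- The lift of a fixed base vector depends affinely on the jet, and over a fixed base point the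
homotopy is an affine combination of jets. Comparison with `tan_pushforward_htpy_eq` shows that
Cartan vectors stay Cartan. -/
lemma totalLift_scale (c : B.BundleChart) (r : ℕ) (t : ℝ) {q : B.JetInf}
    (hq : toBase q ∈ c.dom) (e : E) :
    totalLift r (c.coordInf (r + 1) (htpy s hs t q)) e =
      totalLift r (jetC (r + 1) (c.rep s) (c.base (toBase q))) e +
        t • (totalLift r (c.coordInf (r + 1) q) e -
          totalLift r (jetC (r + 1) (c.rep s) (c.base (toBase q))) e) := by
  rw [coordInf_htpy c (r + 1) t hq, BundleChart.scale, coordInf_fst c (r + 1) hq]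
  refine Prod.ext ?_ rfl
  simp [totalLift]

lemma IsCartan.pushforward_htpy {q : B.JetInf} {ξ : Tangent (smoothInf B) q} (h : IsCartan ξ)
    (t : ℝ) : IsCartan (pushforward (isSmoothMap_htpy (hs := hs) t) q ξ) := by
  obtain ⟨c, hc⟩ := exists_bundleChart B (toBase q)
  refine (isCartan_iff c ((toBase_htpy t q).symm ▸ hc)).mpr fun r => ?_
  rw [pushforward_htpy_tan_fst c r t hc, totalLift_scale c r t hc, tan_pushforward_htpy_eq c r t hc,
    ← (isCartan_iff c hc).mp h r]

/-- At time 0 the map factors through x ↦ j^∞s(x), whose tangent vectors are total-derivative lifts.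
-/
lemma isCartan_pushforward_htpy_zero {q : B.JetInf} (ξ : Tangent (smoothInf B) q) :
    IsCartan (pushforward (isSmoothMap_htpy (hs := hs) 0) q ξ) := by
  obtain ⟨c, hc⟩ := exists_bundleChart B (toBase q)
  refine (isCartan_iff c ((toBase_htpy 0 q).symm ▸ hc)).mpr fun r => ?_
  rw [pushforward_htpy_tan_fst c r 0 hc, totalLift_scale c r 0 hc, tan_pushforward_htpy_eq c r 0 hc,
    zero_smul, zero_smul]

/-! ### The bidegree and the homotopy operator -/

lemma IsBidegree.add {k m : ℕ} {φ φ' : B.InfForm n} (h : IsBidegree k m φ)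
    (h' : IsBidegree k m φ') : IsBidegree k m (φ + φ') :=
  ⟨h.1, fun q ξ A hA => by
    rw [Pi.add_apply, AlternatingMap.add_apply, h.2 q ξ A hA, h'.2 q ξ A hA, add_zero]⟩

lemma IsBidegree.neg {k m : ℕ} {φ : B.InfForm n} (h : IsBidegree k m φ) : IsBidegree k m (-φ) :=
  ⟨h.1, fun q ξ A hA => by
    rw [Pi.neg_apply, AlternatingMap.neg_apply, h.2 q ξ A hA, neg_zero]⟩

/-- The contracted vertical vector counts as one further vertical argument, so contraction lowers
the contact degree by one and leaves the horizontal degree alone. -/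
lemma IsBidegree.contract_eq_zero {k m : ℕ} {φ : B.InfForm (n + 1)} (h : IsBidegree (k + 1) m φ)
    {q : B.JetInf} {ζ : Tangent (smoothInf B) q} (hζ : IsVertical ζ)
    {ξ : Fin n → Tangent (smoothInf B) q} {A : Finset (Fin n)}
    (hA : (k < A.card ∧ ∀ a ∈ A, IsVertical (ξ a)) ∨ (m < A.card ∧ ∀ a ∈ A, IsCartan (ξ a))) :
    φ q (Fin.cons ζ ξ) = 0 := by
  rcases hA with ⟨h1, h2⟩ | ⟨h1, h2⟩
  · refine h.2 q _ (Finset.cons 0 (A.map (Fin.succEmb n)) (by simp)) (Or.inl ⟨?_, ?_⟩)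
    · rw [Finset.card_cons, Finset.card_map]
      omega
    · intro a ha
      rw [Finset.mem_cons, Finset.mem_map] at ha
      rcases ha with rfl | ⟨b, hb, rfl⟩
      · exact hζ
      · exact h2 b hb
  · refine h.2 q _ (A.map (Fin.succEmb n)) (Or.inr ⟨?_, ?_⟩)
    · rwa [Finset.card_map]
    · intro a ha
      obtain ⟨b, hb, rfl⟩ := Finset.mem_map.mp ha
      exact h2 b hb

lemma IsBidegree.htpyOp {k m : ℕ} {φ : B.InfForm (n + 1)} (hφ : IsLocallyPullbackForm φ)
    (h : IsBidegree (k + 1) m φ) (a b : ℝ) : IsBidegree k m (htpyOp s hs a b φ) := by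
  refine ⟨by have := h.1; omega, fun q ξ A hA => ?_⟩
  rw [hφ.htpyOp_apply]
  refine (intervalIntegral.integral_congr fun t _ => ?_).trans intervalIntegral.integral_zero
  rw [contractHtpy_apply]
  refine h.contract_eq_zero (isVertical_vel t q) (A := A) ?_
  exact hA.imp (fun h => ⟨h.1, fun a ha => (h.2 a ha).pushforward_htpy t⟩)
    fun h => ⟨h.1, fun a ha => (h.2 a ha).pushforward_htpy t⟩

/-- The velocity is vertical, and in contact degree 0 one vertical argument is already too many. -/
lemma IsBidegree.htpyOp_eq_zero {m : ℕ} {φ : B.InfForm (n + 1)} (hφ : IsLocallyPullbackForm φ)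
    (h : IsBidegree 0 m φ) (a b : ℝ) : AffineBundle.htpyOp s hs a b φ = 0 := by
  funext q
  ext ξ
  rw [hφ.htpyOp_apply]
  refine (intervalIntegral.integral_congr fun t _ => ?_).trans intervalIntegral.integral_zero
  rw [contractHtpy_apply]
  refine h.2 _ _ {0} (Or.inl ⟨by simp, fun a ha => ?_⟩)
  rw [Finset.mem_singleton.mp ha]
  exact isVertical_vel t q

/-- All n = k + 1 + m > m arguments become Cartan. -/
lemma IsBidegree.pullback_htpy_zero {k m : ℕ} {φ : B.InfForm n} (h : IsBidegree (k + 1) m φ) :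
    pullback (isSmoothMap_htpy (hs := hs) 0) φ = 0 := by
  funext q
  ext ξ
  refine h.2 _ _ Finset.univ (Or.inr ⟨?_, fun a _ => isCartan_pushforward_htpy_zero (ξ a)⟩)
  have := h.1
  simp only [Finset.card_univ, Fintype.card_fin]
  omega

/-- `htpy s hs 1 q` equals q only propositionally, so tangent vectors at the two points have
different types and are compared through their components. -/
lemma form_congr (c : B.BundleChart) {φ : B.InfForm n} {q q' : B.JetInf} (hq : toBase q ∈ c.dom)
    (h : q = q') {ξ : Fin n → Tangent (smoothInf B) q} {ξ' : Fin n → Tangent (smoothInf B) q'}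
    (hξ : ∀ a r, c.tan r (ξ a) = c.tan r (ξ' a)) : φ q ξ = φ q' ξ' := by
  subst h
  exact congrArg _ (funext fun a => Tangent.eq_of_tan_eq c hq (hξ a))

lemma pullback_htpy_one {t : ℝ} (ht : t = 1) (φ : B.InfForm n) :
    pullback (isSmoothMap_htpy (hs := hs) t) φ = φ := by
  funext q
  ext ξ
  obtain ⟨c, hc⟩ := exists_bundleChart B (toBase q)
  have h1 : ∀ a r, c.tan r (pushforward (isSmoothMap_htpy (hs := hs) t) q (ξ a)) =
      c.tan r (ξ a) := fun a r => by
    rw [tan_pushforward_htpy_eq c r t hc, ht, one_smul, add_sub_cancel]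
  have h2 : htpy s hs t q = q := by rw [ht, htpy_one]
  have h3 : toBase (htpy s hs t q) ∈ c.dom := by rwa [toBase_htpy]
  change φ (htpy s hs t q) (fun a => pushforward (isSmoothMap_htpy (hs := hs) t) q (ξ a)) = φ q ξ
  exact form_congr (φ := φ) c h3 h2 h1

/-- The vertical part of the homotopy formula. -/
lemma IsVerticalDiff.htpyOp {k m : ℕ} {φ : B.InfForm (n + 1)} {ψ : B.InfForm (n + 2)}
    (h : IsVerticalDiff (k + 1) m φ ψ) :
    IsVerticalDiff k m (htpyOp s hs 0 1 φ) (φ - htpyOp s hs 0 1 ψ) := by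
  obtain ⟨hφ, hψ, η, hη, hd⟩ := h
  have h1 := IsExtDeriv.htpyOp (hs := hs) hφ.1 (hψ.1.add hη.1) hd 0 1
  -- With dφ = ψ + η and K the homotopy operator, the formula becomes d(Kφ) = (φ − Kψ) − Kη. The
  -- first summand has bidegree (k+1, m) and the second (k, m+1), so they are the d_V and d_H parts.
  rw [pullback_htpy_one rfl, hφ.2.pullback_htpy_zero, sub_zero, hψ.1.htpyOp_add hη.1, ← sub_sub,
    sub_eq_add_neg] at h1
  refine ⟨⟨hφ.1.htpyOp 0 1, hφ.2.htpyOp hφ.1 0 1⟩, ⟨?_, ?_⟩, _,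
    ⟨(hη.1.htpyOp 0 1).neg, (hη.2.htpyOp hη.1 0 1).neg⟩, h1⟩
  · rw [sub_eq_add_neg]
    exact hφ.1.add (hψ.1.htpyOp 0 1).neg
  · rw [sub_eq_add_neg]
    exact hφ.2.add (hψ.2.htpyOp hψ.1 0 1).neg

end Homotopy

end AffineBundle

namespace AffineBundle

variable {E E' F X Y : Type*}
  [NormedAddCommGroup E] [NormedSpace ℝ E] [FiniteDimensional ℝ E]
  [NormedAddCommGroup E'] [NormedSpace ℝ E']
  [NormedAddCommGroup F] [NormedSpace ℝ F] [FiniteDimensional ℝ F]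
  [TopologicalSpace X] [ChartedSpace E X] [IsManifold 𝓘(ℝ, E) ∞ X]
  [TopologicalSpace Y] [ChartedSpace E' Y] [IsManifold 𝓘(ℝ, E') ∞ Y]
  {B : AffineBundle E E' F X Y}

variable {s : B.LocalSection} {hs : s.dom = univ} {n : ℕ}

/-! ### The integral formula for the homotopy operator -/

lemma BundleChart.clm_tan (c : B.BundleChart) {q : B.JetInf} (hq : toBase q ∈ c.dom) (r : ℕ)
    (l : Coord E F r →L[ℝ] ℝ) (ξ : Tangent (smoothInf B) q) :
    dAt (smoothInf B) q (fun p => l (c.coord r (toJet r p))) ξ = l (c.tan r ξ) :=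
  (isCoordAt_coordInf c r hq).clm_coordT l ξ

lemma BundleChart.clm_tan_fst (c : B.BundleChart) {q : B.JetInf} (hq : toBase q ∈ c.dom) (r : ℕ)
    (l : E →L[ℝ] ℝ) (ξ : Tangent (smoothInf B) q) :
    dAt (smoothInf B) q (fun p => l (c.base (toBase p))) ξ = l (c.tan r ξ).1 := by
  have h1 : (fun p => l (c.base (toBase p))) =ᶠ[𝓝 q]
      l.comp (ContinuousLinearMap.fst ℝ E _) ∘ c.coordInf r := by
    filter_upwards [eventually_toBase_mem c hq] with p hp
    exact congrArg l (coordInf_fst c r hp).symm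
  rw [(isCoordAt_coordInf c r hq).dAt_eq
    ((l.comp (ContinuousLinearMap.fst ℝ E _)).contDiff.smoothNear _) h1,
    ContinuousLinearMap.fderiv]
  rfl

lemma eq_of_clm_eq {V : Type*} [NormedAddCommGroup V] [NormedSpace ℝ V] {v w : V}
    (h : ∀ l : V →L[ℝ] ℝ, l v = l w) : v = w :=
  (SeparatingDual.eq_iff_forall_dual_eq (R := ℝ)).mpr h

-- The origin of the power t^k. Push-forward by the homotopy multiplies the components of vertical
-- arguments by t and preserves the base components of Cartan arguments; the latter then agree with
-- the given Cartan vectors at the new point. Multilinearity extracts one factor t per vertical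
-- argument.
open Classical in
lemma contractHtpy_eq {k m : ℕ} {φ : B.InfForm (n + 1)} (hφ : IsBidegree (k + 1) m φ)
    (c : B.BundleChart) {q q' : B.JetInf} (hq : toBase q ∈ c.dom) {t : ℝ}
    (hq' : q' = htpy s hs t q) {ξ : Fin n → Tangent (smoothInf B) q}
    {ζ : Tangent (smoothInf B) q'} {ξ' : Fin n → Tangent (smoothInf B) q'} (hζv : IsVertical ζ)
    (hζ : ∀ r, c.tan r ζ = c.tan r (vel s hs t q))
    (hξ : ∀ a, SameComponents c (ξ a) (ξ' a)) :
    t ^ k * φ q' (Fin.cons ζ ξ') = contractHtpy s hs φ t q ξ := by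
  subst hq'
  have hq' : toBase (htpy s hs t q) ∈ c.dom := (toBase_htpy t q).symm ▸ hq
  let V : Finset (Fin n) := Finset.univ.filter fun a => IsVertical (ξ a) ∧ IsVertical (ξ' a) ∧
    ∀ r, c.tan r (ξ a) = c.tan r (ξ' a)
  have hV : ∀ a ∈ V, IsVertical (ξ a) ∧ IsVertical (ξ' a) ∧ ∀ r, c.tan r (ξ a) = c.tan r (ξ' a) :=
    fun a ha => (Finset.mem_filter.mp ha).2
  have hVc : ∀ a ∈ Vᶜ, IsCartan (ξ a) ∧ IsCartan (ξ' a) ∧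
      ∀ r, (c.tan r (ξ a)).1 = (c.tan r (ξ' a)).1 := by
    intro a ha
    rcases hξ a with ⟨h1, h2, h3⟩ | ⟨h1, h2, h3⟩
    · refine absurd (Finset.mem_filter.mpr ⟨Finset.mem_univ a, h1, h2, fun r => ?_⟩)
        (Finset.mem_compl.mp ha)
      refine eq_of_clm_eq fun l => ?_
      rw [← c.clm_tan hq, ← c.clm_tan hq', h3]
    · refine ⟨h1, h2, fun r => eq_of_clm_eq fun l => ?_⟩
      rw [← c.clm_tan_fst hq, ← c.clm_tan_fst hq', h3]
  have hζ' : vel s hs t q = ζ := Tangent.eq_of_tan_eq c hq' fun r => (hζ r).symm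
  have hpush : (fun a => pushforward (isSmoothMap_htpy (hs := hs) t) q (ξ a)) =
      fun a => if a ∈ V then t • ξ' a else ξ' a := by
    funext a
    refine Tangent.eq_of_tan_eq c hq' fun r => ?_
    by_cases ha : a ∈ V
    · rw [if_pos ha, (hV a ha).1.tan_pushforward_htpy c hq, (hV a ha).2.2 r, map_smul]
    · obtain ⟨h1, h2, h3⟩ := hVc a (Finset.mem_compl.mpr ha)
      rw [if_neg ha, (isCartan_iff c hq').mp h2 r,
        (isCartan_iff c hq').mp (h1.pushforward_htpy t) r, pushforward_htpy_tan_fst c r t hq, h3]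
  have hsmul : ((φ (htpy s hs t q)).curryLeft ζ) (fun a => if a ∈ V then t • ξ' a else ξ' a) =
      t ^ V.card * φ (htpy s hs t q) (Fin.cons ζ ξ') := by
    have := ((φ (htpy s hs t q)).curryLeft ζ).toMultilinearMap.map_piecewise_smul (fun _ => t) ξ' V
    rw [Finset.prod_const] at this
    exact this
  have hmain : contractHtpy s hs φ t q ξ = t ^ V.card * φ (htpy s hs t q) (Fin.cons ζ ξ') := by
    rw [contractHtpy_apply, hpush, hζ']
    exact hsmul
  rw [hmain]
  -- With fewer than k vertical arguments more than m are Cartan, and with more than k the contact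
  -- degree is exceeded. In both cases the value of φ is zero and the exponent of t is irrelevant.
  by_cases hk : V.card = k
  · rw [hk]
  · have h0 : φ (htpy s hs t q) (Fin.cons ζ ξ') = 0 := by
      rcases lt_or_gt_of_ne hk with h1 | h1
      · refine hφ.contract_eq_zero hζv (A := Vᶜ) (Or.inr ⟨?_, fun a ha => (hVc a ha).2.1⟩)
        have h2 := hφ.1
        rw [Finset.card_compl, Fintype.card_fin]
        omega
      · exact hφ.contract_eq_zero hζv (A := V) (Or.inl ⟨h1, fun a ha => (hV a ha).2.1⟩)
    rw [h0, mul_zero, mul_zero]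

lemma isHomotopyIntegral_htpyOp {k m : ℕ} {φ : B.InfForm (n + 1)} (h : IsLocallyPullbackForm φ)
    (hφ : IsBidegree (k + 1) m φ) : IsHomotopyIntegral s hs k φ (htpyOp s hs 0 1 φ) := by
  intro c q ξ qt ybar ξt hq s₀ y hqt hy hξ
  have hs₀ : ∀ r, s₀ r = jetC r (c.rep s) (c.base (toBase q)) := fun r => coord_jet c r s _ hq
  have hqt' : ∀ t ∈ Icc (0 : ℝ) 1, qt t = htpy s hs t q := by
    intro t ht
    have h1 : toBase (qt t) ∈ c.dom := (hqt t ht).1.symm ▸ hq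
    refine JetInf.eq_of_coordInf_eq c h1 ((toBase_htpy t q).symm ▸ hq) fun r => ?_
    rw [coordInf_htpy c r t hq, BundleChart.scale, coordInf_fst c r hq, ← hs₀]
    exact (hqt t ht).2 r
  have key : ∀ t ∈ uIcc (0 : ℝ) 1, t ^ k * φ (qt t) (Fin.cons (ybar t) (ξt t)) =
      contractHtpy s hs φ t q ξ := by
    intro t ht
    rw [uIcc_of_le zero_le_one] at ht
    have h1 : toBase (qt t) ∈ c.dom := (hqt t ht).1.symm ▸ hq
    refine contractHtpy_eq hφ c hq (hqt' t ht) (hy t ht).1 (fun r => ?_) (hξ t ht)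
    rw [tan_vel c r t hq, coordInf_fst c r hq, ← hs₀]
    exact eq_of_clm_eq fun l => (c.clm_tan h1 r l _).symm.trans ((hy t ht).2 r l)
  refine ⟨?_, ?_⟩
  · refine ((h.continuous_contractHtpy (hs := hs) q ξ).intervalIntegrable 0 1).congr ?_
    exact fun t ht => (key t (uIoc_subset_uIcc ht)).symm
  · rw [h.htpyOp_apply]
    exact intervalIntegral.integral_congr fun t ht => (key t ht).symm

/-! ### Uniqueness of the exterior derivative -/

/-- Only values of A along the lines in the directions v i, on the remaining vectors, enter dA(v).
Vanishing on a full neighbourhood would be too much to ask in `IsExtDeriv.eq_zero`. -/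
lemma extDeriv_apply_eq_zero {V : Type*} [NormedAddCommGroup V] [NormedSpace ℝ V]
    {A : V → V [⋀^Fin n]→L[ℝ] ℝ} {z : V} (hA : DifferentiableAt ℝ A z) {v : Fin (n + 1) → V}
    (h : ∀ i, ∀ᶠ t in 𝓝 (0 : ℝ), A (z + t • v i) (i.removeNth v) = 0) : extDeriv A z v = 0 := by
  rw [extDeriv_apply hA]
  refine Finset.sum_eq_zero fun i _ => ?_
  have h1 : HasFDerivAt (fun z => A z (i.removeNth v))
      (fderiv ℝ (fun z => A z (i.removeNth v)) z) (z + (0 : ℝ) • v i) := by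
    rw [zero_smul, add_zero]
    exact DifferentiableAt.hasFDerivAt
      ((ContinuousAlternatingMap.apply ℝ V ℝ (i.removeNth v)).differentiableAt.comp z hA)
  have h2 : HasDerivAt (fun t : ℝ => z + t • v i) (v i) 0 := by
    simpa using ((hasDerivAt_id (0 : ℝ)).smul_const (v i)).const_add z
  have h3 := (h1.comp_hasDerivAt (f := fun t : ℝ => z + t • v i) (0 : ℝ) h2).unique
    ((hasDerivAt_const (0 : ℝ) (0 : ℝ)).congr_of_eventuallyEq (h i))
  rw [h3, smul_zero]

/-- A coordinate form A of the zero form need not vanish off the coordinates of jets. It does vanish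
at points of J^∞Y on components of tangent vectors. The lines with velocity ξ i run through such
points, and the components of the other ξ j are tangent all along them because `cohSub E F` is
independent of the point. This determines dA on ξ. -/
lemma IsExtDeriv.eq_zero {ψ : B.InfForm (n + 1)} (h : IsExtDeriv (smoothInf B) 0 ψ) : ψ = 0 := by
  funext q
  ext ξ
  obtain ⟨c, hc⟩ := exists_bundleChart B (toBase q)
  obtain ⟨r, A, hA, hA0, hAψ⟩ := ExtDerivAt.exists_rep (isExtDeriv_iff.mp h q) c hc
  rw [hAψ.self_of_nhds ξ]
  refine extDeriv_apply_eq_zero hA.differentiableAt fun i => ?_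
  obtain ⟨γ, hγ, hγt⟩ := exists_curve c hc (tan_mem_cohSub c hc (ξ i))
  have h1 : Tendsto γ (𝓝 0) (𝓝 q) := by
    refine tendsto_jetInf c hc (hγt.mono fun t ht => ht.1) fun k => ?_
    have h2 : ContinuousAt (fun t : ℝ => c.coordInf k q + t • c.tan k (ξ i)) 0 := by fun_prop
    have h3 := h2.tendsto
    rw [zero_smul, add_zero] at h3
    exact h3.congr' (hγt.mono fun t ht => (ht.2 k).symm)
  filter_upwards [h1.eventually hA0, hγt] with t ht1 ht2
  choose η hη using fun a => exists_tangent c ht2.1 (tan_mem_cohSub c hc (i.removeNth ξ a))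
  have h4 := ht1 η
  rw [ht2.2 r] at h4
  simp only [hη] at h4
  exact h4.symm

/-! ### Exactness -/

lemma continuous_secInf (s : B.LocalSection) (hs : s.dom = univ) : Continuous (secInf s hs) := by
  refine continuous_iff_continuousAt.mpr fun x => ?_
  obtain ⟨c, hc⟩ := exists_bundleChart B x
  have h1 : ∀ᶠ y in 𝓝 x, y ∈ c.dom := c.isOpen_dom.mem_nhds hc
  refine tendsto_jetInf c (q := secInf s hs x) hc h1 fun r => ?_
  have h2 : ContinuousAt (fun y => jetC r (c.rep s) (c.base y)) x :=
    ContinuousAt.comp (g := jetC r (c.rep s)) (f := c.base)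
      (smoothNear_jetC r (c.smoothNear_rep s hc (hs ▸ mem_univ x))).continuousAt
      (c.base.continuousAt hc.1)
  rw [coordInf_secInf s hs c r hc]
  exact h2.tendsto.congr' (h1.mono fun y hy => (coordInf_secInf s hs c r hy).symm)

lemma isSmoothMap_secInf (s : B.LocalSection) (hs : s.dom = univ) :
    IsSmoothMap (smoothX E X) (smoothInf B) (secInf s hs) := by
  intro x f hf
  obtain ⟨c, hc⟩ := exists_bundleChart B x
  obtain ⟨r, g, hg, hfg⟩ := (smoothInf_rep c (q := secInf s hs x) hc hf).exists
  rw [coordInf_secInf s hs c r hc] at hg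
  have h1 := SmoothNear.comp (f := jetC r (c.rep s)) hg
    (smoothNear_jetC r (c.smoothNear_rep s hc (hs ▸ mem_univ x)))
  refine (isCoordAt_base c hc.1).congr ((isCoordAt_base c hc.1).comp_mem h1) ?_
  filter_upwards [(continuous_secInf s hs).continuousAt.eventually hfg,
    c.isOpen_dom.mem_nhds hc] with y h2 h3
  rw [Function.comp_apply, h2, Function.comp_apply, coordInf_secInf s hs c r h3]
  rfl

lemma pullback_htpy_zero_eq {t : ℝ} (ht : t = 0) (φ : B.InfForm n) :
    pullback (isSmoothMap_htpy (hs := hs) t) φ =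
      B.pullbackBase (pullback (isSmoothMap_secInf s hs) φ) := by
  have key : ∀ (G : B.JetInf → B.JetInf) (hG : IsSmoothMap (smoothInf B) (smoothInf B) G),
      G = secInf s hs ∘ toBase →
        pullback hG φ = B.pullbackBase (pullback (isSmoothMap_secInf s hs) φ) := by
    rintro _ hG rfl
    rfl
  refine key _ _ (funext fun q => ?_)
  rw [ht, htpy_zero]
  rfl

/-- The composite π^∞ ∘ j^∞s is the identity by definition, so pulling back along `secInf s hs`
recovers the form on X. -/
lemma pullbackBase_injective (s : B.LocalSection) (hs : s.dom = univ) :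
    Function.Injective (B.pullbackBase (n := n)) := by
  intro α α' h
  funext x
  ext η
  have h1 := congrArg (fun β : B.InfForm n => pullback (isSmoothMap_secInf s hs) β x η) h
  exact h1

lemma IsExtDeriv.apply_cons_zero {φ : B.InfForm 0} {ψ : B.InfForm 1}
    (h : IsExtDeriv (smoothInf B) φ ψ) (q : B.JetInf) : (fun q' => φ q' ![]) ∈ smoothInf B q ∧
      ∀ ξ : Fin 1 → Tangent (smoothInf B) q,
        ψ q ξ = dAt (smoothInf B) q (fun q' => φ q' ![]) (ξ 0) := by
  obtain ⟨J, f, g, h⟩ := isExtDeriv_iff.mp h q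
  have h0 := h.self_of_nhds
  have h1 : (fun q' => φ q' ![]) =ᶠ[𝓝 q] ∑ j, f j := by
    filter_upwards [h] with q' h'
    rw [h'.1.2]
    simp
  have h2 : ∑ j, f j ∈ smoothInf B q := Subalgebra.sum_mem _ fun j _ => (h0.1.1 j).1
  obtain ⟨c, hc⟩ := exists_bundleChart B (toBase q)
  refine ⟨(isCoordAt_coordInf c 0 hc).congr h2 h1, fun ξ => ?_⟩
  rw [dAt_congr (isCoordAt_coordInf c 0 hc).congr h1, h0.2.2, dAt_apply h2]
  have h3 : (⟨∑ j, f j, h2⟩ : smoothInf B q) = ∑ j, ⟨f j, (h0.1.1 j).1⟩ :=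
    Subtype.ext (by simp)
  rw [h3, map_sum]
  refine Finset.sum_congr rfl fun j _ => ?_
  rw [one_mul, Matrix.det_fin_one]
  exact dAt_apply (h0.1.1 j).1 _

/-- In positive degree both φ and dφ = η have contact degree 0, so their homotopy integrals vanish.
The homotopy formula then presents the difference of the two sides as the derivative of the zero
form. For functions the operator is not available; instead φ is constant along the path of each
point, as its derivative there is η on the vertical velocity. -/
lemma eq_pullback_htpy_zero : ∀ {n m : ℕ} {φ : B.InfForm n}, IsBidegree 0 m φ →
    IsLocallyPullbackForm φ → IsVerticalDiff 0 m φ 0 →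
      φ = pullback (isSmoothMap_htpy (hs := hs) 0) φ
  | 0, m, φ, hb, hφ, ⟨_, _, η, hη, hd⟩ => by
    rw [zero_add] at hd
    have h1 := fun q => IsExtDeriv.apply_cons_zero hd q
    funext q
    ext ξ
    have h2 : ∀ t, HasDerivAt ((fun q' => φ q' ![]) ∘ fun t => htpy s hs t q) 0 t := by
      intro t
      have h3 := (differentiableAt_htpy t q _ (h1 (htpy s hs t q)).1).hasDerivAt
      have h4 := dAt_curveTangent (γ := fun t => htpy s hs t q) rfl
        (differentiableAt_htpy t q) (h1 (htpy s hs t q)).1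
      have h5 := (h1 (htpy s hs t q)).2 fun _ => vel s hs t q
      rw [hη.2.2 _ _ {0} (Or.inl ⟨by simp, fun a _ => isVertical_vel t q⟩)] at h5
      rw [← h4, show dAt (smoothInf B) (htpy s hs t q) (fun q' => φ q' ![])
        (curveTangent (fun t => htpy s hs t q) t rfl (differentiableAt_htpy t q)) = 0 from h5.symm]
        at h3
      exact h3
    have h6 := is_const_of_deriv_eq_zero (fun t => (h2 t).differentiableAt)
      (fun t => (h2 t).deriv) 1 0
    have h8 := congrArg (fun q' => φ q' ![]) (htpy_one (hs := hs) q)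
    have h7 : ∀ (q' : B.JetInf) (ζ : Fin 0 → Tangent (smoothInf B) q'), φ q' ζ = φ q' ![] :=
      fun q' ζ => congrArg _ (Subsingleton.elim _ _)
    rw [h7]
    refine (h8.symm.trans h6).trans ?_
    exact (h7 _ fun a => pushforward (isSmoothMap_htpy (hs := hs) 0) q (ξ a)).symm
  | n + 1, m, φ, hb, hφ, ⟨_, _, η, hη, hd⟩ => by
    rw [zero_add] at hd
    have h1 := IsExtDeriv.htpyOp (hs := hs) hφ hη.1 hd 0 1
    rw [pullback_htpy_one rfl, hb.htpyOp_eq_zero hφ, hη.2.htpyOp_eq_zero hη.1, sub_zero] at h1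
    exact sub_eq_zero.mp (IsExtDeriv.eq_zero h1)

lemma isBidegree_pullbackBase {m : ℕ} (α : Form (smoothX E X) m) :
    IsBidegree 0 m (B.pullbackBase α) := by
  refine ⟨(zero_add m).symm, fun q ξ A hA => ?_⟩
  rcases hA with ⟨h1, h2⟩ | ⟨h1, -⟩
  · obtain ⟨a, ha⟩ := Finset.card_pos.mp h1
    exact (α (toBase q)).map_coord_zero (m := fun a => pushforward isSmoothMap_toBase q (ξ a)) a
      (h2 a ha)
  · have := Finset.card_le_univ A
    rw [Fintype.card_fin] at this
    omega

lemma isBidegree_zero {k m : ℕ} (h : n = k + m) : IsBidegree k m (0 : B.InfForm n) :=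
  ⟨h, fun _ _ _ _ => rfl⟩

lemma isLocallyPullbackForm_zero : IsLocallyPullbackForm (0 : B.InfForm n) :=
  isLocallyPullbackForm_iff.mpr fun q => ⟨0, pullbackNear_zero 0 q⟩

lemma isVerticalDiff_pullbackBase {m : ℕ} {α : Form (smoothX E X) m}
    (hα : IsSmoothFormOn (smoothX E X) univ α) : IsVerticalDiff 0 m (B.pullbackBase α) 0 := by
  obtain ⟨ψ, hψ⟩ := exists_isExtDeriv_base B hα
  refine ⟨⟨(isPullbackForm_pullbackBase hα).isLocallyPullbackForm, isBidegree_pullbackBase α⟩,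
    ⟨isLocallyPullbackForm_zero, isBidegree_zero (by omega)⟩, B.pullbackBase ψ,
    ⟨(isPullbackForm_pullbackBase (IsExtDeriv.isSmoothFormOn hψ).2).isLocallyPullbackForm,
      isBidegree_pullbackBase ψ⟩, ?_⟩
  rw [zero_add]
  exact IsExtDeriv.pullbackBase hψ

lemma htpyOp_zero (a b : ℝ) : htpyOp s hs a b (0 : B.InfForm (n + 1)) = 0 := by
  funext q
  ext ξ
  rw [isLocallyPullbackForm_zero.htpyOp_apply]
  exact intervalIntegral.integral_zero

/-- Both complexes are treated at once: A is any family between `MemO` and `MemQ` that is stable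
under the homotopy operator. -/
lemma verticalComplexExact {A : ℕ → ℕ → ∀ {n : ℕ}, B.InfForm n → Prop} (s : B.LocalSection)
    (hs : s.dom = univ) (hAQ : ∀ {k m n : ℕ} {φ : B.InfForm n}, A k m φ → MemQ k m φ)
    (hOA : ∀ {k m n : ℕ} {φ : B.InfForm n}, MemO k m φ → A k m φ)
    (hA : ∀ {k m n : ℕ} {φ : B.InfForm (n + 1)}, A (k + 1) m φ → A k m (htpyOp s hs 0 1 φ))
    (m : ℕ) : B.VerticalComplexExact A m := by
  refine ⟨fun α α' _ _ h => pullbackBase_injective s hs h, fun α hα =>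
    ⟨hOA ⟨isPullbackForm_pullbackBase hα, isBidegree_pullbackBase α⟩,
      isVerticalDiff_pullbackBase hα⟩, fun φ hφ hd => ?_, fun k n φ hφ hd =>
    ⟨htpyOp s hs 0 1 φ, hA hφ, ?_⟩⟩
  · refine ⟨pullback (isSmoothMap_secInf s hs) φ, isSmoothFormOn_iff.mpr fun x _ => ?_, ?_⟩
    · obtain ⟨_, _, η, _, h1⟩ := hd
      obtain ⟨J, f, g, h2⟩ := isSmoothFormOn_iff.mp (IsExtDeriv.isSmoothFormOn h1).1 (secInf s hs x)
        (mem_univ _)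
      exact ⟨J, _, _, ((continuous_secInf s hs).continuousAt.eventually h2).mono fun _ h3 =>
        IsExprAt.pullback (isSmoothMap_secInf s hs) h3⟩
    · exact (eq_pullback_htpy_zero (hs := hs) (hAQ hφ).2 (hAQ hφ).1 hd).trans
        (pullback_htpy_zero_eq rfl φ)
  -- With ψ = 0 the homotopy identity says that `htpyOp s hs 0 1 φ` is a primitive of φ.
  · have := hd.htpyOp (hs := hs)
    rwa [htpyOp_zero, sub_zero] at this

end AffineBundle

/-! ### Existence of global sections -/

/-- A connected, paracompact, locally compact Hausdorff space is a countable union of compact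
sets. -/
theorem sigmaCompactSpace_of_connected_of_paracompact (X : Type*) [TopologicalSpace X]
    [LocallyCompactSpace X] [T2Space X] [ParacompactSpace X] [ConnectedSpace X] :
    SigmaCompactSpace X := by
  choose K hK hxK using fun x : X => exists_compact_mem_nhds x
  obtain ⟨v, hvo, hvc, hvf, hvK⟩ := precise_refinement (fun x => interior (K x))
    (fun x => isOpen_interior)
    (iUnion_eq_univ_iff.mpr fun x => ⟨x, mem_interior_iff_mem_nhds.mpr (hxK x)⟩)
  -- A compact set meets only finitely many members of the locally finite cover v, and each of these
  -- lies in a compact set K i.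
  have hstep : ∀ C : {C : Set X // IsCompact C}, ∃ C' : {C : Set X // IsCompact C},
      ∀ i, (v i ∩ C.1).Nonempty → v i ⊆ C'.1 := fun C =>
    ⟨⟨⋃ i ∈ {i | (v i ∩ C.1).Nonempty}, K i,
      (hvf.finite_nonempty_inter_compact C.2).isCompact_biUnion fun i _ => hK i⟩,
      fun i hi => ((hvK i).trans interior_subset).trans
        (subset_biUnion_of_mem (u := K) (show i ∈ {i | (v i ∩ C.1).Nonempty} from hi))⟩
  choose T hT using hstep
  obtain ⟨x₀⟩ := (inferInstance : Nonempty X)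
  let C : ℕ → {C : Set X // IsCompact C} := fun n => T^[n] ⟨{x₀}, isCompact_singleton⟩
  have hC : ∀ n i, (v i ∩ (C n).1).Nonempty → v i ⊆ (C (n + 1)).1 := fun n i hi => by
    have := hT (C n) i hi
    simpa only [C, Function.iterate_succ_apply'] using this
  -- The union of the iterates contains every v i that it meets, so both it and its complement are
  -- open.
  have hcl : IsClopen (⋃ n, (C n).1) := by
    refine ⟨isClosed_of_closure_subset fun x hx => ?_, isOpen_iff_mem_nhds.mpr fun x hx => ?_⟩
    · obtain ⟨i, hi⟩ := iUnion_eq_univ_iff.mp hvc x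
      obtain ⟨y, hy, hyC⟩ := mem_closure_iff.mp hx (v i) (hvo i) hi
      obtain ⟨n, hn⟩ := mem_iUnion.mp hyC
      exact mem_iUnion.mpr ⟨n + 1, hC n i ⟨y, hy, hn⟩ hi⟩
    · obtain ⟨i, hi⟩ := iUnion_eq_univ_iff.mp hvc x
      obtain ⟨n, hn⟩ := mem_iUnion.mp hx
      exact Filter.mem_of_superset ((hvo i).mem_nhds hi)
        ((hC n i ⟨x, hi, hn⟩).trans (subset_iUnion (fun n => (C n).1) (n + 1)))
  have hu := hcl.eq_univ ⟨x₀, mem_iUnion.mpr ⟨0, rfl⟩⟩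
  rw [← isSigmaCompact_univ_iff, ← hu]
  exact isSigmaCompact_iUnion_of_isCompact _ fun n => (C n).2

namespace AffineBundle

variable {E E' F X Y : Type*}
  [NormedAddCommGroup E] [NormedSpace ℝ E] [FiniteDimensional ℝ E]
  [NormedAddCommGroup E'] [NormedSpace ℝ E']
  [NormedAddCommGroup F] [NormedSpace ℝ F] [FiniteDimensional ℝ F]
  [TopologicalSpace X] [ChartedSpace E X] [IsManifold 𝓘(ℝ, E) ∞ X]
  [TopologicalSpace Y] [ChartedSpace E' Y] [IsManifold 𝓘(ℝ, E') ∞ Y]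
  {B : AffineBundle E E' F X Y}

lemma symm_snd_apply (e : Bundle.Trivialization F B.proj) {p : Y} (hp : B.proj p ∈ e.baseSet) :
    e.toOpenPartialHomeomorph.symm (B.proj p, (e p).2) = p := by
  have h : e p = (B.proj p, (e p).2) := Prod.ext (e.coe_fst (e.mem_source.mpr hp)) rfl
  rw [← h]
  exact e.left_inv (e.mem_source.mpr hp)

lemma _root_.AffineMap.map_sum_smul_of_sum_eq_one {ι : Type*} (a : F →ᵃ[ℝ] F) (I : Finset ι)
    (w : ι → ℝ) (hw : ∑ i ∈ I, w i = 1) (v : ι → F) :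
    a (∑ i ∈ I, w i • v i) = ∑ i ∈ I, w i • a (v i) := by
  have h : ∀ v, a v = a.linear v + a 0 := fun v => by
    have := a.map_vadd 0 v
    simpa using this
  rw [h, map_sum]
  simp only [map_smul, h (v _), smul_add, Finset.sum_add_distrib, ← Finset.sum_smul, hw, one_smul]

/-- An affine bundle over a connected paracompact Hausdorff manifold has a smooth section. -/
theorem exists_globalSection [T2Space X] [ParacompactSpace X] [ConnectedSpace X] :
    ∃ s : B.LocalSection, s.dom = univ := by
  have : LocallyCompactSpace X := ChartedSpace.locallyCompactSpace E X
  have : SigmaCompactSpace X := sigmaCompactSpace_of_connected_of_paracompact X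
  choose e he hxe using B.exists_mem
  obtain ⟨ρ, hρ⟩ := SmoothPartitionOfUnity.exists_isSubordinate 𝓘(ℝ, E) (isClosed_univ (X := X))
    (fun x => (e x).baseSet) (fun x => (e x).open_baseSet)
    (fun x _ => mem_iUnion.mpr ⟨x, hxe x⟩)
  have hσ : ∀ i, ∃ σ : B.LocalSection, σ.dom = (e i).baseSet := fun i => by
    obtain ⟨σ, h, -⟩ := exists_localSection_of_contMDiffOn (he i) (e i).open_baseSet Subset.rfl
      (v := fun _ => (0 : F)) contMDiffOn_const
    exact ⟨σ, h⟩
  choose σ hσ using hσ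
  -- The fibre coordinate, in the trivialization e', of the affine combination of the local sections
  -- σ i with weights ρ i. Values of σ i outside its domain have weight zero.
  let f : Bundle.Trivialization F B.proj → X → F := fun e' y =>
    ∑ᶠ i, ρ i y • (e' ((σ i).toFun y)).2
  have hfs : ∀ e' y, f e' y = ∑ i ∈ ρ.finsupport y, ρ i y • (e' ((σ i).toFun y)).2 :=
    fun e' y => (ρ.sum_finsupport_smul_eq_finsum y fun i y => (e' ((σ i).toFun y)).2).symm
  have hmem : ∀ i y, ρ i y ≠ 0 → y ∈ (σ i).dom := fun i y h =>
    hσ i ▸ hρ i (subset_tsupport _ h)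
  -- The weights sum to 1 and the transition maps are affine, so the combination does not depend on
  -- the trivialization.
  have hf : ∀ e₁ ∈ B.atlas, ∀ e₂ ∈ B.atlas, ∀ y ∈ e₁.baseSet ∩ e₂.baseSet,
      e₁.toOpenPartialHomeomorph.symm (y, f e₁ y) =
        e₂.toOpenPartialHomeomorph.symm (y, f e₂ y) := by
    intro e₁ h₁ e₂ h₂ y hy
    obtain ⟨a, ha⟩ := B.affine e₁ h₁ e₂ h₂ y hy
    have hp : B.proj (e₁.toOpenPartialHomeomorph.symm (y, f e₁ y)) = y :=
      e₁.proj_symm_apply' hy.1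
    have key : (e₂ (e₁.toOpenPartialHomeomorph.symm (y, f e₁ y))).2 = f e₂ y := by
      rw [ha]
      rw [hfs e₁, hfs e₂, a.map_sum_smul_of_sum_eq_one _ _ (ρ.sum_finsupport y (mem_univ y))]
      refine Finset.sum_congr rfl fun i hi => ?_
      have hiy := hmem i y ((ρ.mem_finsupport y).mp hi)
      have hq := (σ i).proj_eq y hiy
      rw [← ha]
      have := symm_snd_apply e₁ (p := (σ i).toFun y) (by rw [hq]; exact hy.1)
      rw [hq] at this
      rw [this]
    have := symm_snd_apply e₂ (p := e₁.toOpenPartialHomeomorph.symm (y, f e₁ y))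
      (by rw [hp]; exact hy.2)
    rw [hp, key] at this
    exact this.symm
  -- The trivialization used varies with the point y, without any continuity; smoothness at x is
  -- checked by passing to the fixed trivialization e x through `hf`.
  refine ⟨⟨univ, isOpen_univ, fun y => (e y).toOpenPartialHomeomorph.symm (y, f (e y) y), ?_,
    fun y _ => (e y).proj_symm_apply' (hxe y)⟩, rfl⟩
  intro x _
  refine ContMDiffAt.contMDiffWithinAt ?_
  have hfx : ContMDiffAt 𝓘(ℝ, E) 𝓘(ℝ, F) ∞ (f (e x)) x := by
    refine ρ.contMDiffAt_finsum fun i hi => ?_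
    have hx : x ∈ (σ i).dom := hσ i ▸ hρ i hi
    exact ((σ i).smooth_snd (he x)).contMDiffAt
      (((σ i).isOpen_dom.inter (e x).open_baseSet).mem_nhds ⟨hx, hxe x⟩)
  have h1 : ContMDiffAt 𝓘(ℝ, E) 𝓘(ℝ, E') ∞
      (fun y => (e x).toOpenPartialHomeomorph.symm (y, f (e x) y)) x :=
    ContMDiffAt.comp x ((B.smooth_symm (e x) (he x)).contMDiffAt
      ((e x).open_target.mem_nhds ((e x).mem_target.mpr (hxe x)))) (contMDiffAt_id.prodMk hfx)
  refine h1.congr_of_eventuallyEq ?_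
  filter_upwards [(e x).open_baseSet.mem_nhds (hxe x)] with y hy
  exact hf _ (he y) _ (he x) y ⟨hxe y, hy⟩

end AffineBundle

end

/-! ### The main theorem -/

theorem mainTheorem6 {E E' F X Y : Type*}
    [NormedAddCommGroup E] [NormedSpace ℝ E] [FiniteDimensional ℝ E]
    [NormedAddCommGroup E'] [NormedSpace ℝ E'] [FiniteDimensional ℝ E']
    [NormedAddCommGroup F] [NormedSpace ℝ F] [FiniteDimensional ℝ F]
    [TopologicalSpace X] [ChartedSpace E X] [IsManifold 𝓘(ℝ, E) ∞ X]
    [T2Space X] [ParacompactSpace X] [ConnectedSpace X]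
    [TopologicalSpace Y] [ChartedSpace E' Y] [IsManifold 𝓘(ℝ, E') ∞ Y]
    (B : AffineBundle E E' F X Y) :
    -- the vertical complexes of locally pull-back forms and of pull-back forms are exact
    (∀ m : ℕ, B.VerticalComplexExact AffineBundle.MemQ m) ∧
    (∀ m : ℕ, B.VerticalComplexExact AffineBundle.MemO m) ∧
    -- global sections exist, and each of them gives a global homotopy operator
    (∃ s : B.LocalSection, s.dom = univ) ∧
    (∀ (s : B.LocalSection) (hs : s.dom = univ),
      ∃ h : ∀ _ n : ℕ, B.InfForm (n + 1) → B.InfForm n,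
        ∀ (k m n : ℕ) (φ : B.InfForm (n + 1)), AffineBundle.MemQ (k + 1) m φ →
          AffineBundle.MemQ k m (h k n φ) ∧
          (AffineBundle.MemO (k + 1) m φ → AffineBundle.MemO k m (h k n φ)) ∧
          AffineBundle.IsHomotopyIntegral s hs k φ (h k n φ) ∧
          ∀ ψ : B.InfForm (n + 2), AffineBundle.IsVerticalDiff (k + 1) m φ ψ →
            AffineBundle.IsVerticalDiff k m (h k n φ) (φ - h (k + 1) (n + 1) ψ)) := by
  obtain ⟨s, hs⟩ := AffineBundle.exists_globalSection (B := B)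
  refine ⟨fun m => AffineBundle.verticalComplexExact s hs id
      (fun h => ⟨h.1.isLocallyPullbackForm, h.2⟩)
      (fun h => ⟨h.1.htpyOp 0 1, h.2.htpyOp h.1 0 1⟩) m,
    fun m => AffineBundle.verticalComplexExact s hs
      (fun h => ⟨h.1.isLocallyPullbackForm, h.2⟩) id
      (fun h => ⟨h.1.htpyOp 0 1, h.2.htpyOp h.1.isLocallyPullbackForm 0 1⟩) m,
    -- One operator serves all contact degrees: the power of t in the explicit formula is produced
    -- by the pull-back and not put in by hand.
    ⟨s, hs⟩, fun s hs => ⟨fun _ _ => AffineBundle.htpyOp s hs 0 1, fun k m n φ h => ?_⟩⟩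
  exact ⟨⟨h.1.htpyOp 0 1, h.2.htpyOp h.1 0 1⟩,
    fun h' => ⟨h'.1.htpyOp 0 1, h'.2.htpyOp h.1 0 1⟩,
    AffineBundle.isHomotopyIntegral_htpyOp h.1 h.2,
    fun ψ hψ => AffineBundle.IsVerticalDiff.htpyOp hψ⟩
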